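/- Let $\mathfrak g$ be a finite-dimensional complex simple Lie algebra, $\mathfrak h$ a Cartan subalgebra, $\Delta$ the root system, $\Delta^+\subset\Delta$ the positive system given by a base, $\rho=\frac12\sum_{\alpha\in\Delta^+}\alpha$, and $\mathfrak g=\bar{\mathfrak n}\oplus\mathfrak h\oplus\mathfrak n$ the corresponding triangular decomposition, with $\mathfrak n=\bigoplus_{\alpha\in\Delta^+}\mathfrak g_\alpha$ and $\bar{\mathfrak n}=\bigoplus_{\alpha\in\Delta^+}\mathfrak g_{-\alpha}$; write $a_{\bar{\mathfrak n}}$ and $a_{\mathfrak h}$ for the components of $a\in\mathfrak g$. Let $\theta\in\Delta^+$ be the maximal root (the highest weight of the adjoint representation) and let $\{f_\alpha\}_{\alpha\in\Delta^+}$ be a basis of $\bar{\mathfrak n}$ with $f_\alpha\in\mathfrak g_{-\alpha}$; $[\,\cdot\,]_\alpha$ denotes the $\alpha$-th coordinate with respect to it. Let $\mathcal A$ be the Weyl algebra generated by $x_\alpha,\partial_{x_\alpha}$ ($\alpha\in\Delta^+$) with the canonical commutation relations, and let $u(x)=\sum_{\alpha\in\Delta^+}x_\alpha f_\alpha\in\mathbb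 C[x]\otimes\mathfrak g$, so that $\operatorname{ad}(u(x))$ is a nilpotent operator on $\mathbb C[x]\otimes\mathfrak g$. For $\lambda\in\mathfrak h^*$ and $a\in\mathfrak g$ put $$\pi_\lambda(a)=-\sum_{\alpha\in\Delta^+}\Big[\tfrac{\operatorname{ad}(u(x))e^{\operatorname{ad}(u(x))}}{e^{\operatorname{ad}(u(x))}-\operatorname{id}}\,(e^{-\operatorname{ad}(u(x))}a)_{\bar{\mathfrak n}}\Big]_\alpha\partial_{x_\alpha}+(\lambda+\rho)\big((e^{-\operatorname{ad}(u(x))}a)_{\mathfrak h}\big)\in\mathcal A .$$ Let $\mathcal I$ be the left ideal of $\mathcal A$ generated by $x_\alpha$ ($\alpha\in\Delta^+\setminus\{\theta\}$) and $\partial_{x_\theta}$. Let $\mathfrak s_\theta\cong\mathfrak{sl}(2,\mathbb C)$ be the Lie subalgebra spanned by an $\mathfrak{sl}_2$-triple $(e,h,f)$ with $e\in\mathfrak g_\theta$, $f\in\mathfrak g_{-\theta}$, and let $\Gamma_\theta\subset U(\mathfrak g)$ be the subalgebra generated by $\mathfrak h$ and the center of $U(\mathfrak s_\theta)$. For a $\mathfrak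 g$-module $M$ and a character (algebra homomorphism) $\chi:\Gamma_\theta\to\mathbb C$ let $M_\chi=\{v\in M:\ \exists k\in\mathbb N\ \forall a\in\Gamma_\theta\ (a-\chi(a))^kv=0\}$ be the $\Gamma_\theta$-weight space. **Theorem.** Let $\lambda\in\mathfrak h^*$. Then: 1. $\Gamma_\theta$ is commutative. 2. The canonical linear map $\mathbb C[\partial_{x_\alpha}\,(\alpha\in\Delta^+\setminus\{\theta\}),\,x_\theta]\to\mathcal A/\mathcal I$, sending a polynomial to its class, is bijective. 3. $\pi_{\lambda+\rho}:\mathfrak g\to\mathcal A$ is a homomorphism of Lie algebras. 4. Let $W(\lambda)=\mathcal A/\mathcal I$, with $a\in\mathfrak g$ acting as left multiplication by $\pi_{\lambda+\rho}(a)$. Then $W(\lambda)$ is the direct sum of its $\mathfrak h$-weight spaces $\{v:\ hv=\mu(h)v\ \forall h\in\mathfrak h\}$, $\mu\in\mathfrak h^*$; it is a cyclic $\mathfrak g$-module (generated by one vector); it is the direct sum of its $\Gamma_\theta$-weight spaces $W(\lambda)_\chi$; and $\dim W(\lambda)_\chi<\infty$ for every character $\chi$ of $\Gamma_\theta$. 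-/

import Mathlib

open scoped TensorProduct
open Module LieAlgebra LieAlgebra.IsKilling

attribute [local instance 100] LieRing.ofAssociativeRing

set_option linter.unusedSectionVars false

noncomputable section

namespace ThetaGT

/-! ### Polynomials evaluated at a commuting family -/

section CommEval

variable {σ R : Type*} [Ring R] [Algebra ℂ R]

open scoped IsMulCommutative in
/-- The algebra homomorphism `ℂ[X_i] → R` with `X_i ↦ c i`, for a family `c` of pairwise commuting
elements of a possibly noncommutative algebra `R`. -/
def commEval (c : σ → R) (hc : ∀ i j, c i * c j = c j * c i) : MvPolynomial σ ℂ →ₐ[ℂ] R :=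
  have : IsMulCommutative (Algebra.adjoin ℂ (Set.range c)) :=
    Algebra.isMulCommutative_adjoin ℂ (by rintro _ ⟨i, rfl⟩ _ ⟨j, rfl⟩; exact hc i j)
  (Algebra.adjoin ℂ (Set.range c)).val.comp
    (MvPolynomial.aeval fun i ↦ ⟨c i, Algebra.subset_adjoin ⟨i, rfl⟩⟩)

@[simp] lemma commEval_X (c : σ → R) (hc : ∀ i j, c i * c j = c j * c i) (i : σ) :
    commEval c hc (MvPolynomial.X i) = c i := by
  simp [commEval]

end CommEval

/-! ### The Weyl algebra -/

section Weyl

/-- The canonical commutation relations; `Sum.inl i` stands for `x_i` and `Sum.inr i` for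
`∂_{x_i}`. -/
inductive WeylRel (σ : Type*) : FreeAlgebra ℂ (σ ⊕ σ) → FreeAlgebra ℂ (σ ⊕ σ) → Prop
  | x_x (i j : σ) : WeylRel σ
      (FreeAlgebra.ι ℂ (Sum.inl i) * FreeAlgebra.ι ℂ (Sum.inl j))
      (FreeAlgebra.ι ℂ (Sum.inl j) * FreeAlgebra.ι ℂ (Sum.inl i))
  | d_d (i j : σ) : WeylRel σ
      (FreeAlgebra.ι ℂ (Sum.inr i) * FreeAlgebra.ι ℂ (Sum.inr j))
      (FreeAlgebra.ι ℂ (Sum.inr j) * FreeAlgebra.ι ℂ (Sum.inr i))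
  | d_x_self (i : σ) : WeylRel σ
      (FreeAlgebra.ι ℂ (Sum.inr i) * FreeAlgebra.ι ℂ (Sum.inl i))
      (FreeAlgebra.ι ℂ (Sum.inl i) * FreeAlgebra.ι ℂ (Sum.inr i) + 1)
  | d_x_ne (i j : σ) (hij : i ≠ j) : WeylRel σ
      (FreeAlgebra.ι ℂ (Sum.inr i) * FreeAlgebra.ι ℂ (Sum.inl j))
      (FreeAlgebra.ι ℂ (Sum.inl j) * FreeAlgebra.ι ℂ (Sum.inr i))

/-- The complex Weyl algebra with generators `x_i`, `∂_{x_i}` for `i : σ`. -/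
def Weyl (σ : Type*) : Type _ := RingQuot (WeylRel σ)

variable {σ : Type*}

instance : Ring (Weyl σ) := inferInstanceAs (Ring (RingQuot (WeylRel σ)))

instance : Algebra ℂ (Weyl σ) := inferInstanceAs (Algebra ℂ (RingQuot (WeylRel σ)))

/-- The quotient map from the free algebra. -/
def Weyl.mk : FreeAlgebra ℂ (σ ⊕ σ) →ₐ[ℂ] Weyl σ := RingQuot.mkAlgHom ℂ (WeylRel σ)

lemma Weyl.mk_rel {p q : FreeAlgebra ℂ (σ ⊕ σ)} (h : WeylRel σ p q) : Weyl.mk p = Weyl.mk q :=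
  RingQuot.mkAlgHom_rel ℂ h

/-- The generator `x_i`. -/
def Weyl.x (i : σ) : Weyl σ := Weyl.mk (FreeAlgebra.ι ℂ (Sum.inl i))

/-- The generator `∂_{x_i}`. -/
def Weyl.d (i : σ) : Weyl σ := Weyl.mk (FreeAlgebra.ι ℂ (Sum.inr i))

lemma Weyl.x_mul_x (i j : σ) : Weyl.x i * Weyl.x j = Weyl.x j * Weyl.x i := by
  simpa [Weyl.x, Weyl.d] using Weyl.mk_rel (WeylRel.x_x i j)

lemma Weyl.d_mul_d (i j : σ) : Weyl.d i * Weyl.d j = Weyl.d j * Weyl.d i := by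
  simpa [Weyl.x, Weyl.d] using Weyl.mk_rel (WeylRel.d_d i j)

lemma Weyl.d_mul_x_self (i : σ) : Weyl.d i * Weyl.x i = Weyl.x i * Weyl.d i + 1 := by
  simpa [Weyl.x, Weyl.d] using Weyl.mk_rel (WeylRel.d_x_self i)

lemma Weyl.d_mul_x_of_ne {i j : σ} (hij : i ≠ j) :
    Weyl.d i * Weyl.x j = Weyl.x j * Weyl.d i := by
  simpa [Weyl.x, Weyl.d] using Weyl.mk_rel (WeylRel.d_x_ne i j hij)

/-- The embedding of the polynomials `ℂ[x_i]` into the Weyl algebra. -/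
def Weyl.ofPoly : MvPolynomial σ ℂ →ₐ[ℂ] Weyl σ := commEval Weyl.x Weyl.x_mul_x

/-- The left ideal generated by `x_α` for `α ≠ θ` and by `∂_{x_θ}`. -/
def gtIdeal (θ : σ) : Submodule (Weyl σ) (Weyl σ) :=
  Submodule.span (Weyl σ) ({w | ∃ α, α ≠ θ ∧ w = Weyl.x α} ∪ {Weyl.d θ})

open Classical in
/-- The commuting elements `∂_{x_α}`, `α ≠ θ`, and `x_θ`. -/
def gtVar (θ α : σ) : Weyl σ := if α = θ then Weyl.x α else Weyl.d α

lemma gtVar_mul_gtVar (θ α β : σ) : gtVar θ α * gtVar θ β = gtVar θ β * gtVar θ α := by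
  unfold gtVar
  split_ifs with h₁ h₂ h₂
  · exact Weyl.x_mul_x _ _
  · exact (Weyl.d_mul_x_of_ne (by rw [h₁]; exact h₂)).symm
  · exact Weyl.d_mul_x_of_ne (by rw [h₂]; exact h₁)
  · exact Weyl.d_mul_d _ _

/-- The canonical map from the polynomial algebra `ℂ[∂_{x_α} (α ≠ θ), x_θ]` to the quotient of the
Weyl algebra by the left ideal `gtIdeal θ`: a polynomial is sent to its class. -/
def gtPolyMap (θ : σ) : MvPolynomial σ ℂ →ₗ[ℂ] Weyl σ ⧸ gtIdeal θ :=
  ((gtIdeal θ).mkQ.restrictScalars ℂ) ∘ₗ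
    (commEval (gtVar θ) (gtVar_mul_gtVar θ)).toLinearMap

end Weyl

/-! ### Modules -/

section Modules

variable {g : Type*} [LieRing g] [LieAlgebra ℂ g]

/-- The quotient of the Weyl algebra by the left ideal `gtIdeal θ`, on which `a : g` acts as left
multiplication by `Φ a`. -/
def GTModule {σ : Type*} (θ : σ) (_Φ : g →ₗ⁅ℂ⁆ Weyl σ) : Type _ := Weyl σ ⧸ gtIdeal θ

section

variable {σ : Type*} (θ : σ) (Φ : g →ₗ⁅ℂ⁆ Weyl σ)

instance : AddCommGroup (GTModule θ Φ) := inferInstanceAs (AddCommGroup (Weyl σ ⧸ gtIdeal θ))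

instance : Module (Weyl σ) (GTModule θ Φ) := inferInstanceAs (Module (Weyl σ) (Weyl σ ⧸ gtIdeal θ))

instance : Module ℂ (GTModule θ Φ) := inferInstanceAs (Module ℂ (Weyl σ ⧸ gtIdeal θ))

instance : IsScalarTower ℂ (Weyl σ) (GTModule θ Φ) :=
  inferInstanceAs (IsScalarTower ℂ (Weyl σ) (Weyl σ ⧸ gtIdeal θ))

instance : LieRingModule g (GTModule θ Φ) where
  bracket a w := Φ a • w
  add_lie a b w := by simp [add_smul]
  lie_add a v w := by simp
  leibniz_lie a b w := by simp [LieRing.of_associative_ring_bracket, sub_smul, mul_smul]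

lemma GTModule.lie_def (a : g) (w : GTModule θ Φ) : ⁅a, w⁆ = Φ a • w := rfl

instance : LieModule ℂ g (GTModule θ Φ) where
  smul_lie t a w := by simp [GTModule.lie_def]
  lie_smul t a w := by
    rw [GTModule.lie_def, GTModule.lie_def, ← algebraMap_smul (Weyl σ) t w,
      ← algebraMap_smul (Weyl σ) t (Φ a • w), ← mul_smul, ← mul_smul, Algebra.commutes]

end

variable (M : Type*) [AddCommGroup M] [Module ℂ M] [LieRingModule g M] [LieModule ℂ g M]

open Classical in
/-- `M` is the direct sum of its weight spaces with respect to the Cartan subalgebra `H`. -/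
def IsWeightModule (H : LieSubalgebra ℂ g) [LieRing.IsNilpotent H] : Prop :=
  DirectSum.IsInternal fun μ : Dual ℂ H ↦ (LieModule.weightSpace M (μ : H → ℂ)).toSubmodule

/-- `M` is generated, as a Lie module, by a single vector. -/
def IsCyclicModule (g M : Type*) [LieRing g] [LieAlgebra ℂ g] [AddCommGroup M] [Module ℂ M]
    [LieRingModule g M] [LieModule ℂ g M] : Prop :=
  ∃ v : M, LieSubmodule.lieSpan ℂ g {v} = ⊤

/-- The action of the universal enveloping algebra on a Lie module. -/
def envelopingAction (g M : Type*) [LieRing g] [LieAlgebra ℂ g] [AddCommGroup M] [Module ℂ M]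
    [LieRingModule g M] [LieModule ℂ g M] :
    UniversalEnvelopingAlgebra ℂ g →ₐ[ℂ] Module.End ℂ M :=
  UniversalEnvelopingAlgebra.lift ℂ (LieModule.toEnd ℂ g M)

/-- The `Γ`-weight space `M_χ`: the vectors `v` for which there is a `k` with
`(a - χ(a))^k v = 0` for all `a ∈ Γ`. -/
def gammaWeightSpace (Γ : Subalgebra ℂ (UniversalEnvelopingAlgebra ℂ g)) (χ : Γ →ₐ[ℂ] ℂ) :
    Submodule ℂ M where
  carrier := {v | ∃ k : ℕ, ∀ a : Γ,
    ((envelopingAction g M a - algebraMap ℂ (Module.End ℂ M) (χ a)) ^ k) v = 0}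
  zero_mem' := ⟨0, fun a ↦ by simp⟩
  add_mem' := by
    rintro v w ⟨k, hk⟩ ⟨l, hl⟩
    refine ⟨k + l, fun a ↦ ?_⟩
    have h₁ := hk a
    have h₂ := hl a
    rw [map_add]
    nth_rewrite 1 [add_comm k l]
    rw [pow_add, pow_add, Module.End.mul_apply, Module.End.mul_apply, h₁, h₂]
    simp
  smul_mem' := by
    rintro c v ⟨k, hk⟩
    exact ⟨k, fun a ↦ by rw [map_smul, hk a, smul_zero]⟩

open Classical in
/-- `M` is the direct sum of its `Γ`-weight spaces. -/
def IsGammaWeightModule (Γ : Subalgebra ℂ (UniversalEnvelopingAlgebra ℂ g)) : Prop :=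
  DirectSum.IsInternal fun χ : Γ →ₐ[ℂ] ℂ ↦ gammaWeightSpace M Γ χ

/-- All `Γ`-weight spaces of `M` are finite-dimensional. -/
def HasFiniteGammaMultiplicities (Γ : Subalgebra ℂ (UniversalEnvelopingAlgebra ℂ g)) : Prop :=
  ∀ χ : Γ →ₐ[ℂ] ℂ, FiniteDimensional ℂ (gammaWeightSpace M Γ χ)

end Modules

/-! ### Triangular decomposition -/

section Simple

variable {g : Type*} [LieRing g] [LieAlgebra ℂ g] [FiniteDimensional ℂ g] [LieAlgebra.IsSimple ℂ g]
  {H : LieSubalgebra ℂ g} [H.IsCartanSubalgebra]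

/-- The positive roots determined by a base of the root system. -/
abbrev PosRoot (b : (rootSystem H).Base) : Type _ := {α : H.root // b.IsPos α}

instance (b : (rootSystem H).Base) : Fintype (PosRoot b) := Fintype.ofFinite _

/-- The root underlying a positive root, as a linear form on `H`. -/
def PosRoot.form {b : (rootSystem H).Base} (α : PosRoot b) : Dual ℂ H := (rootSystem H).root α.1

/-- `θ` is the highest weight of the adjoint representation: adding a positive root to the root `θ`
never gives a root. -/
def IsMaximalRoot {b : (rootSystem H).Base} (θ : PosRoot b) : Prop :=
  ∀ (α : PosRoot b) (β : H.root), (rootSystem H).root β ≠ α.form + θ.form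

/-- Half the sum of the positive roots. -/
def rho (b : (rootSystem H).Base) : Dual ℂ H := (1 / 2 : ℂ) • ∑ α : PosRoot b, α.form

/-- The nilradical `n`, the sum of the positive root spaces. -/
def nil (b : (rootSystem H).Base) : Submodule ℂ g :=
  ⨆ α : PosRoot b, (rootSpace H (α.form : H → ℂ)).toSubmodule

/-- The opposite nilradical, the sum of the negative root spaces. -/
def nilBar (b : (rootSystem H).Base) : Submodule ℂ g :=
  ⨆ α : PosRoot b, (rootSpace H (-(α.form : H → ℂ))).toSubmodule

lemma isCompl_iSup_rootSpace {S T : Set (H → ℂ)} (hST : Disjoint S T)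
    (h : ∀ χ : H → ℂ, rootSpace H χ ≠ ⊥ → χ ∈ S ∪ T) :
    IsCompl (⨆ χ ∈ S, (rootSpace H χ).toSubmodule) (⨆ χ ∈ T, (rootSpace H χ).toSubmodule) := by
  constructor
  · exact (LieSubmodule.iSupIndep_toSubmodule.mpr
      (LieModule.iSupIndep_genWeightSpace ℂ H g)).disjoint_biSup_biSup hST
  · rw [codisjoint_iff, eq_top_iff, ← iSup_union]
    rw [← LieSubmodule.iSup_toSubmodule_eq_top.mpr (LieModule.iSup_genWeightSpace_eq_top ℂ H g)]
    refine iSup_le fun χ ↦ ?_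
    by_cases hχ : rootSpace H χ = ⊥
    · simp [hχ]
    · exact le_biSup (fun χ : H → ℂ ↦ (rootSpace H χ).toSubmodule) (h χ hχ)

lemma nil_eq (b : (rootSystem H).Base) :
    nil b = ⨆ χ ∈ Set.range fun α : PosRoot b ↦ (α.form : H → ℂ),
      (rootSpace H χ).toSubmodule := by
  rw [iSup_range, nil]

lemma nilBar_eq (b : (rootSystem H).Base) :
    nilBar b = ⨆ χ ∈ Set.range fun α : PosRoot b ↦ -(α.form : H → ℂ),
      (rootSpace H χ).toSubmodule := by
  rw [iSup_range, nilBar]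

lemma cartan_eq : H.toSubmodule = (rootSpace H (0 : H → ℂ)).toSubmodule := by
  rw [rootSpace_zero_eq]; rfl

lemma PosRoot.form_ne_zero {b : (rootSystem H).Base} (α : PosRoot b) : (α.form : H → ℂ) ≠ 0 := by
  intro h
  exact (rootSystem H).ne_zero α.1 (DFunLike.coe_injective h)

lemma root_indexNeg (i : H.root) :
    letI := (rootSystem H).indexNeg
    (rootSystem H).root (-i) = -(rootSystem H).root i := by
  rw [RootPairing.indexNeg_neg, RootPairing.root_reflectionPerm, RootPairing.reflection_apply_self]

lemma PosRoot.form_ne_neg {b : (rootSystem H).Base} (α β : PosRoot b) :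
    (α.form : H → ℂ) ≠ -(β.form : H → ℂ) := by
  intro h
  let := (rootSystem H).indexNeg
  have h' : (rootSystem H).root α.1 = (rootSystem H).root (-β.1) := by
    rw [root_indexNeg]
    exact DFunLike.coe_injective h
  have h₁ := (rootSystem H).root.injective h'
  have h₂ := (RootPairing.Base.IsPos.neg_iff_not b β.1).mp (h₁ ▸ α.2)
  exact h₂ β.2

lemma eq_of_rootSpace_ne_bot (b : (rootSystem H).Base) (χ : H → ℂ) (hχ : rootSpace H χ ≠ ⊥) :
    χ = 0 ∨ (∃ α : PosRoot b, (α.form : H → ℂ) = χ) ∨ ∃ α : PosRoot b, -(α.form : H → ℂ) = χ := by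
  by_cases h0 : χ = 0
  · exact Or.inl h0
  right
  let w : LieModule.Weight ℂ H g := ⟨χ, hχ⟩
  have hw : w ∈ H.root := by
    simp only [LieSubalgebra.root, Finset.mem_filter, Finset.mem_univ, true_and]
    exact h0
  let := (rootSystem H).indexNeg
  rcases RootPairing.Base.IsPos.or_neg b (⟨w, hw⟩ : H.root) with h | h
  · exact Or.inl ⟨⟨_, h⟩, rfl⟩
  · refine Or.inr ⟨⟨_, h⟩, ?_⟩
    have : PosRoot.form ⟨-(⟨w, hw⟩ : H.root), h⟩ = -(rootSystem H).root ⟨w, hw⟩ :=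
      root_indexNeg _
    rw [this]
    ext x
    simp [w]

/-- The triangular decomposition, in the form that isolates the opposite nilradical. -/
lemma isCompl_nilBar (b : (rootSystem H).Base) : IsCompl (nilBar b) (H.toSubmodule ⊔ nil b) := by
  rw [cartan_eq, nil_eq, ← iSup_insert (f := fun χ : H → ℂ ↦ (rootSpace H χ).toSubmodule),
    nilBar_eq]
  apply isCompl_iSup_rootSpace
  · rw [Set.disjoint_left]
    rintro _ ⟨α, rfl⟩ (h | ⟨β, h⟩)
    · exact α.form_ne_zero (neg_eq_zero.mp h)
    · exact β.form_ne_neg α h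
  · intro χ hχ
    rcases eq_of_rootSpace_ne_bot b χ hχ with h | h | h
    · exact Or.inr (Or.inl h)
    · exact Or.inr (Or.inr h)
    · exact Or.inl h

/-- The triangular decomposition, in the form that isolates the Cartan subalgebra. -/
lemma isCompl_cartan (b : (rootSystem H).Base) : IsCompl H.toSubmodule (nilBar b ⊔ nil b) := by
  rw [cartan_eq, nil_eq, nilBar_eq, ← iSup_union,
    ← iSup_singleton (f := fun χ : H → ℂ ↦ (rootSpace H χ).toSubmodule) (b := 0)]
  apply isCompl_iSup_rootSpace
  · rw [Set.disjoint_left]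
    rintro _ rfl (⟨α, h⟩ | ⟨α, h⟩)
    · exact α.form_ne_zero (neg_eq_zero.mp h)
    · exact α.form_ne_zero h
  · intro χ hχ
    rcases eq_of_rootSpace_ne_bot b χ hχ with h | h | h
    · exact Or.inl h
    · exact Or.inr (Or.inr h)
    · exact Or.inr (Or.inl h)

/-- The `n̄`-part of an element of `g`. -/
def nilBarPart (b : (rootSystem H).Base) : g →ₗ[ℂ] nilBar b :=
  (nilBar b).projectionOnto (H.toSubmodule ⊔ nil b) (isCompl_nilBar b)

/-- The `h`-part of an element of `g`. -/
def cartanPart (b : (rootSystem H).Base) : g →ₗ[ℂ] H :=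
  H.toSubmodule.projectionOnto (nilBar b ⊔ nil b) (isCompl_cartan b)

/-! ### The differential operators -/

/-- The value `∑ i, c_i T ^ i` of a formal power series `∑ i, c_i t ^ i` at a nilpotent linear
operator `T`. -/
def nilEval {A V : Type*} [CommRing A] [Algebra ℂ A] [AddCommGroup V] [Module A V]
    (φ : PowerSeries ℂ) (T : Module.End A V) : Module.End A V :=
  ∑ i ∈ Finset.range (nilpotencyClass T), algebraMap ℂ A (PowerSeries.coeff i φ) • T ^ i

/-- The extension of a linear form on `V` to an `A`-linear form on `A ⊗ V`. -/
def extForm (A : Type*) {V : Type*} [CommRing A] [Algebra ℂ A] [AddCommGroup V] [Module ℂ V]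
    (φ : V →ₗ[ℂ] ℂ) : A ⊗[ℂ] V →ₗ[A] A :=
  (TensorProduct.AlgebraTensorModule.rid ℂ A A).toLinearMap ∘ₗ φ.baseChange A

variable {b : (rootSystem H).Base} (f : Basis (PosRoot b) ℂ (nilBar b))

/-- The element `u(x) = ∑ α, x_α f_α` of `ℂ[n̄] ⊗ g`. -/
def uElt : MvPolynomial (PosRoot b) ℂ ⊗[ℂ] g := ∑ α, MvPolynomial.X α ⊗ₜ[ℂ] (f α : g)

/-- The operator `ad(u(x))` on `ℂ[n̄] ⊗ g`. -/
def adU : Module.End (MvPolynomial (PosRoot b) ℂ) (MvPolynomial (PosRoot b) ℂ ⊗[ℂ] g) :=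
  LieAlgebra.ad (MvPolynomial (PosRoot b) ℂ) (MvPolynomial (PosRoot b) ℂ ⊗[ℂ] g) (uElt f)

/-- The element `e^{-ad(u(x))} a` of `ℂ[n̄] ⊗ g`. -/
def expNegAdU (a : g) : MvPolynomial (PosRoot b) ℂ ⊗[ℂ] g :=
  nilEval (PowerSeries.exp ℂ) (-adU f) (1 ⊗ₜ[ℂ] a)

/-- The `α`-th coordinate of the element
`(ad(u(x)) e^{ad(u(x))} / (e^{ad(u(x))} - id)) (e^{-ad(u(x))} a)_{n̄}` of `ℂ[n̄] ⊗ n̄`. The series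
`bernoulli'PowerSeries ℂ` is the expansion of `t e^t / (e^t - 1)`. -/
def vectorCoeff (a : g) (α : PosRoot b) : MvPolynomial (PosRoot b) ℂ :=
  extForm (MvPolynomial (PosRoot b) ℂ) (f.coord α ∘ₗ nilBarPart b)
    (nilEval (bernoulli'PowerSeries ℂ) (adU f)
      ((((nilBar b).subtype ∘ₗ nilBarPart b).baseChange (MvPolynomial (PosRoot b) ℂ))
        (expNegAdU f a)))

/-- The polynomial `μ((e^{-ad(u(x))} a)_h)`. -/
def scalarCoeff (μ : Dual ℂ H) (a : g) : MvPolynomial (PosRoot b) ℂ :=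
  extForm (MvPolynomial (PosRoot b) ℂ) (μ ∘ₗ cartanPart b) (expNegAdU f a)

/-- The differential operator `π_lam(a)`. -/
def diffOp (lam : Dual ℂ H) (a : g) : Weyl (PosRoot b) :=
  -(∑ α, Weyl.ofPoly (vectorCoeff f a α) * Weyl.d α) + Weyl.ofPoly (scalarCoeff f (lam + rho b) a)

/-! ### The commutative subalgebra attached to a root -/

lemma PosRoot.isNonZero (α : PosRoot b) : α.1.1.IsNonZero :=
  (Finset.mem_filter.mp α.1.2).2

/-- The subalgebra of `U(g)` generated by the Cartan subalgebra `H` and by the center of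
`U(s_θ)`, where `s_θ` is the copy of `sl₂` spanned by an `sl₂`-triple attached to the root `θ`. -/
def gammaTheta (θ : PosRoot b) : Subalgebra ℂ (UniversalEnvelopingAlgebra ℂ g) :=
  let s := sl2SubalgebraOfRoot θ.isNonZero
  let j : UniversalEnvelopingAlgebra ℂ s →ₐ[ℂ] UniversalEnvelopingAlgebra ℂ g :=
    UniversalEnvelopingAlgebra.lift ℂ ((UniversalEnvelopingAlgebra.ι ℂ).comp s.incl)
  Algebra.adjoin ℂ
    (UniversalEnvelopingAlgebra.ι ℂ '' (H : Set g) ∪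
      j '' (Subalgebra.center ℂ (UniversalEnvelopingAlgebra ℂ s) : Set _))

end Simple

end ThetaGT
end

/-! A partial Fourier transform identifies W(λ) with a polynomial ring. There x_θ and ∂_θ keep their
usual meaning, while for α ≠ θ the generator x_α acts as -∂/∂X_α and ∂_α acts as multiplication by
X_α (`gtRep`). The constant 1 is killed by the left ideal, and acting on 1 inverts the canonical
map, so that map is bijective.

The homomorphism property comes from conjugating derivations by e^{-ad u}. A derivation δ of the
coefficients becomes δ + ad(`logDer u δ`), and commutators give a Maurer–Cartan equation
(`logDer_lie`). The Bernoulli series in π is the inverse of the series in `logDer`, so the vector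
field of a has logarithmic derivative -(e^{-ad u} a)_n̄. The bracket relation for vector fields and
the cocycle relation for scalar terms then follow from n̄ being a subalgebra and from [h + n, h + n]
⊆ n (`logDer_lie_of_projection`, `vectorField_lie_and_potential_lie`). Any linear form on h may
stand in the scalar term.

Two explicit formulas suffice for the module: a Cartan element acts by an Euler operator plus a
scalar, hence diagonally on monomials, and the root vector of -θ acts as -∂_θ because it is central
in n̄.

For Γ_θ, let (h, e, f) be the triple of θ. The vectors of weight μ killed by f are spanned by
monomials free of X_θ, and only finitely many of these have weight μ. Hence the vectors of weight μ
killed by f^k form a finite-dimensional Γ_θ-stable space (`killedBy`), and these spaces exhaust W(λ)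
as f is locally nilpotent; this gives the decomposition. A character χ fixes μ and the Casimir
value. If f^k v is the last nonzero vector f^j v, the Casimir element acts on it by m² - 2m with m =
μ(h) - 2k, which equals χ of the Casimir element for at most two k. So the weight space of χ lies in
a single `killedBy` space.

For cyclicity, the generator is x_θ^N with N large: e moves it up through higher powers with nonzero
coefficients and f moves it down. The other negative root vectors act as multiplication by -X_α up
to terms of lower degree in the variables other than X_θ, so all monomials are reached. -/

noncomputable section

namespace ThetaGT

/-! ### The representation of the Weyl algebra on polynomials -/

section WeylRep

variable {σ : Type*}

/-- A predicate on the Weyl algebra that holds for scalars and generators and is stable under sums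
and products holds everywhere. -/
lemma Weyl.induction {P : Weyl σ → Prop} (hc : ∀ c : ℂ, P (algebraMap ℂ _ c))
    (hx : ∀ i, P (Weyl.x i)) (hd : ∀ i, P (Weyl.d i)) (hadd : ∀ a b, P a → P b → P (a + b))
    (hmul : ∀ a b, P a → P b → P (a * b)) (a : Weyl σ) : P a := by
  obtain ⟨p, rfl⟩ := RingQuot.mkAlgHom_surjective ℂ (WeylRel σ) a
  induction p using FreeAlgebra.induction with
  | grade0 c =>
    rw [AlgHom.commutes]
    exact hc c
  | grade1 i =>
    cases i with
    | inl i => exact hx i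
    | inr i => exact hd i
  | mul a b ha hb => rw [map_mul]; exact hmul _ _ ha hb
  | add a b ha hb => rw [map_add]; exact hadd _ _ ha hb

/-- The universal property of the Weyl algebra. -/
def Weyl.lift {R : Type*} [Ring R] [Algebra ℂ R] (X D : σ → R)
    (hX : ∀ i j, X i * X j = X j * X i) (hD : ∀ i j, D i * D j = D j * D i)
    (hDX : ∀ i, D i * X i = X i * D i + 1) (hDX' : ∀ i j, i ≠ j → D i * X j = X j * D i) :
    Weyl σ →ₐ[ℂ] R :=
  RingQuot.liftAlgHom ℂ ⟨FreeAlgebra.lift ℂ (Sum.elim X D), by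
    intro a b h
    cases h with
    | x_x i j => simpa using hX i j
    | d_d i j => simpa using hD i j
    | d_x_self i => simpa using hDX i
    | d_x_ne i j hij => simpa using hDX' i j hij⟩

section

variable {R : Type*} [Ring R] [Algebra ℂ R] (X D : σ → R)
    (hX : ∀ i j, X i * X j = X j * X i) (hD : ∀ i j, D i * D j = D j * D i)
    (hDX : ∀ i, D i * X i = X i * D i + 1) (hDX' : ∀ i j, i ≠ j → D i * X j = X j * D i)

@[simp] lemma Weyl.lift_x (i : σ) : Weyl.lift X D hX hD hDX hDX' (Weyl.x i) = X i := by
  rw [Weyl.lift, Weyl.x, Weyl.mk]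
  erw [RingQuot.liftAlgHom_mkAlgHom_apply]
  simp

@[simp] lemma Weyl.lift_d (i : σ) : Weyl.lift X D hX hD hDX hDX' (Weyl.d i) = D i := by
  rw [Weyl.lift, Weyl.d, Weyl.mk]
  erw [RingQuot.liftAlgHom_mkAlgHom_apply]
  simp

end

/-- Multiplication by a variable. -/
def mulX (i : σ) : End ℂ (MvPolynomial σ ℂ) := LinearMap.mulLeft ℂ (MvPolynomial.X i)

/-- Partial derivative as an endomorphism. -/
def pd (i : σ) : End ℂ (MvPolynomial σ ℂ) := (MvPolynomial.pderiv i).toLinearMap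

@[simp] lemma mulX_apply (i : σ) (p : MvPolynomial σ ℂ) : mulX i p = MvPolynomial.X i * p := rfl

@[simp] lemma pd_apply (i : σ) (p : MvPolynomial σ ℂ) : pd i p = MvPolynomial.pderiv i p := rfl

lemma mulX_comm (i j : σ) : mulX i * mulX j = mulX j * mulX i := by
  refine LinearMap.ext fun p ↦ ?_
  simp only [End.mul_apply, mulX_apply]
  ring

lemma pd_comm (i j : σ) : pd i * pd j = pd j * pd i := by
  refine LinearMap.ext fun p ↦ ?_
  simp only [End.mul_apply, pd_apply]
  have h : ⁅(MvPolynomial.pderiv i : Derivation ℂ (MvPolynomial σ ℂ) (MvPolynomial σ ℂ)),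
      (MvPolynomial.pderiv j : Derivation ℂ (MvPolynomial σ ℂ) (MvPolynomial σ ℂ))⁆ = 0 := by
    apply MvPolynomial.derivation_ext
    intro k
    classical
    simp [Derivation.commutator_apply, MvPolynomial.pderiv_X, Pi.single_apply]
    split_ifs <;> simp
  have := DFunLike.congr_fun h p
  rwa [Derivation.commutator_apply, Derivation.zero_apply, sub_eq_zero] at this

lemma pd_mulX_self (i : σ) : pd i * mulX i = mulX i * pd i + 1 := by
  refine LinearMap.ext fun p ↦ ?_
  simp [Derivation.leibniz]

lemma pd_mulX_of_ne {i j : σ} (h : i ≠ j) : pd i * mulX j = mulX j * pd i := by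
  refine LinearMap.ext fun p ↦ ?_
  simp [Derivation.leibniz, MvPolynomial.pderiv_X_of_ne h.symm]

/-- The pair (-∂, X) obeys the same canonical relations as (X, ∂). This lemma and the next three
supply the relations of such Fourier-transformed and mixed pairs for `gtRep`. -/
lemma mulX_neg_pd {i j : σ} (h : i ≠ j) : mulX i * -pd j = -pd j * mulX i := by
  refine LinearMap.ext fun p ↦ ?_
  have := LinearMap.congr_fun (pd_mulX_of_ne h.symm) p
  simp only [End.mul_apply, LinearMap.neg_apply, map_neg] at this ⊢
  rw [this]

lemma neg_pd_comm (i j : σ) : -pd i * -pd j = -pd j * -pd i := by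
  refine LinearMap.ext fun p ↦ ?_
  have := LinearMap.congr_fun (pd_comm i j) p
  simp only [End.mul_apply, LinearMap.neg_apply, map_neg] at this ⊢
  rw [this]

lemma mulX_neg_pd_self (i : σ) : mulX i * -pd i = -pd i * mulX i + 1 := by
  refine LinearMap.ext fun p ↦ ?_
  have := LinearMap.congr_fun (pd_mulX_self i) p
  simp only [End.mul_apply, LinearMap.neg_apply, map_neg, LinearMap.add_apply] at this ⊢
  rw [this]
  abel

lemma pd_neg_pd_comm (i j : σ) : pd i * -pd j = -pd j * pd i := by
  refine LinearMap.ext fun p ↦ ?_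
  have := LinearMap.congr_fun (pd_comm i j) p
  simp only [End.mul_apply, LinearMap.neg_apply, map_neg] at this ⊢
  rw [this]

open Classical in
/-- The representation of the Weyl algebra on polynomials obtained from the natural one by a partial
Fourier transform in the variables `x_α`, `α ≠ θ`. -/
def gtRep (θ : σ) : Weyl σ →ₐ[ℂ] End ℂ (MvPolynomial σ ℂ) :=
  Weyl.lift (fun α ↦ if α = θ then mulX α else -pd α) (fun α ↦ if α = θ then pd α else mulX α)
    (by
      intro i j
      split_ifs with h₁ h₂ h₂
      · exact mulX_comm i j
      · exact mulX_neg_pd (by rw [h₁]; exact Ne.symm h₂)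
      · exact (mulX_neg_pd (by rw [h₂]; exact Ne.symm h₁)).symm
      · exact neg_pd_comm i j)
    (by
      intro i j
      split_ifs with h₁ h₂ h₂
      · exact pd_comm i j
      · exact pd_mulX_of_ne (by rintro rfl; exact h₂ h₁)
      · exact (pd_mulX_of_ne (by rintro rfl; exact h₁ h₂)).symm
      · exact mulX_comm i j)
    (by
      intro i
      split_ifs with h₁
      · exact pd_mulX_self i
      · exact mulX_neg_pd_self i)
    (by
      intro i j hij
      split_ifs with h₁ h₂ h₂
      · exact absurd (h₁.trans h₂.symm) hij
      · exact pd_neg_pd_comm i j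
      · exact mulX_comm i j
      · exact mulX_neg_pd hij)

lemma gtRep_x_self (θ : σ) : gtRep θ (Weyl.x θ) = mulX θ := by simp [gtRep]

lemma gtRep_d_self (θ : σ) : gtRep θ (Weyl.d θ) = pd θ := by simp [gtRep]

lemma gtRep_x_of_ne {θ α : σ} (h : α ≠ θ) : gtRep θ (Weyl.x α) = -pd α := by simp [gtRep, h]

lemma gtRep_d_of_ne {θ α : σ} (h : α ≠ θ) : gtRep θ (Weyl.d α) = mulX α := by simp [gtRep, h]

lemma gtRep_gtVar (θ α : σ) : gtRep θ (gtVar θ α) = mulX α := by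
  unfold gtVar
  split_ifs with h
  · rw [h, gtRep_x_self]
  · exact gtRep_d_of_ne h

lemma gtRep_commEval (θ : σ) (p q : MvPolynomial σ ℂ) :
    gtRep θ (commEval (gtVar θ) (gtVar_mul_gtVar θ) p) q = p * q := by
  induction p using MvPolynomial.induction_on generalizing q with
  | C c =>
    rw [← MvPolynomial.algebraMap_eq, AlgHom.commutes, AlgHom.commutes,
      Module.algebraMap_end_apply, Algebra.smul_def]
  | add p₁ p₂ h₁ h₂ => simp [h₁, h₂, add_mul]
  | mul_X p i h => simp [h, gtRep_gtVar, mul_assoc]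

/-- The commutator with `y` obeys the Leibniz rule, so agreement with `D` on the variables
propagates to all polynomials. It serves both the Fourier picture and the vector fields in
`weylOfDer_mul_ofPoly`. -/
lemma mul_commEval {R : Type*} [Ring R] [Algebra ℂ R] (c : σ → R)
    (hc : ∀ i j, c i * c j = c j * c i) (y : R)
    (D : Derivation ℂ (MvPolynomial σ ℂ) (MvPolynomial σ ℂ))
    (h : ∀ i, y * c i = c i * y + commEval c hc (D (MvPolynomial.X i))) (p : MvPolynomial σ ℂ) :
    y * commEval c hc p = commEval c hc p * y + commEval c hc (D p) := by
  induction p using MvPolynomial.induction_on with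
  | C a =>
    rw [← MvPolynomial.algebraMap_eq, AlgHom.commutes, Derivation.map_algebraMap, map_zero,
      add_zero, Algebra.commutes]
  | add p₁ p₂ h₁ h₂ => simp only [map_add, mul_add, add_mul, h₁, h₂]; abel
  | mul_X p i hp =>
    rw [map_mul, commEval_X, ← mul_assoc, hp, add_mul, mul_assoc, h, Derivation.leibniz,
      mul_add, smul_eq_mul, smul_eq_mul, map_add, map_mul, mul_comm (MvPolynomial.X i), map_mul,
      commEval_X]
    noncomm_ring

lemma x_mul_commEval {θ α : σ} (h : α ≠ θ) (p : MvPolynomial σ ℂ) :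
    Weyl.x α * commEval (gtVar θ) (gtVar_mul_gtVar θ) p =
      commEval (gtVar θ) (gtVar_mul_gtVar θ) p * Weyl.x α +
        commEval (gtVar θ) (gtVar_mul_gtVar θ)
          ((-MvPolynomial.pderiv α : Derivation ℂ (MvPolynomial σ ℂ) (MvPolynomial σ ℂ)) p) := by
  apply mul_commEval
  intro i
  by_cases hi : i = α
  · subst hi
    rw [gtVar, if_neg h, Weyl.d_mul_x_self]
    simp
  · have : Weyl.x α * gtVar θ i = gtVar θ i * Weyl.x α := by
      unfold gtVar
      split_ifs with h'
      · exact Weyl.x_mul_x _ _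
      · exact (Weyl.d_mul_x_of_ne hi).symm
    simp [this, MvPolynomial.pderiv_X_of_ne hi]

lemma d_mul_commEval (θ : σ) (p : MvPolynomial σ ℂ) :
    Weyl.d θ * commEval (gtVar θ) (gtVar_mul_gtVar θ) p =
      commEval (gtVar θ) (gtVar_mul_gtVar θ) p * Weyl.d θ +
        commEval (gtVar θ) (gtVar_mul_gtVar θ) (MvPolynomial.pderiv θ p) := by
  apply mul_commEval
  intro i
  by_cases hi : i = θ
  · subst hi
    rw [gtVar, if_pos rfl, Weyl.d_mul_x_self]
    simp
  · rw [gtVar, if_neg hi, Weyl.d_mul_d]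
    simp [MvPolynomial.pderiv_X_of_ne hi]

/-- In the quotient by `gtIdeal θ`, the Weyl algebra acts on classes of polynomials through
`gtRep θ`. -/
lemma smul_gtPolyMap (θ : σ) (a : Weyl σ) (p : MvPolynomial σ ℂ) :
    a • gtPolyMap θ p = gtPolyMap θ (gtRep θ a p) := by
  have key (a : Weyl σ) (p q : MvPolynomial σ ℂ)
      (h : a * commEval (gtVar θ) (gtVar_mul_gtVar θ) p -
        commEval (gtVar θ) (gtVar_mul_gtVar θ) q ∈ gtIdeal θ) :
      a • gtPolyMap θ p = gtPolyMap θ q := by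
    change a • (Submodule.Quotient.mk _ : Weyl σ ⧸ gtIdeal θ) = Submodule.Quotient.mk _
    rw [← Submodule.Quotient.mk_smul]
    exact (Submodule.Quotient.eq _).mpr h
  induction a using Weyl.induction generalizing p with
  | hc c =>
    apply key
    rw [AlgHom.commutes, Module.algebraMap_end_apply, map_smul, ← Algebra.smul_def, sub_self]
    exact zero_mem _
  | hx i =>
    apply key
    by_cases h : i = θ
    · rw [h, gtRep_x_self, mulX_apply, map_mul, commEval_X, gtVar, if_pos rfl, sub_self]
      exact zero_mem _
    · rw [gtRep_x_of_ne h, x_mul_commEval h]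
      have : (-MvPolynomial.pderiv i : Derivation ℂ (MvPolynomial σ ℂ) (MvPolynomial σ ℂ)) p =
          (-pd i) p := by simp
      rw [this, add_sub_cancel_right]
      -- Moving the generator to the right of the polynomial leaves a left multiple of it, which
      -- lies in the left ideal.
      exact Submodule.smul_mem _ _ (Submodule.subset_span (Or.inl ⟨i, h, rfl⟩))
  | hd i =>
    apply key
    by_cases h : i = θ
    · rw [h, gtRep_d_self, d_mul_commEval, pd_apply, add_sub_cancel_right]
      exact Submodule.smul_mem _ _ (Submodule.subset_span (Or.inr rfl))
    · rw [gtRep_d_of_ne h, mulX_apply, map_mul, commEval_X, gtVar, if_neg h, sub_self]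
      exact zero_mem _
  | hadd a b ha hb => rw [add_smul, ha, hb, map_add, LinearMap.add_apply, map_add]
  | hmul a b ha hb => rw [mul_smul, hb, ha, map_mul, End.mul_apply]

/-- Every generator of the ideal acts as a derivative up to sign, so 1 is a vacuum vector. -/
lemma gtRep_apply_one_of_mem {θ : σ} {a : Weyl σ} (ha : a ∈ gtIdeal θ) : gtRep θ a 1 = 0 := by
  induction ha using Submodule.span_induction with
  | mem a h =>
    rcases h with ⟨α, hα, rfl⟩ | rfl
    · simp [gtRep_x_of_ne hα]
    · simp [gtRep_d_self]
  | zero => simp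
  | add a b _ _ ha hb => simp [ha, hb]
  | smul c a _ ha => rw [smul_eq_mul, map_mul, End.mul_apply, ha, map_zero]

/-- The inverse is induced by `a ↦ gtRep θ a 1`: the ideal kills 1, and the commuting generators act
by multiplication, which returns `p` from 1. -/
theorem gtPolyMap_bijective (θ : σ) : Function.Bijective (gtPolyMap θ) := by
  constructor
  · rw [injective_iff_map_eq_zero]
    intro p hp
    have h : commEval (gtVar θ) (gtVar_mul_gtVar θ) p ∈ gtIdeal θ :=
      (Submodule.Quotient.mk_eq_zero _).mp hp
    simpa [gtRep_commEval] using gtRep_apply_one_of_mem h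
  · intro w
    obtain ⟨a, rfl⟩ := Submodule.Quotient.mk_surjective _ w
    refine ⟨gtRep θ a 1, ?_⟩
    rw [← smul_gtPolyMap]
    change a • (Submodule.Quotient.mk (commEval (gtVar θ) (gtVar_mul_gtVar θ) 1) : Weyl σ ⧸ gtIdeal θ) = _
    rw [← Submodule.Quotient.mk_smul, smul_eq_mul]
    congr 2
    simp

end WeylRep

/-! ### First order differential operators -/

section FirstOrder

variable {σ : Type*} [Fintype σ]

/-- The element of the Weyl algebra given by a derivation of the polynomial algebra. -/
def weylOfDer (D : Derivation ℂ (MvPolynomial σ ℂ) (MvPolynomial σ ℂ)) : Weyl σ :=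
  ∑ i, Weyl.ofPoly (D (MvPolynomial.X i)) * Weyl.d i

lemma weylOfDer_mul_ofPoly (D : Derivation ℂ (MvPolynomial σ ℂ) (MvPolynomial σ ℂ))
    (p : MvPolynomial σ ℂ) :
    weylOfDer D * Weyl.ofPoly p = Weyl.ofPoly p * weylOfDer D + Weyl.ofPoly (D p) := by
  classical
  apply mul_commEval
  intro j
  have h (i : σ) : Weyl.d i * Weyl.x j = Weyl.x j * Weyl.d i + if i = j then 1 else 0 := by
    split_ifs with hij
    · rw [hij, Weyl.d_mul_x_self]
    · rw [Weyl.d_mul_x_of_ne hij, add_zero]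
  have h' (i : σ) : Weyl.ofPoly (D (MvPolynomial.X i)) * Weyl.x j =
      Weyl.x j * Weyl.ofPoly (D (MvPolynomial.X i)) := by
    have : Weyl.x j = Weyl.ofPoly (MvPolynomial.X j) := (commEval_X _ _ _).symm
    rw [this, ← map_mul, mul_comm, map_mul]
  rw [weylOfDer, Finset.sum_mul, Finset.mul_sum]
  simp_rw [mul_assoc, h, mul_add, ← mul_assoc, h', Finset.sum_add_distrib]
  simp [Weyl.ofPoly]

/-- The second-order part of a product of two vector fields is symmetric in the two factors because
the partial derivatives commute, so it cancels in the commutator. -/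
lemma weylOfDer_lie (D E : Derivation ℂ (MvPolynomial σ ℂ) (MvPolynomial σ ℂ)) :
    weylOfDer ⁅D, E⁆ = weylOfDer D * weylOfDer E - weylOfDer E * weylOfDer D := by
  have key (D E : Derivation ℂ (MvPolynomial σ ℂ) (MvPolynomial σ ℂ)) :
      weylOfDer D * weylOfDer E =
        (∑ i, ∑ j, Weyl.ofPoly (E (MvPolynomial.X i) * D (MvPolynomial.X j)) *
          (Weyl.d j * Weyl.d i)) +
        ∑ i, Weyl.ofPoly (D (E (MvPolynomial.X i))) * Weyl.d i := by
    conv_lhs => rw [weylOfDer.eq_1 E]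
    rw [Finset.mul_sum, ← Finset.sum_add_distrib]
    refine Finset.sum_congr rfl fun i _ ↦ ?_
    rw [← mul_assoc, weylOfDer_mul_ofPoly, add_mul]
    congr 1
    rw [weylOfDer, Finset.mul_sum, Finset.sum_mul]
    refine Finset.sum_congr rfl fun j _ ↦ ?_
    rw [map_mul]
    noncomm_ring
  rw [key, key, Finset.sum_comm]
  simp_rw [weylOfDer, Derivation.commutator_apply, map_sub, sub_mul]
  rw [Finset.sum_sub_distrib]
  have : ∀ i j : σ, Weyl.ofPoly (E (MvPolynomial.X j) * D (MvPolynomial.X i)) *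
      (Weyl.d i * Weyl.d j) = Weyl.ofPoly (D (MvPolynomial.X i) * E (MvPolynomial.X j)) *
      (Weyl.d j * Weyl.d i) := fun i j ↦ by rw [mul_comm, Weyl.d_mul_d]
  simp_rw [this]
  abel

/-- The commutator of two first order differential operators. -/
lemma firstOrder_lie (D E : Derivation ℂ (MvPolynomial σ ℂ) (MvPolynomial σ ℂ))
    (p q : MvPolynomial σ ℂ) :
    ⁅weylOfDer D + Weyl.ofPoly p, weylOfDer E + Weyl.ofPoly q⁆ =
      weylOfDer ⁅D, E⁆ + Weyl.ofPoly (D q - E p) := by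
  rw [LieRing.of_associative_ring_bracket, weylOfDer_lie, mul_add, add_mul, add_mul, mul_add,
    add_mul, add_mul, weylOfDer_mul_ofPoly, weylOfDer_mul_ofPoly, map_sub, ← map_mul, ← map_mul,
    mul_comm p q]
  abel

end FirstOrder

/-! ### Power series of nilpotent elements -/

section PsEval

variable {R S : Type*} [Ring R] [Algebra ℂ R] [Ring S] [Algebra ℂ S]

/-- The value of a formal power series at a nilpotent element of an algebra. -/
def psEval (φ : PowerSeries ℂ) (t : R) : R :=
  ∑ i ∈ Finset.range (nilpotencyClass t), PowerSeries.coeff i φ • t ^ i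

lemma psEval_eq_sum (φ : PowerSeries ℂ) {t : R} {n : ℕ} (h : t ^ n = 0) :
    psEval φ t = ∑ i ∈ Finset.range n, PowerSeries.coeff i φ • t ^ i := by
  refine Finset.sum_subset (Finset.range_mono (csInf_le' h)) fun i _ hi ↦ ?_
  have hn : t ^ nilpotencyClass t = 0 := pow_nilpotencyClass ⟨n, h⟩
  rw [pow_eq_zero_of_le (by simpa using hi) hn, smul_zero]

lemma psEval_eq_aeval (φ : PowerSeries ℂ) {t : R} {n : ℕ} (h : t ^ n = 0) :
    psEval φ t = Polynomial.aeval t (PowerSeries.trunc n φ) := by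
  rw [psEval_eq_sum φ h, Polynomial.aeval_def, PowerSeries.eval₂_trunc_eq_sum_range]
  simp [Algebra.smul_def]

/-- Truncation reduces to polynomials: the product of the truncations and the truncation of the
product differ by a multiple of X^n, which vanishes at `t`. -/
lemma psEval_mul (φ ψ : PowerSeries ℂ) {t : R} (ht : IsNilpotent t) :
    psEval (φ * ψ) t = psEval φ t * psEval ψ t := by
  obtain ⟨n, hn⟩ := ht
  rw [psEval_eq_aeval _ hn, psEval_eq_aeval _ hn, psEval_eq_aeval _ hn, ← map_mul]
  have h : (Polynomial.X : Polynomial ℂ) ^ n ∣ PowerSeries.trunc n φ * PowerSeries.trunc n ψ -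
      PowerSeries.trunc n (φ * ψ) := by
    rw [Polynomial.X_pow_dvd_iff]
    intro d hd
    rw [Polynomial.coeff_sub, PowerSeries.coeff_trunc, if_pos hd,
      PowerSeries.coeff_mul_eq_coeff_trunc_mul_trunc _ _ hd, sub_eq_zero, ← Polynomial.coeff_coe,
      Polynomial.coe_mul]
  obtain ⟨q, hq⟩ := h
  have := congrArg (Polynomial.aeval t) hq
  rw [map_sub, map_mul (Polynomial.aeval t) (_ ^ n), map_pow, Polynomial.aeval_X, hn, zero_mul,
    sub_eq_zero] at this
  exact this.symm

lemma psEval_one {t : R} (ht : IsNilpotent t) : psEval 1 t = 1 := by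
  obtain ⟨n, hn⟩ := ht
  have hn' : t ^ (n + 1) = 0 := by rw [pow_succ, hn, zero_mul]
  rw [psEval_eq_aeval _ hn', PowerSeries.trunc_one, map_one]

lemma psEval_map (F : R →ₐ[ℂ] S) (φ : PowerSeries ℂ) {t : R} (ht : IsNilpotent t) :
    psEval φ (F t) = F (psEval φ t) := by
  obtain ⟨n, hn⟩ := ht
  rw [psEval_eq_aeval _ hn, psEval_eq_aeval _ (n := n) (by rw [← map_pow, hn, map_zero]),
    Polynomial.aeval_algHom_apply]

lemma psEval_neg (φ : PowerSeries ℂ) {t : R} (ht : IsNilpotent t) :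
    psEval φ (-t) = psEval (PowerSeries.rescale (-1) φ) t := by
  obtain ⟨n, hn⟩ := ht
  rw [psEval_eq_sum _ hn, psEval_eq_sum _ (n := n) (by rw [neg_pow, hn, mul_zero])]
  refine Finset.sum_congr rfl fun i _ ↦ ?_
  rw [PowerSeries.coeff_rescale, neg_pow, mul_comm, mul_smul]
  congr 1
  rcases Nat.even_or_odd i with h | h <;> simp [h.neg_one_pow]

lemma psEval_exp_add {s t : R} (h : Commute s t) (hs : IsNilpotent s) (ht : IsNilpotent t) :
    psEval (PowerSeries.exp ℂ) (s + t) =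
      psEval (PowerSeries.exp ℂ) s * psEval (PowerSeries.exp ℂ) t := by
  -- The rational structure is there only to compare with `IsNilpotent.exp`.
  let _ : Module ℚ R := Module.compHom R (algebraMap ℚ ℂ)
  have key (r : R) : psEval (PowerSeries.exp ℂ) r = IsNilpotent.exp r := by
    refine Finset.sum_congr rfl fun i _ ↦ ?_
    rw [PowerSeries.coeff_exp, one_div]
    rfl
  rw [key, key, key, IsNilpotent.exp_add_of_commute h hs ht]

/-- `e^t X = (e^{ad t} X) e^t`. -/
lemma psEval_exp_mul {t : R} (ht : IsNilpotent t) (X : R) :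
    psEval (PowerSeries.exp ℂ) t * X =
      psEval (PowerSeries.exp ℂ) (LinearMap.mulLeft ℂ t - LinearMap.mulRight ℂ t) X *
        psEval (PowerSeries.exp ℂ) t := by
  obtain ⟨n, hn⟩ := id ht
  have hl : IsNilpotent (LinearMap.mulLeft ℂ t) := ⟨n, by simp [LinearMap.pow_mulLeft, hn]⟩
  have hr : IsNilpotent (LinearMap.mulRight ℂ t) := ⟨n, by simp [LinearMap.pow_mulRight, hn]⟩
  have hc : Commute (LinearMap.mulLeft ℂ t) (LinearMap.mulRight ℂ t) :=
    LinearMap.commute_mulLeft_right _ _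
  have h1 : psEval (PowerSeries.exp ℂ) (LinearMap.mulLeft ℂ t) X =
      psEval (PowerSeries.exp ℂ) t * X := by
    have := psEval_map (Algebra.lmul ℂ R) (PowerSeries.exp ℂ) ht
    exact LinearMap.congr_fun this X
  have h2 (Y : R) : psEval (PowerSeries.exp ℂ) (LinearMap.mulRight ℂ t) Y =
      Y * psEval (PowerSeries.exp ℂ) t := by
    rw [psEval_eq_sum _ hn, psEval_eq_sum _ (n := n) (by simp [LinearMap.pow_mulRight, hn]),
      LinearMap.sum_apply, Finset.mul_sum]
    simp [LinearMap.pow_mulRight]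
  have hs : Commute (LinearMap.mulRight ℂ t) (LinearMap.mulLeft ℂ t - LinearMap.mulRight ℂ t) :=
    hc.symm.sub_right (Commute.refl _)
  -- Left multiplication by `t` is the sum of ad t and right multiplication by `t`, two commuting
  -- nilpotent operators, so its exponential factors.
  have h3 := psEval_exp_add hs hr (hc.isNilpotent_sub hl hr)
  rw [add_sub_cancel] at h3
  rw [← h1, h3, End.mul_apply, h2]

end PsEval

/-! ### Conjugation of derivations by exponentials -/

/-- The power series `(e^t - 1) / t`. -/
def expQuot : PowerSeries ℂ := PowerSeries.mk fun n ↦ ((n + 1).factorial : ℂ)⁻¹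

lemma X_mul_expQuot : PowerSeries.X * expQuot = PowerSeries.exp ℂ - 1 := by
  ext n
  cases n with
  | zero => simp
  | succ n =>
    rw [PowerSeries.coeff_succ_X_mul, map_sub, PowerSeries.coeff_exp, PowerSeries.coeff_one,
      if_neg n.succ_ne_zero, expQuot, PowerSeries.coeff_mk]
    simp

/-- The factors are t e^t / (e^t - 1) and (1 - e^{-t}) / t. The identity is checked after
multiplication by t e^t, which is cancellable. It is the reason for the Bernoulli factor in π. -/
lemma bernoulli_mul_expQuot :
    bernoulli'PowerSeries ℂ * PowerSeries.rescale (-1) expQuot = 1 := by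
  have h1 := bernoulli'PowerSeries_mul_exp_sub_one ℂ
  have h2 := congrArg (PowerSeries.rescale (-1 : ℂ)) X_mul_expQuot
  have h3 := PowerSeries.exp_mul_exp_neg_eq_one (A := ℂ)
  rw [PowerSeries.evalNegHom] at h3
  rw [map_mul, map_sub, map_one, PowerSeries.rescale_X] at h2
  set E := PowerSeries.exp ℂ
  set F := PowerSeries.rescale (-1 : ℂ) E
  set Q := PowerSeries.rescale (-1 : ℂ) expQuot
  have hC : PowerSeries.C (-1 : ℂ) = -1 := by simp
  rw [hC] at h2
  refine mul_left_cancel₀ (PowerSeries.X_ne_zero (R := ℂ)) ?_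
  refine mul_left_cancel₀ (a := E) (by intro h; simp [h] at h3) ?_
  linear_combination (-E * bernoulli'PowerSeries ℂ) * h2 + bernoulli'PowerSeries ℂ * (-1) * h3 + h1

section Conj

variable {L : Type*} [LieRing L] [LieAlgebra ℂ L]

/-- The operator `e^{-ad u}`. -/
def expNegAd (u : L) : End ℂ L := psEval (PowerSeries.exp ℂ) (-LieAlgebra.ad ℂ L u)

/-- The element `((1 - e^{-ad u}) / ad u) (δ u)`. -/
def logDer (u : L) (δ : LieDerivation ℂ L L) : L :=
  psEval expQuot (-LieAlgebra.ad ℂ L u) (δ u)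

/-- By the Jacobi identity, commuting with -ad u preserves inner derivations and acts on them
through -ad u. Power series in the commutator operator thus become power series in -ad u inside
`ad`. -/
lemma pow_ad_apply_ad (u y : L) (n : ℕ) :
    ((LinearMap.mulLeft ℂ (-LieAlgebra.ad ℂ L u) -
      LinearMap.mulRight ℂ (-LieAlgebra.ad ℂ L u)) ^ n) (LieAlgebra.ad ℂ L y) =
      LieAlgebra.ad ℂ L (((-LieAlgebra.ad ℂ L u) ^ n) y) := by
  induction n with
  | zero => rfl
  | succ n ih =>
    rw [pow_succ', End.mul_apply, ih, pow_succ', End.mul_apply]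
    refine LinearMap.ext fun z ↦ ?_
    simp only [LinearMap.sub_apply, LinearMap.mulLeft_apply, LinearMap.mulRight_apply,
      End.mul_apply, LinearMap.neg_apply, LieAlgebra.ad_apply, neg_lie, lie_neg]
    rw [leibniz_lie u]
    abel

variable {u : L}

lemma exists_pow_adjoint_eq_zero (hu : IsNilpotent (LieAlgebra.ad ℂ L u))
    : ∃ n, (-LieAlgebra.ad ℂ L u) ^ n = 0 ∧
    (LinearMap.mulLeft ℂ (-LieAlgebra.ad ℂ L u) -
      LinearMap.mulRight ℂ (-LieAlgebra.ad ℂ L u)) ^ n = 0 := by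
  obtain ⟨n, hn⟩ := hu.neg
  have hl : IsNilpotent (LinearMap.mulLeft ℂ (-LieAlgebra.ad ℂ L u)) :=
    ⟨n, by simp [LinearMap.pow_mulLeft, hn]⟩
  have hr : IsNilpotent (LinearMap.mulRight ℂ (-LieAlgebra.ad ℂ L u)) :=
    ⟨n, by simp [LinearMap.pow_mulRight, hn]⟩
  obtain ⟨m, hm⟩ := (LinearMap.commute_mulLeft_right (R := ℂ) (-LieAlgebra.ad ℂ L u)
    (-LieAlgebra.ad ℂ L u)).isNilpotent_sub hl hr
  exact ⟨n + m, by rw [pow_add, hn, zero_mul], by rw [pow_add, hm, mul_zero]⟩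

lemma expNegAd_mul_ad (hu : IsNilpotent (LieAlgebra.ad ℂ L u))
    (y : L) :
    expNegAd u * LieAlgebra.ad ℂ L y = LieAlgebra.ad ℂ L (expNegAd u y) * expNegAd u := by
  obtain ⟨n, h1, h2⟩ := exists_pow_adjoint_eq_zero hu
  rw [expNegAd, psEval_exp_mul hu.neg, psEval_eq_sum _ h2, LinearMap.sum_apply]
  simp_rw [LinearMap.smul_apply, pow_ad_apply_ad, psEval_eq_sum _ h1, LinearMap.sum_apply,
    LinearMap.smul_apply, map_sum, map_smul]

lemma expNegAd_lie (hu : IsNilpotent (LieAlgebra.ad ℂ L u))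
    (y z : L) : expNegAd u ⁅y, z⁆ = ⁅expNegAd u y, expNegAd u z⁆ :=
  LinearMap.congr_fun (expNegAd_mul_ad hu y) z

/-- The commutator of -ad u with δ is ad(δ u), which is already inner, so all higher commutators are
inner too. Splitting off the zeroth term δ of the exponential series leaves its coefficients shifted
by one, which are those of `expQuot`. -/
lemma expNegAd_mul_derivation (hu : IsNilpotent (LieAlgebra.ad ℂ L u))
    (δ : LieDerivation ℂ L L) :
    expNegAd u * (δ : L →ₗ[ℂ] L) =
      ((δ : L →ₗ[ℂ] L) + LieAlgebra.ad ℂ L (logDer u δ)) * expNegAd u := by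
  obtain ⟨n, h1, h2⟩ := exists_pow_adjoint_eq_zero hu
  rw [expNegAd, psEval_exp_mul hu.neg]
  congr 1
  have h0 : (LinearMap.mulLeft ℂ (-LieAlgebra.ad ℂ L u) -
      LinearMap.mulRight ℂ (-LieAlgebra.ad ℂ L u)) (δ : L →ₗ[ℂ] L) =
      LieAlgebra.ad ℂ L (δ u) := by
    refine LinearMap.ext fun z ↦ ?_
    simp only [LinearMap.sub_apply, LinearMap.mulLeft_apply, LinearMap.mulRight_apply,
      End.mul_apply, LinearMap.neg_apply, LieAlgebra.ad_apply, map_neg,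
      LieDerivation.coeFn_coe, LieDerivation.apply_lie_eq_add]
    abel
  rw [psEval_eq_sum _ (n := n + 1) (by rw [pow_succ, h2, zero_mul]), LinearMap.sum_apply,
    Finset.sum_range_succ', add_comm]
  congr 1
  · simp [PowerSeries.coeff_exp]
  · simp_rw [logDer, LinearMap.smul_apply, pow_succ, End.mul_apply, h0, pow_ad_apply_ad,
      psEval_eq_sum _ h1, LinearMap.sum_apply, LinearMap.smul_apply, map_sum, map_smul]
    refine Finset.sum_congr rfl fun i _ ↦ ?_
    congr 1
    simp [expQuot, PowerSeries.coeff_exp]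

lemma derivation_expNegAd (hu : IsNilpotent (LieAlgebra.ad ℂ L u))
    (δ : LieDerivation ℂ L L) {y : L} (hy : δ y = 0) :
    δ (expNegAd u y) = -⁅logDer u δ, expNegAd u y⁆ := by
  have := LinearMap.congr_fun (expNegAd_mul_derivation hu δ) y
  simp only [End.mul_apply, LieDerivation.coeFn_coe, hy, map_zero, LinearMap.add_apply,
    LieAlgebra.ad_apply] at this
  exact eq_neg_of_add_eq_zero_left this.symm

lemma isUnit_expNegAd (hu : IsNilpotent (LieAlgebra.ad ℂ L u))
    : IsUnit (expNegAd u) := by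
  have h1 := psEval_exp_add (Commute.neg_left (Commute.refl (LieAlgebra.ad ℂ L u))) hu.neg hu
  have h2 := psEval_exp_add (Commute.neg_right (Commute.refl (LieAlgebra.ad ℂ L u))) hu hu.neg
  have h0 : psEval (PowerSeries.exp ℂ) (0 : End ℂ L) = 1 := by
    rw [psEval_eq_sum (n := 1) _ (by simp)]
    simp [PowerSeries.coeff_exp]
  rw [neg_add_cancel, h0] at h1
  rw [add_neg_cancel, h0] at h2
  exact ⟨⟨_, _, h1.symm, h2.symm⟩, rfl⟩

/-- The Maurer–Cartan equation. -/
lemma logDer_lie (hu : IsNilpotent (LieAlgebra.ad ℂ L u))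
    (hc : Function.Injective (LieAlgebra.ad ℂ L)) (δ ε : LieDerivation ℂ L L) :
    logDer u ⁅δ, ε⁆ = δ (logDer u ε) - ε (logDer u δ) + ⁅logDer u δ, logDer u ε⁆ := by
  have h1 := expNegAd_mul_derivation hu δ
  have h2 := expNegAd_mul_derivation hu ε
  have h3 := expNegAd_mul_derivation hu ⁅δ, ε⁆
  apply hc
  -- The conjugate of a commutator is the commutator of the conjugates. Comparing the two
  -- expressions, cancelling the invertible `expNegAd u` and using injectivity of `ad` gives the
  -- equation.
  have h4 : (((⁅δ, ε⁆ : LieDerivation ℂ L L) : L →ₗ[ℂ] L) +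
      LieAlgebra.ad ℂ L (logDer u ⁅δ, ε⁆)) * expNegAd u =
      (((⁅δ, ε⁆ : LieDerivation ℂ L L) : L →ₗ[ℂ] L) + LieAlgebra.ad ℂ L
        (δ (logDer u ε) - ε (logDer u δ) + ⁅logDer u δ, logDer u ε⁆)) * expNegAd u := by
    rw [← h3]
    have h5 : ((⁅δ, ε⁆ : LieDerivation ℂ L L) : L →ₗ[ℂ] L) =
        (δ : L →ₗ[ℂ] L) * (ε : L →ₗ[ℂ] L) - (ε : L →ₗ[ℂ] L) * (δ : L →ₗ[ℂ] L) := by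
      refine LinearMap.ext fun z ↦ ?_
      simp
    have h6 : expNegAd u * ((⁅δ, ε⁆ : LieDerivation ℂ L L) : L →ₗ[ℂ] L) =
        (((δ : L →ₗ[ℂ] L) + LieAlgebra.ad ℂ L (logDer u δ)) *
          ((ε : L →ₗ[ℂ] L) + LieAlgebra.ad ℂ L (logDer u ε)) -
        ((ε : L →ₗ[ℂ] L) + LieAlgebra.ad ℂ L (logDer u ε)) *
          ((δ : L →ₗ[ℂ] L) + LieAlgebra.ad ℂ L (logDer u δ))) * expNegAd u := by
      rw [h5, mul_sub, ← mul_assoc, h1, ← mul_assoc, h2, mul_assoc, h2, mul_assoc, h1, sub_mul]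
      simp only [mul_assoc]
    rw [h6]
    congr 1
    refine LinearMap.ext fun z ↦ ?_
    simp only [LinearMap.sub_apply, LinearMap.add_apply, End.mul_apply, LieAlgebra.ad_apply,
      LieDerivation.coeFn_coe, LieDerivation.apply_lie_eq_add, LieDerivation.commutator_apply,
      map_add, sub_lie, lie_lie]
    abel
  exact add_left_cancel ((isUnit_expNegAd hu).mul_right_cancel h4)

/-- The identities behind the homomorphism property of the operators attached to a triangular
decomposition: `P` is the projection onto one of two complementary subalgebras, and `δ_y`, `δ_z` are
derivations with logarithmic derivative `-P (e^{-ad u} y)`, `-P (e^{-ad u} z)`. -/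
theorem logDer_lie_of_projection (hu : IsNilpotent (LieAlgebra.ad ℂ L u))
    (hc : Function.Injective (LieAlgebra.ad ℂ L)) (P : End ℂ L)
    (hP₁ : ∀ x y, P ⁅P x, P y⁆ = ⁅P x, P y⁆)
    (hP₂ : ∀ x y, P ⁅x - P x, y - P y⁆ = 0) {y z : L} (δ ε : LieDerivation ℂ L L)
    (hδ : ∀ x, δ (P x) = P (δ x)) (hε : ∀ x, ε (P x) = P (ε x))
    (hδz : δ z = 0) (hεy : ε y = 0)
    (hlδ : logDer u δ = -P (expNegAd u y)) (hlε : logDer u ε = -P (expNegAd u z)) :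
    logDer u ⁅δ, ε⁆ = -P (expNegAd u ⁅y, z⁆) ∧
      δ (expNegAd u z) - ε (expNegAd u y) - expNegAd u ⁅y, z⁆ =
        ⁅P (expNegAd u y), P (expNegAd u z)⁆ -
        ⁅expNegAd u y - P (expNegAd u y), expNegAd u z - P (expNegAd u z)⁆ := by
  have h1 := derivation_expNegAd hu δ hδz
  have h2 := derivation_expNegAd hu ε hεy
  rw [hlδ] at h1
  rw [hlε] at h2
  have h3 : δ (expNegAd u z) - ε (expNegAd u y) - expNegAd u ⁅y, z⁆ =
        ⁅P (expNegAd u y), P (expNegAd u z)⁆ -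
        ⁅expNegAd u y - P (expNegAd u y), expNegAd u z - P (expNegAd u z)⁆ := by
    rw [h1, h2, expNegAd_lie hu]
    simp only [neg_lie, lie_sub, sub_lie, neg_neg]
    rw [← lie_skew (P (expNegAd u z))]
    abel
  refine ⟨?_, h3⟩
  rw [logDer_lie hu hc, hlδ, hlε, map_neg, map_neg, hδ, hε, neg_lie, lie_neg, neg_neg]
  -- `P` fixes the first bracket on the right and kills the second, which turns the difference
  -- identity into the value required by the Maurer–Cartan equation.
  have h4 := congrArg P h3
  rw [map_sub, map_sub, map_sub, hP₁, hP₂, sub_zero] at h4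
  rw [← h4]
  abel

end Conj

/-! ### Heights -/

section Height

variable {g : Type*} [LieRing g] [LieAlgebra ℂ g] [FiniteDimensional ℂ g] [LieAlgebra.IsSimple ℂ g]
  {H : LieSubalgebra ℂ g} [H.IsCartanSubalgebra]

/-- There is an element of the Cartan subalgebra on which every root takes its height as value. -/
lemma exists_forall_root_eq_height (b : (rootSystem H).Base) :
    ∃ d : H, ∀ β : H.root, (rootSystem H).root β d = (b.height β : ℂ) := by
  -- Simple roots are independent, so some functional on the dual of `H` takes the value 1 on each
  -- of them; reflexivity turns it into an element of `H`.
  have hli := b.linearIndepOn_root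
  let B := Basis.span hli
  obtain ⟨l, hl⟩ := LinearMap.exists_extend (B.constr ℂ fun _ ↦ (1 : ℂ))
  have hl' : ∀ j ∈ b.support, l ((rootSystem H).root j) = 1 := by
    intro j hj
    have h1 := LinearMap.congr_fun hl (B ⟨j, hj⟩)
    rwa [Basis.constr_basis, LinearMap.comp_apply, Submodule.subtype_apply,
      show (B ⟨j, hj⟩ : Dual ℂ H) = _ from congrArg Subtype.val (Basis.span_apply hli ⟨j, hj⟩)] at h1
  refine ⟨(Module.evalEquiv ℂ H).symm l, fun β ↦ ?_⟩
  obtain ⟨c, -, -, hc⟩ := b.exists_root_eq_sum_int β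
  have h2 : (rootSystem H).root β ((Module.evalEquiv ℂ H).symm l) = l ((rootSystem H).root β) :=
    Module.apply_evalEquiv_symm_apply ℂ H _ l
  rw [h2, RootPairing.Base.height_eq_sum hc, hc, map_sum, Int.cast_sum]
  refine Finset.sum_congr rfl fun j hj ↦ ?_
  rw [map_zsmul, hl' j hj, zsmul_one]

/-- An element of the Cartan subalgebra on which every root takes its height as value. -/
def heightElt (b : (rootSystem H).Base) : H := (exists_forall_root_eq_height b).choose

lemma PosRoot.form_heightElt {b : (rootSystem H).Base} (α : PosRoot b) :
    α.form (heightElt b) = (b.height α.1 : ℂ) :=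
  (exists_forall_root_eq_height b).choose_spec α.1

lemma PosRoot.one_le_height {b : (rootSystem H).Base} (α : PosRoot b) : 1 ≤ b.height α.1 :=
  b.isPos_iff.mp α.2

lemma rootSpace_le_nil (b : (rootSystem H).Base) {χ : H → ℂ} {m : ℤ} (hm : 0 < m)
    (hχ : χ (heightElt b) = m) : (rootSpace H χ).toSubmodule ≤ nil b := by
  by_cases h0 : rootSpace H χ = ⊥
  · simp [h0]
  rcases eq_of_rootSpace_ne_bot b χ h0 with rfl | ⟨α, rfl⟩ | ⟨α, rfl⟩
  · simp only [Pi.zero_apply] at hχ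
    exact absurd (by exact_mod_cast hχ.symm) hm.ne'
  · exact le_iSup (fun α : PosRoot b ↦ (rootSpace H (α.form : H → ℂ)).toSubmodule) α
  · have h1 := α.one_le_height
    rw [Pi.neg_apply, α.form_heightElt] at hχ
    have : -b.height α.1 = m := by exact_mod_cast hχ
    omega

lemma rootSpace_le_nilBar (b : (rootSystem H).Base) {χ : H → ℂ} {m : ℤ} (hm : m < 0)
    (hχ : χ (heightElt b) = m) : (rootSpace H χ).toSubmodule ≤ nilBar b := by
  by_cases h0 : rootSpace H χ = ⊥
  · simp [h0]
  rcases eq_of_rootSpace_ne_bot b χ h0 with rfl | ⟨α, rfl⟩ | ⟨α, rfl⟩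
  · simp only [Pi.zero_apply] at hχ
    exact absurd (by exact_mod_cast hχ.symm) hm.ne
  · have h1 := α.one_le_height
    rw [α.form_heightElt] at hχ
    have : b.height α.1 = m := by exact_mod_cast hχ
    omega
  · exact le_iSup (fun α : PosRoot b ↦ (rootSpace H (-(α.form : H → ℂ))).toSubmodule) α

/-- A property of pairs that is biadditive and holds on generating submodules. -/
lemma iSup_induction₂ {V : Type*} [AddCommGroup V] [Module ℂ V] {ι κ : Type*}
    (M : ι → Submodule ℂ V) (N : κ → Submodule ℂ V) (Q : Submodule ℂ V) (B : V →ₗ[ℂ] V →ₗ[ℂ] V)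
    (h : ∀ i j, ∀ x ∈ M i, ∀ y ∈ N j, B x y ∈ Q) {x y : V} (hx : x ∈ ⨆ i, M i)
    (hy : y ∈ ⨆ j, N j) : B x y ∈ Q := by
  have h1 : ∀ i, ∀ x ∈ M i, ⨆ j, N j ≤ Q.comap (B x) := fun i x hx ↦
    iSup_le fun j y hy ↦ h i j x hx y hy
  have h2 : ⨆ i, M i ≤ Q.comap (B.flip y) := iSup_le fun i x hx ↦ h1 i x hx hy
  exact h2 hx

lemma lie_mem_nilBar (b : (rootSystem H).Base) {x y : g} (hx : x ∈ nilBar b)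
    (hy : y ∈ nilBar b) : ⁅x, y⁆ ∈ nilBar b := by
  refine iSup_induction₂ _ _ (nilBar b) (LieModule.toEnd ℂ g g : g →ₗ[ℂ] End ℂ g) ?_ hx hy
  intro α β x hx y hy
  have h1 := α.one_le_height
  have h2 := β.one_le_height
  refine rootSpace_le_nilBar b (χ := -(α.form : H → ℂ) + -(β.form : H → ℂ))
    (m := -b.height α.1 + -b.height β.1) (by omega) ?_
    (lie_mem_genWeightSpace_of_mem_genWeightSpace hx hy)
  simp [PosRoot.form_heightElt]

lemma lie_mem_nil_of_cartan (b : (rootSystem H).Base) {x y : g} (hx : x ∈ H)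
    (hy : y ∈ nil b) : ⁅x, y⁆ ∈ nil b := by
  have : nil b ≤ (nil b).comap (LieModule.toEnd ℂ g g x) := by
    refine iSup_le fun α y hy ↦ ?_
    refine le_iSup (fun α : PosRoot b ↦ (rootSpace H (α.form : H → ℂ)).toSubmodule) α ?_
    exact (rootSpace H (α.form : H → ℂ)).lie_mem (x := ⟨x, hx⟩) hy
  exact this hy

lemma lie_mem_nil_of_nil (b : (rootSystem H).Base) {x y : g} (hx : x ∈ nil b)
    (hy : y ∈ nil b) : ⁅x, y⁆ ∈ nil b := by
  refine iSup_induction₂ _ _ (nil b) (LieModule.toEnd ℂ g g : g →ₗ[ℂ] End ℂ g) ?_ hx hy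
  intro α β x hx y hy
  have h1 := α.one_le_height
  have h2 := β.one_le_height
  refine rootSpace_le_nil b (χ := (α.form : H → ℂ) + (β.form : H → ℂ))
    (m := b.height α.1 + b.height β.1) (by omega) ?_
    (lie_mem_genWeightSpace_of_mem_genWeightSpace hx hy)
  simp [PosRoot.form_heightElt]

/-- Since `H` is abelian, the bracket loses its Cartan part. This is more than closure under
brackets, and it is what makes the scalar term of π a cocycle. -/
lemma lie_mem_nil (b : (rootSystem H).Base) {x y : g} (hx : x ∈ H.toSubmodule ⊔ nil b)
    (hy : y ∈ H.toSubmodule ⊔ nil b) : ⁅x, y⁆ ∈ nil b := by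
  obtain ⟨h, hh, n, hn, rfl⟩ := Submodule.mem_sup.mp hx
  obtain ⟨h', hh', n', hn', rfl⟩ := Submodule.mem_sup.mp hy
  have h0 : ⁅h, h'⁆ = 0 := by
    have := trivial_lie_zero H H ⟨h, hh⟩ ⟨h', hh'⟩
    simpa using congrArg Subtype.val this
  rw [add_lie, lie_add, lie_add, h0, zero_add, ← lie_skew n h']
  exact add_mem (lie_mem_nil_of_cartan b hh hn') (add_mem
    (neg_mem (lie_mem_nil_of_cartan b hh' hn)) (lie_mem_nil_of_nil b hn hn'))

/-- The sum of the root spaces of height at most `k`. -/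
def heightFilt (b : (rootSystem H).Base) (k : ℤ) : Submodule ℂ g :=
  ⨆ χ : {χ : H → ℂ // ∃ m : ℤ, m ≤ k ∧ χ (heightElt b) = m}, (rootSpace H χ.1).toSubmodule

lemma lie_mem_heightFilt (b : (rootSystem H).Base) (α : PosRoot b) {x y : g} {k : ℤ}
    (hx : x ∈ rootSpace H (-(α.form : H → ℂ))) (hy : y ∈ heightFilt b k) :
    ⁅x, y⁆ ∈ heightFilt b (k - 1) := by
  have : heightFilt b k ≤ (heightFilt b (k - 1)).comap (LieModule.toEnd ℂ g g x) := by
    refine iSup_le fun ⟨χ, m, hm, hχ⟩ y hy ↦ ?_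
    have h1 := α.one_le_height
    refine le_iSup (fun χ : {χ : H → ℂ // ∃ m : ℤ, m ≤ k - 1 ∧ χ (heightElt b) = m} ↦
      (rootSpace H χ.1).toSubmodule) ⟨-(α.form : H → ℂ) + χ, -b.height α.1 + m, by omega, ?_⟩
      (lie_mem_genWeightSpace_of_mem_genWeightSpace hx hy)
    simp [PosRoot.form_heightElt, hχ]
  exact this hy

lemma exists_height_bound (b : (rootSystem H).Base) : ∃ K : ℤ, ∀ χ : H → ℂ,
    rootSpace H χ ≠ ⊥ → ∃ m : ℤ, -K < m ∧ m < K ∧ χ (heightElt b) = m := by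
  refine ⟨∑ α : PosRoot b, b.height α.1 + 1, fun χ hχ ↦ ?_⟩
  have h0 : ∀ α : PosRoot b, b.height α.1 ≤ ∑ α : PosRoot b, b.height α.1 := fun α ↦
    Finset.single_le_sum (f := fun α : PosRoot b ↦ b.height α.1)
      (fun i _ ↦ by have := i.one_le_height; omega) (Finset.mem_univ α)
  have h1 : 0 ≤ ∑ α : PosRoot b, b.height α.1 :=
    Finset.sum_nonneg fun i _ ↦ by have := i.one_le_height; omega
  rcases eq_of_rootSpace_ne_bot b χ hχ with rfl | ⟨α, rfl⟩ | ⟨α, rfl⟩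
  · exact ⟨0, by omega, by omega, by simp⟩
  · have := α.one_le_height
    have := h0 α
    exact ⟨b.height α.1, by omega, by omega, α.form_heightElt⟩
  · have := α.one_le_height
    have := h0 α
    exact ⟨-b.height α.1, by omega, by omega, by simp [α.form_heightElt]⟩

lemma exists_heightFilt (b : (rootSystem H).Base) :
    ∃ (k : ℤ) (n : ℕ), heightFilt b k = ⊤ ∧ heightFilt b (k - n) = ⊥ := by
  obtain ⟨K, hK⟩ := exists_height_bound b
  refine ⟨K, (2 * K).toNat, ?_, ?_⟩
  · rw [eq_top_iff,
      ← LieSubmodule.iSup_toSubmodule_eq_top.mpr (LieModule.iSup_genWeightSpace_eq_top ℂ H g)]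
    refine iSup_le fun χ ↦ ?_
    by_cases hχ : rootSpace H χ = ⊥
    · simp [hχ]
    · obtain ⟨m, -, h2, h3⟩ := hK χ hχ
      exact le_iSup (fun χ : {χ : H → ℂ // ∃ m : ℤ, m ≤ K ∧ χ (heightElt b) = m} ↦
        (rootSpace H χ.1).toSubmodule) ⟨χ, m, h2.le, h3⟩
  · rw [heightFilt, iSup_eq_bot]
    rintro ⟨χ, m, h1, h2⟩
    by_contra h
    obtain ⟨m', h3, h4, h5⟩ := hK χ (fun h' ↦ h (by simp [h']))
    have : m = m' := by exact_mod_cast h2.symm.trans h5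
    omega

/-- The lowest root vector commutes with the opposite nilradical. -/
lemma lie_eq_zero_of_isMaximalRoot {b : (rootSystem H).Base} {θ : PosRoot b}
    (hθ : IsMaximalRoot θ) {x y : g} (hx : x ∈ rootSpace H (-(θ.form : H → ℂ)))
    (hy : y ∈ nilBar b) : ⁅x, y⁆ = 0 := by
  have : nilBar b ≤ (⊥ : Submodule ℂ g).comap (LieModule.toEnd ℂ g g x) := by
    refine iSup_le fun α y hy ↦ ?_
    have h1 : ⁅x, y⁆ ∈ rootSpace H (-(θ.form : H → ℂ) + -(α.form : H → ℂ)) :=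
      lie_mem_genWeightSpace_of_mem_genWeightSpace hx hy
    by_cases h0 : rootSpace H (-(θ.form : H → ℂ) + -(α.form : H → ℂ)) = ⊥
    · rw [h0] at h1
      exact h1
    exfalso
    -- The form -θ - α has negative height, so it is neither zero nor a positive root; if it were a
    -- negative root, θ + α would be a root, against maximality.
    rcases eq_of_rootSpace_ne_bot b _ h0 with h | ⟨β, h⟩ | ⟨β, h⟩
    · have h2 := congrFun h (heightElt b)
      simp only [Pi.add_apply, Pi.neg_apply, PosRoot.form_heightElt, Pi.zero_apply] at h2
      have h3 : -b.height θ.1 + -b.height α.1 = 0 := by exact_mod_cast h2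
      have := α.one_le_height
      have := θ.one_le_height
      omega
    · have h2 := congrFun h (heightElt b)
      simp only [Pi.add_apply, Pi.neg_apply, PosRoot.form_heightElt] at h2
      have h3 : b.height β.1 = -b.height θ.1 + -b.height α.1 := by exact_mod_cast h2
      have := α.one_le_height
      have := θ.one_le_height
      have := β.one_le_height
      omega
    · refine hθ α β.1 (DFunLike.coe_injective ?_)
      have h2 := congrArg Neg.neg h
      rw [neg_neg] at h2
      change (β.form : H → ℂ) = _
      rw [h2]
      ext z
      simp [add_comm]
  exact this hy

end Height

/-! ### Extension of scalars -/

section ExtForm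

variable {A : Type*} [CommRing A] [Algebra ℂ A] {V : Type*} [AddCommGroup V] [Module ℂ V]

@[simp] lemma extForm_tmul (φ : V →ₗ[ℂ] ℂ) (s : A) (x : V) : extForm A φ (s ⊗ₜ x) = φ x • s := by
  simp [extForm]

lemma eq_zero_of_extForm [FiniteDimensional ℂ V] {y : A ⊗[ℂ] V}
    (h : ∀ φ : V →ₗ[ℂ] ℂ, extForm A φ y = 0) : y = 0 := by
  let B := Module.finBasis ℂ V
  refine (B.baseChange A).ext_elem fun i ↦ ?_
  have key : (B.baseChange A).coord i = extForm A (B.coord i) := by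
    refine (B.baseChange A).ext fun j ↦ ?_
    simp [Basis.baseChange_apply, Finsupp.single_apply, Algebra.smul_def]
  rw [map_zero, Finsupp.zero_apply]
  exact (LinearMap.congr_fun key y).trans (h _)

end ExtForm

section ScalarExtension

variable {A : Type*} [CommRing A] [Algebra ℂ A] {g : Type*} [LieRing g] [LieAlgebra ℂ g]

/-- Contracting a central element of A ⊗ g along a linear functional on A gives a central element of
g, hence zero. Such contractions, followed by functionals on g, separate the points of A ⊗ g. -/
lemma ad_injective_of_center [FiniteDimensional ℂ g]
    (hc : ∀ x : g, (∀ z : g, ⁅x, z⁆ = 0) → x = 0) :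
    Function.Injective (LieAlgebra.ad ℂ (A ⊗[ℂ] g)) := by
  rw [injective_iff_map_eq_zero]
  intro y hy
  refine eq_zero_of_extForm fun φ ↦ ?_
  rw [← Module.forall_dual_apply_eq_zero_iff ℂ]
  intro c
  let C : A ⊗[ℂ] g →ₗ[ℂ] g := TensorProduct.lift ((LinearMap.lsmul ℂ g : ℂ →ₗ[ℂ] End ℂ g) ∘ₗ c)
  have hC (s : A) (x : g) : C (s ⊗ₜ x) = c s • x := by simp [C]
  have h1 (w : A ⊗[ℂ] g) : c (extForm A φ w) = φ (C w) := by
    induction w with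
    | zero => simp
    | add w₁ w₂ h₁ h₂ => simp [h₁, h₂]
    | tmul s x => simp [hC, mul_comm]
  have h2 (w : A ⊗[ℂ] g) (z : g) : C ⁅w, (1 : A) ⊗ₜ[ℂ] z⁆ = ⁅C w, z⁆ := by
    induction w with
    | zero => simp
    | add w₁ w₂ h₁ h₂ => simp [h₁, h₂]
    | tmul s x => simp [hC, LieAlgebra.ExtendScalars.bracket_tmul]
  rw [h1, hc (C y), map_zero]
  intro z
  rw [← h2, ← LieAlgebra.ad_apply ℂ, hy, LinearMap.zero_apply, map_zero]

/-- The extension of a derivation of `A` to a derivation of the Lie algebra `A ⊗ g`. -/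
def tensorDer (D : Derivation ℂ A A) : LieDerivation ℂ (A ⊗[ℂ] g) (A ⊗[ℂ] g) where
  toLinearMap := (D : A →ₗ[ℂ] A).rTensor g
  leibniz' := by
    intro y z
    induction y with
    | zero => simp
    | add y₁ y₂ h₁ h₂ => simp only [add_lie, lie_add, map_add, h₁, h₂]; abel
    | tmul s x =>
      induction z with
      | zero => simp
      | add z₁ z₂ h₁ h₂ => simp only [add_lie, lie_add, map_add, h₁, h₂]; abel
      | tmul t w =>
        simp only [LieAlgebra.ExtendScalars.bracket_tmul, LinearMap.rTensor_tmul,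
          Derivation.coeFn_coe, Derivation.leibniz, smul_eq_mul, TensorProduct.add_tmul]
        rw [← lie_skew w x, TensorProduct.tmul_neg, sub_neg_eq_add]

@[simp] lemma tensorDer_tmul (D : Derivation ℂ A A) (s : A) (x : g) :
    tensorDer D (s ⊗ₜ[ℂ] x) = D s ⊗ₜ[ℂ] x := rfl

lemma tensorDer_lie (D E : Derivation ℂ A A) :
    tensorDer (g := g) ⁅D, E⁆ = ⁅tensorDer (g := g) D, tensorDer (g := g) E⁆ := by
  ext y
  rw [LieDerivation.commutator_apply]
  induction y with
  | zero => simp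
  | add y₁ y₂ h₁ h₂ => simp only [map_add, h₁, h₂]; abel
  | tmul s x => simp [Derivation.commutator_apply, TensorProduct.sub_tmul]

lemma tensorDer_baseChange (D : Derivation ℂ A A) (p : g →ₗ[ℂ] g) (y : A ⊗[ℂ] g) :
    tensorDer D (p.baseChange A y) = p.baseChange A (tensorDer D y) := by
  induction y with
  | zero => simp
  | add y₁ y₂ h₁ h₂ => simp only [map_add, h₁, h₂]
  | tmul s x => simp

lemma extForm_tensorDer (D : Derivation ℂ A A) (φ : g →ₗ[ℂ] ℂ) (y : A ⊗[ℂ] g) :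
    extForm A φ (tensorDer D y) = D (extForm A φ y) := by
  induction y with
  | zero => simp
  | add y₁ y₂ h₁ h₂ => simp only [map_add, h₁, h₂]
  | tmul s x => simp

/-- A linear map that vanishes on a family of brackets still does so after extension of scalars. -/
lemma lie_baseChange_induction {W : Type*} [AddCommGroup W] [Module ℂ W]
    (p q : g →ₗ[ℂ] g) (F : A ⊗[ℂ] g →ₗ[ℂ] W)
    (h : ∀ (s : A) (x y : g), F (s ⊗ₜ ⁅p x, q y⁆) = 0) (y z : A ⊗[ℂ] g) :
    F ⁅p.baseChange A y, q.baseChange A z⁆ = 0 := by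
  induction y with
  | zero => simp
  | add y₁ y₂ h₁ h₂ => simp only [add_lie, map_add, h₁, h₂, add_zero]
  | tmul s x =>
    induction z with
    | zero => simp
    | add z₁ z₂ h₁ h₂ => simp only [lie_add, map_add, h₁, h₂, add_zero]
    | tmul t w => simp [LieAlgebra.ExtendScalars.bracket_tmul, h]

/-- This passes from A-linear to ℂ-linear operators, which is necessary because derivations of the
coefficients are not A-linear. -/
lemma nilEval_apply {T : Module.End A (A ⊗[ℂ] g)} {S : Module.End ℂ (A ⊗[ℂ] g)}
    (hTS : ∀ y, T y = S y) (hS : IsNilpotent S) (φ : PowerSeries ℂ) (y : A ⊗[ℂ] g) :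
    nilEval φ T y = psEval φ S y := by
  have hpow (n : ℕ) (y : A ⊗[ℂ] g) : (T ^ n) y = (S ^ n) y := by
    induction n generalizing y with
    | zero => rfl
    | succ n ih => rw [pow_succ, pow_succ, End.mul_apply, End.mul_apply, ih, hTS]
  obtain ⟨n, hn⟩ := hS
  have hT : IsNilpotent T := ⟨n, LinearMap.ext fun y ↦ by rw [hpow, hn]; rfl⟩
  have hc : S ^ nilpotencyClass T = 0 := LinearMap.ext fun y ↦ by
    rw [← hpow, pow_nilpotencyClass hT]; rfl
  rw [psEval_eq_sum φ hc, nilEval, LinearMap.sum_apply, LinearMap.sum_apply]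
  simp [hpow]

end ScalarExtension

/-! ### Projections of the triangular decomposition and nilpotency of ad u. -/

section DiffOp

variable {g : Type*} [LieRing g] [LieAlgebra ℂ g] [FiniteDimensional ℂ g] [LieAlgebra.IsSimple ℂ g]
  {H : LieSubalgebra ℂ g} [H.IsCartanSubalgebra] {b : (rootSystem H).Base}

/-- The projection of `g` onto the opposite nilradical, as an endomorphism. -/
def nilBarProj (b : (rootSystem H).Base) : g →ₗ[ℂ] g := (nilBar b).subtype ∘ₗ nilBarPart b

lemma nilBarProj_mem (b : (rootSystem H).Base) (x : g) : nilBarProj b x ∈ nilBar b :=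
  (nilBarPart b x).2

lemma nilBarPart_coe (x : nilBar b) : nilBarPart b (x : g) = x := by
  simp [nilBarPart]

lemma nilBarProj_eq_self {x : g} (hx : x ∈ nilBar b) : nilBarProj b x = x :=
  congrArg Subtype.val (nilBarPart_coe (⟨x, hx⟩ : nilBar b))

lemma nilBarProj_eq_zero {x : g} (hx : x ∈ H.toSubmodule ⊔ nil b) : nilBarProj b x = 0 := by
  have : nilBarPart b x = 0 := (Submodule.projectionOnto_apply_eq_zero_iff _).mpr hx
  simp [nilBarProj, this]

lemma sub_nilBarProj_mem (b : (rootSystem H).Base) (x : g) :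
    x - nilBarProj b x ∈ H.toSubmodule ⊔ nil b := by
  rw [← Submodule.projectionOnto_apply_eq_zero_iff (isCompl_nilBar b)]
  change nilBarPart b _ = 0
  rw [map_sub, sub_eq_zero]
  exact (nilBarPart_coe _).symm

lemma cartanPart_coe (x : H) : cartanPart b (x : g) = x := by
  exact Submodule.projectionOnto_apply_left (isCompl_cartan b) x

lemma cartanPart_eq_zero_of_nilBar {x : g} (hx : x ∈ nilBar b) : cartanPart b x = 0 :=
  (Submodule.projectionOnto_apply_eq_zero_iff _).mpr (Submodule.mem_sup_left hx)

lemma cartanPart_eq_zero_of_nil {x : g} (hx : x ∈ nil b) : cartanPart b x = 0 :=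
  (Submodule.projectionOnto_apply_eq_zero_iff _).mpr (Submodule.mem_sup_right hx)

section Nilpotent

variable (f : Basis (PosRoot b) ℂ (nilBar b))

lemma adU_apply (y : MvPolynomial (PosRoot b) ℂ ⊗[ℂ] g) :
    adU f y = LieAlgebra.ad ℂ (MvPolynomial (PosRoot b) ℂ ⊗[ℂ] g) (uElt f) y := rfl

lemma lie_uElt_tmul (p : MvPolynomial (PosRoot b) ℂ) (x : g) :
    ⁅uElt f, p ⊗ₜ[ℂ] x⁆ = ∑ α, (MvPolynomial.X α * p) ⊗ₜ[ℂ] ⁅(f α : g), x⁆ := by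
  change LieAlgebra.ad ℂ (MvPolynomial (PosRoot b) ℂ ⊗[ℂ] g) (uElt f) (p ⊗ₜ[ℂ] x) = _
  rw [uElt, map_sum, LinearMap.sum_apply]
  rfl

lemma lie_uElt_mem {N N' : Submodule ℂ g} (h : ∀ α : PosRoot b, ∀ x ∈ N, ⁅(f α : g), x⁆ ∈ N')
    {y : MvPolynomial (PosRoot b) ℂ ⊗[ℂ] g} (hy : y ∈ N.baseChange (MvPolynomial (PosRoot b) ℂ)) :
    ⁅uElt f, y⁆ ∈ N'.baseChange (MvPolynomial (PosRoot b) ℂ) := by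
  have : N.baseChange (MvPolynomial (PosRoot b) ℂ) ≤
      (N'.baseChange (MvPolynomial (PosRoot b) ℂ)).comap (adU f) := by
    rw [Submodule.baseChange_eq_span, Submodule.span_le]
    rintro _ ⟨x, hx, rfl⟩
    change ⁅uElt f, (1 : MvPolynomial (PosRoot b) ℂ) ⊗ₜ[ℂ] x⁆ ∈ N'.baseChange _
    rw [lie_uElt_tmul]
    exact Submodule.sum_mem _ fun α _ ↦ Submodule.tmul_mem_baseChange_of_mem _ (h α x hx)
  exact this hy

/-- Each f_α lowers the height by at least one, and only finitely many heights occur in g. -/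
lemma isNilpotent_ad_uElt
    (hf : ∀ α : PosRoot b, (f α : g) ∈ rootSpace H (-(α.form : H → ℂ))) :
    IsNilpotent (LieAlgebra.ad ℂ (MvPolynomial (PosRoot b) ℂ ⊗[ℂ] g) (uElt f)) := by
  obtain ⟨k, n, h1, h2⟩ := exists_heightFilt b
  refine ⟨n, LinearMap.ext fun y ↦ ?_⟩
  have key (m : ℕ) : ((LieAlgebra.ad ℂ (MvPolynomial (PosRoot b) ℂ ⊗[ℂ] g) (uElt f)) ^ m) y ∈
      (heightFilt b (k - m)).baseChange (MvPolynomial (PosRoot b) ℂ) := by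
    induction m with
    | zero => simp [h1]
    | succ m ih =>
      rw [pow_succ', End.mul_apply, LieAlgebra.ad_apply]
      have h3 : k - ((m + 1 : ℕ) : ℤ) = k - m - 1 := by push_cast; ring
      rw [h3]
      exact lie_uElt_mem f (fun α x hx ↦ lie_mem_heightFilt b α (hf α) hx) ih
  have := key n
  rw [h2] at this
  simpa using this

end Nilpotent

end DiffOp

/-! ### The homomorphism property -/

section DiffOpHom

variable {g : Type*} [LieRing g] [LieAlgebra ℂ g] [FiniteDimensional ℂ g] [LieAlgebra.IsSimple ℂ g]
  {H : LieSubalgebra ℂ g} [H.IsCartanSubalgebra] {b : (rootSystem H).Base}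
  (f : Basis (PosRoot b) ℂ (nilBar b))

/-- The extension of the projection onto the opposite nilradical to `ℂ[n̄] ⊗ g`. -/
def bigProj (b : (rootSystem H).Base) : End ℂ (MvPolynomial (PosRoot b) ℂ ⊗[ℂ] g) :=
  ((nilBarProj b).baseChange (MvPolynomial (PosRoot b) ℂ)).restrictScalars ℂ

@[simp] lemma bigProj_tmul (p : MvPolynomial (PosRoot b) ℂ) (x : g) :
    bigProj b (p ⊗ₜ[ℂ] x) = p ⊗ₜ[ℂ] nilBarProj b x := rfl

lemma bigProj_mem (y : MvPolynomial (PosRoot b) ℂ ⊗[ℂ] g) :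
    bigProj b y ∈ (nilBar b).baseChange (MvPolynomial (PosRoot b) ℂ) := by
  induction y with
  | zero => simp
  | add y z hy hz => rw [map_add]; exact add_mem hy hz
  | tmul p x => exact Submodule.tmul_mem_baseChange_of_mem _ (nilBarProj_mem b x)

lemma bigProj_eq_self {y : MvPolynomial (PosRoot b) ℂ ⊗[ℂ] g}
    (hy : y ∈ (nilBar b).baseChange (MvPolynomial (PosRoot b) ℂ)) : bigProj b y = y := by
  have : (nilBar b).baseChange (MvPolynomial (PosRoot b) ℂ) ≤
      LinearMap.eqLocus ((nilBarProj b).baseChange (MvPolynomial (PosRoot b) ℂ))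
        LinearMap.id := by
    rw [Submodule.baseChange_eq_span, Submodule.span_le]
    rintro _ ⟨x, hx, rfl⟩
    simp [nilBarProj_eq_self hx]
  exact this hy

lemma sub_bigProj (y : MvPolynomial (PosRoot b) ℂ ⊗[ℂ] g) :
    y - bigProj b y = (LinearMap.id - nilBarProj b).baseChange (MvPolynomial (PosRoot b) ℂ) y := by
  rw [LinearMap.baseChange_sub, LinearMap.sub_apply, LinearMap.baseChange_id]
  rfl

lemma bigProj_lie (y z : MvPolynomial (PosRoot b) ℂ ⊗[ℂ] g) :
    bigProj b ⁅bigProj b y, bigProj b z⁆ = ⁅bigProj b y, bigProj b z⁆ := by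
  rw [← sub_eq_zero]
  refine lie_baseChange_induction (nilBarProj b) (nilBarProj b) (bigProj b - LinearMap.id)
    (fun s x y ↦ ?_) y z
  simp [nilBarProj_eq_self (lie_mem_nilBar b (nilBarProj_mem b x) (nilBarProj_mem b y))]

lemma bigProj_lie_sub (y z : MvPolynomial (PosRoot b) ℂ ⊗[ℂ] g) :
    bigProj b ⁅y - bigProj b y, z - bigProj b z⁆ = 0 := by
  rw [sub_bigProj, sub_bigProj]
  refine lie_baseChange_induction _ _ (bigProj b) (fun s x y ↦ ?_) y z
  have := lie_mem_nil b (sub_nilBarProj_mem b x) (sub_nilBarProj_mem b y)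
  rw [bigProj_tmul, LinearMap.sub_apply, LinearMap.sub_apply, LinearMap.id_apply,
    LinearMap.id_apply, nilBarProj_eq_zero (Submodule.mem_sup_right this), TensorProduct.tmul_zero]

lemma extForm_cartan_lie (μ : Dual ℂ H) (y z : MvPolynomial (PosRoot b) ℂ ⊗[ℂ] g) :
    extForm (MvPolynomial (PosRoot b) ℂ) (μ ∘ₗ cartanPart b) ⁅bigProj b y, bigProj b z⁆ = 0 := by
  refine lie_baseChange_induction (nilBarProj b) (nilBarProj b)
    ((extForm (MvPolynomial (PosRoot b) ℂ) (μ ∘ₗ cartanPart b)).restrictScalars ℂ)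
    (fun s x y ↦ ?_) y z
  have := lie_mem_nilBar b (nilBarProj_mem b x) (nilBarProj_mem b y)
  simp [cartanPart_eq_zero_of_nilBar this]

lemma extForm_cartan_lie_sub (μ : Dual ℂ H) (y z : MvPolynomial (PosRoot b) ℂ ⊗[ℂ] g) :
    extForm (MvPolynomial (PosRoot b) ℂ) (μ ∘ₗ cartanPart b)
      ⁅y - bigProj b y, z - bigProj b z⁆ = 0 := by
  rw [sub_bigProj, sub_bigProj]
  refine lie_baseChange_induction _ _
    ((extForm (MvPolynomial (PosRoot b) ℂ) (μ ∘ₗ cartanPart b)).restrictScalars ℂ)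
    (fun s x y ↦ ?_) y z
  have := lie_mem_nil b (sub_nilBarProj_mem b x) (sub_nilBarProj_mem b y)
  rw [LinearMap.restrictScalars_apply, extForm_tmul, LinearMap.comp_apply, LinearMap.sub_apply,
    LinearMap.sub_apply, LinearMap.id_apply, LinearMap.id_apply, cartanPart_eq_zero_of_nil this,
    map_zero, zero_smul]

lemma extForm_cartan_of_mem (μ : Dual ℂ H) {y : MvPolynomial (PosRoot b) ℂ ⊗[ℂ] g}
    (hy : y ∈ (nilBar b).baseChange (MvPolynomial (PosRoot b) ℂ)) :
    extForm (MvPolynomial (PosRoot b) ℂ) (μ ∘ₗ cartanPart b) y = 0 := by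
  have : (nilBar b).baseChange (MvPolynomial (PosRoot b) ℂ) ≤
      LinearMap.ker (extForm (MvPolynomial (PosRoot b) ℂ) (μ ∘ₗ cartanPart b)) := by
    rw [Submodule.baseChange_eq_span, Submodule.span_le]
    rintro _ ⟨x, hx, rfl⟩
    simp [cartanPart_eq_zero_of_nilBar hx]
  exact this hy

/-- The `α`-th coordinate of the component of an element of `ℂ[n̄] ⊗ g` in `ℂ[n̄] ⊗ n̄`. -/
def coordForm (α : PosRoot b) :
    MvPolynomial (PosRoot b) ℂ ⊗[ℂ] g →ₗ[MvPolynomial (PosRoot b) ℂ] MvPolynomial (PosRoot b) ℂ :=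
  extForm (MvPolynomial (PosRoot b) ℂ) (f.coord α ∘ₗ nilBarPart b)

lemma coordForm_tmul_self [DecidableEq (PosRoot b)] (p : MvPolynomial (PosRoot b) ℂ)
    (α β : PosRoot b) : coordForm f α (p ⊗ₜ[ℂ] (f β : g)) = if β = α then p else 0 := by
  simp [coordForm, nilBarPart_coe, Finsupp.single_apply]

lemma sum_coordForm_tmul (y : MvPolynomial (PosRoot b) ℂ ⊗[ℂ] g) :
    ∑ α, coordForm f α y ⊗ₜ[ℂ] (f α : g) = bigProj b y := by
  induction y with
  | zero => simp
  | add y z hy hz => simp only [map_add, TensorProduct.add_tmul, Finset.sum_add_distrib, hy, hz]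
  | tmul p x =>
    have h1 : nilBarProj b x = ∑ α, f.repr (nilBarPart b x) α • (f α : g) := by
      have h := congrArg (nilBar b).subtype (f.sum_repr (nilBarPart b x)).symm
      simp only [map_sum, map_smul] at h
      exact h
    rw [bigProj_tmul, h1, TensorProduct.tmul_sum]
    refine Finset.sum_congr rfl fun α _ ↦ ?_
    simp [coordForm, TensorProduct.smul_tmul]

lemma psEval_mem (φ : PowerSeries ℂ) {y : MvPolynomial (PosRoot b) ℂ ⊗[ℂ] g}
    (hy : y ∈ (nilBar b).baseChange (MvPolynomial (PosRoot b) ℂ)) :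
    psEval φ (LieAlgebra.ad ℂ (MvPolynomial (PosRoot b) ℂ ⊗[ℂ] g) (uElt f)) y ∈
      (nilBar b).baseChange (MvPolynomial (PosRoot b) ℂ) := by
  have h (n : ℕ) : ((LieAlgebra.ad ℂ (MvPolynomial (PosRoot b) ℂ ⊗[ℂ] g) (uElt f)) ^ n) y ∈
      ((nilBar b).baseChange (MvPolynomial (PosRoot b) ℂ)).restrictScalars ℂ := by
    induction n with
    | zero => exact hy
    | succ n ih =>
      rw [pow_succ', End.mul_apply, LieAlgebra.ad_apply]
      exact lie_uElt_mem f (fun α x hx ↦ lie_mem_nilBar b (f α).2 hx) ih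
  rw [psEval, LinearMap.sum_apply]
  exact sum_mem fun i _ ↦ Submodule.smul_mem
    (((nilBar b).baseChange (MvPolynomial (PosRoot b) ℂ)).restrictScalars ℂ) _ (h i)

lemma expNegAdU_eq (hf : ∀ α : PosRoot b, (f α : g) ∈ rootSpace H (-(α.form : H → ℂ))) (a : g) :
    expNegAdU f a = expNegAd (uElt f) (1 ⊗ₜ[ℂ] a) :=
  nilEval_apply (T := -adU f)
    (S := -LieAlgebra.ad ℂ (MvPolynomial (PosRoot b) ℂ ⊗[ℂ] g) (uElt f))
    (fun y ↦ congrArg Neg.neg (adU_apply f y)) (isNilpotent_ad_uElt f hf).neg _ _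

/-- The element `(ad(u) e^{ad(u)} / (e^{ad(u)} - id)) (e^{-ad(u)} a)_{n̄}`. -/
def vectorElt (a : g) : MvPolynomial (PosRoot b) ℂ ⊗[ℂ] g :=
  psEval (bernoulli'PowerSeries ℂ)
    (LieAlgebra.ad ℂ (MvPolynomial (PosRoot b) ℂ ⊗[ℂ] g) (uElt f))
    (bigProj b (expNegAd (uElt f) (1 ⊗ₜ[ℂ] a)))

lemma vectorCoeff_eq (hf : ∀ α : PosRoot b, (f α : g) ∈ rootSpace H (-(α.form : H → ℂ)))
    (a : g) (α : PosRoot b) : vectorCoeff f a α = coordForm f α (vectorElt f a) := by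
  rw [vectorCoeff, expNegAdU_eq f hf,
    nilEval_apply (T := adU f)
    (S := LieAlgebra.ad ℂ (MvPolynomial (PosRoot b) ℂ ⊗[ℂ] g) (uElt f))
    (adU_apply f) (isNilpotent_ad_uElt f hf)]
  rfl

lemma vectorElt_add (a c : g) : vectorElt f (a + c) = vectorElt f a + vectorElt f c := by
  simp [vectorElt, TensorProduct.tmul_add]

lemma vectorElt_smul (t : ℂ) (a : g) : vectorElt f (t • a) = t • vectorElt f a := by
  simp [vectorElt, TensorProduct.tmul_smul]

/-- The vector field part of `diffOp`. -/
def vectorField (a : g) : Derivation ℂ (MvPolynomial (PosRoot b) ℂ) (MvPolynomial (PosRoot b) ℂ) :=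
  MvPolynomial.mkDerivation ℂ fun α ↦ -coordForm f α (vectorElt f a)

/-- The potential part of `diffOp`. -/
def potential (μ : Dual ℂ H) (a : g) : MvPolynomial (PosRoot b) ℂ :=
  extForm (MvPolynomial (PosRoot b) ℂ) (μ ∘ₗ cartanPart b) (expNegAd (uElt f) (1 ⊗ₜ[ℂ] a))

lemma diffOp_eq (hf : ∀ α : PosRoot b, (f α : g) ∈ rootSpace H (-(α.form : H → ℂ)))
    (lam : Dual ℂ H) (a : g) : diffOp f lam a =
      weylOfDer (vectorField f a) + Weyl.ofPoly (potential f (lam + rho b) a) := by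
  simp only [diffOp, weylOfDer, scalarCoeff, potential, vectorField, MvPolynomial.mkDerivation_X,
    vectorCoeff_eq f hf, expNegAdU_eq f hf, map_neg, neg_mul, Finset.sum_neg_distrib]

lemma tensorDer_uElt (D : Derivation ℂ (MvPolynomial (PosRoot b) ℂ) (MvPolynomial (PosRoot b) ℂ)) :
    tensorDer D (uElt f) = ∑ α, D (MvPolynomial.X α) ⊗ₜ[ℂ] (f α : g) := by
  simp [uElt]

lemma bigProj_vectorElt (a : g) : bigProj b (vectorElt f a) = vectorElt f a :=
  bigProj_eq_self (psEval_mem f _ (bigProj_mem _))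

/-- The derivation sends u to `-vectorElt f a`, and the Bernoulli series in `vectorElt` cancels the
series in `logDer`. Only the projected term remains. -/
lemma logDer_vectorField (hf : ∀ α : PosRoot b, (f α : g) ∈ rootSpace H (-(α.form : H → ℂ)))
    (a : g) : logDer (uElt f) (tensorDer (vectorField f a)) =
      -bigProj b (expNegAd (uElt f) (1 ⊗ₜ[ℂ] a)) := by
  have hu := isNilpotent_ad_uElt f hf
  have h1 : tensorDer (vectorField f a) (uElt f) = -vectorElt f a := by
    rw [tensorDer_uElt, ← bigProj_vectorElt f, ← sum_coordForm_tmul f]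
    simp [vectorField, TensorProduct.neg_tmul]
  rw [logDer, h1, map_neg, vectorElt, ← End.mul_apply, psEval_neg _ hu, ← psEval_mul _ _ hu,
    mul_comm, bernoulli_mul_expQuot, psEval_one hu, End.one_apply]

/-- The Bernoulli series recovers the derivative of u from its logarithmic derivative, and the
coordinates of that derivative are the values on the variables. -/
lemma derivation_ext_of_logDer
    (hf : ∀ α : PosRoot b, (f α : g) ∈ rootSpace H (-(α.form : H → ℂ)))
    {D E : Derivation ℂ (MvPolynomial (PosRoot b) ℂ) (MvPolynomial (PosRoot b) ℂ)}
    (h : logDer (uElt f) (tensorDer D) = logDer (uElt f) (tensorDer E)) : D = E := by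
  classical
  have hu := isNilpotent_ad_uElt f hf
  have h1 : tensorDer D (uElt f) = tensorDer E (uElt f) := by
    have h2 := congrArg (fun y ↦ psEval (bernoulli'PowerSeries ℂ)
      (LieAlgebra.ad ℂ (MvPolynomial (PosRoot b) ℂ ⊗[ℂ] g) (uElt f)) y) h
    rwa [logDer, logDer, ← End.mul_apply, ← End.mul_apply, psEval_neg _ hu, ← psEval_mul _ _ hu,
      bernoulli_mul_expQuot, psEval_one hu, End.one_apply, End.one_apply] at h2
  apply MvPolynomial.derivation_ext
  intro α
  have h2 := congrArg (coordForm f α) h1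
  rw [tensorDer_uElt, tensorDer_uElt, map_sum, map_sum] at h2
  simpa [coordForm_tmul_self] using h2

lemma eq_zero_of_forall_lie_eq_zero (x : g) (h : ∀ z : g, ⁅x, z⁆ = 0) : x = 0 := by
  have : x ∈ LieAlgebra.center ℂ g := by
    rw [LieModule.mem_maxTrivSubmodule]
    intro z
    rw [← lie_skew, h, neg_zero]
  simpa using this

/-- Both parts come from `logDer_lie_of_projection`. The first uses that a derivation is determined
by its logarithmic derivative. The second applies μ to Cartan parts, which vanish on brackets within
n̄ and on brackets within h + n. -/
lemma vectorField_lie_and_potential_lie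
    (hf : ∀ α : PosRoot b, (f α : g) ∈ rootSpace H (-(α.form : H → ℂ))) (μ : Dual ℂ H) (a c : g) :
    vectorField f ⁅a, c⁆ = ⁅vectorField f a, vectorField f c⁆ ∧
      potential f μ ⁅a, c⁆ =
        vectorField f a (potential f μ c) - vectorField f c (potential f μ a) := by
  have hu := isNilpotent_ad_uElt f hf
  obtain ⟨h1, h2⟩ := logDer_lie_of_projection hu
    (ad_injective_of_center eq_zero_of_forall_lie_eq_zero) (bigProj b) bigProj_lie bigProj_lie_sub
    (y := 1 ⊗ₜ[ℂ] a) (z := 1 ⊗ₜ[ℂ] c) (tensorDer (vectorField f a)) (tensorDer (vectorField f c))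
    (tensorDer_baseChange _ _) (tensorDer_baseChange _ _) (by simp) (by simp)
    (logDer_vectorField f hf a) (logDer_vectorField f hf c)
  have h3 : ⁅(1 : MvPolynomial (PosRoot b) ℂ) ⊗ₜ[ℂ] a, (1 : MvPolynomial (PosRoot b) ℂ) ⊗ₜ[ℂ] c⁆ =
      1 ⊗ₜ[ℂ] ⁅a, c⁆ := by rw [LieAlgebra.ExtendScalars.bracket_tmul, one_mul]
  rw [h3] at h1 h2
  constructor
  · apply derivation_ext_of_logDer f hf
    rw [logDer_vectorField f hf, tensorDer_lie, h1]
  · have h4 := congrArg (extForm (MvPolynomial (PosRoot b) ℂ) (μ ∘ₗ cartanPart b)) h2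
    rw [map_sub, map_sub, map_sub, extForm_cartan_lie, extForm_cartan_lie_sub, sub_zero,
      extForm_tensorDer, extForm_tensorDer, sub_eq_zero] at h4
    exact h4.symm

/-- The Lie algebra homomorphism `a ↦ π_lam(a)`. -/
def diffOpHom (hf : ∀ α : PosRoot b, (f α : g) ∈ rootSpace H (-(α.form : H → ℂ)))
    (lam : Dual ℂ H) : g →ₗ⁅ℂ⁆ Weyl (PosRoot b) where
  toFun := diffOp f lam
  map_add' a c := by
    simp only [diffOp_eq f hf, weylOfDer, vectorField, MvPolynomial.mkDerivation_X, vectorElt_add,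
      potential, TensorProduct.tmul_add, map_add, neg_add, add_mul, Finset.sum_add_distrib]
    abel
  map_smul' t a := by
    have h (p : MvPolynomial (PosRoot b) ℂ ⊗[ℂ] g) (α : PosRoot b) :
        coordForm f α (t • p) = t • coordForm f α p := LinearMap.map_smul_of_tower _ _ _
    have h' (μ : Dual ℂ H) (p : MvPolynomial (PosRoot b) ℂ ⊗[ℂ] g) :
        extForm (MvPolynomial (PosRoot b) ℂ) (μ ∘ₗ cartanPart b) (t • p) =
          t • extForm (MvPolynomial (PosRoot b) ℂ) (μ ∘ₗ cartanPart b) p :=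
      LinearMap.map_smul_of_tower _ _ _
    simp only [diffOp_eq f hf, weylOfDer, vectorField, MvPolynomial.mkDerivation_X, vectorElt_smul,
      potential, TensorProduct.tmul_smul, map_smul, h, h', ← smul_neg, smul_mul_assoc,
      ← Finset.smul_sum, RingHom.id_apply, smul_add]
  map_lie' {a c} := by
    obtain ⟨h1, h2⟩ := vectorField_lie_and_potential_lie f hf (lam + rho b) a c
    simp only [diffOp_eq f hf]
    rw [firstOrder_lie, h1, h2]

end DiffOpHom

/-! ### Explicit operators -/

section PsEvalAux

variable {R : Type*} [Ring R] [Algebra ℂ R]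

lemma psEval_add (φ ψ : PowerSeries ℂ) (t : R) : psEval (φ + ψ) t = psEval φ t + psEval ψ t := by
  simp [psEval, add_smul, Finset.sum_add_distrib]

lemma psEval_X {t : R} (ht : IsNilpotent t) : psEval PowerSeries.X t = t := by
  obtain ⟨n, hn⟩ := ht
  have hn' : t ^ (n + 2) = 0 := by rw [pow_add, hn, zero_mul]
  rw [psEval_eq_aeval _ hn', PowerSeries.trunc_X, Polynomial.aeval_X]

/-- The value of a power series with constant coefficient `1`, up to a submodule stable under the
operator. -/
lemma psEval_apply_sub_mem {V : Type*} [AddCommGroup V] [Module ℂ V] {T : End ℂ V}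
    (hT : IsNilpotent T) {φ : PowerSeries ℂ} (hφ : PowerSeries.coeff 0 φ = 1) {v : V}
    {N : Submodule ℂ V} (hv : T v ∈ N) (hN : ∀ w ∈ N, T w ∈ N) : psEval φ T v - v ∈ N := by
  obtain ⟨n, hn⟩ := hT
  rw [psEval_eq_sum φ (n := n + 1) (by rw [pow_succ, hn, zero_mul]), LinearMap.sum_apply,
    Finset.sum_range_succ', LinearMap.smul_apply, hφ, pow_zero, one_smul, End.one_apply,
    add_sub_cancel_right]
  refine sum_mem fun i hi ↦ N.smul_mem _ ?_
  clear hi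
  induction i with
  | zero => simpa using hv
  | succ i ih => rw [pow_succ', End.mul_apply]; exact hN _ ih

end PsEvalAux

/-! ### Action of the Cartan subalgebra and of negative root vectors. -/

section Formulas

variable {g : Type*} [LieRing g] [LieAlgebra ℂ g] [FiniteDimensional ℂ g] [LieAlgebra.IsSimple ℂ g]
  {H : LieSubalgebra ℂ g} [H.IsCartanSubalgebra] {b : (rootSystem H).Base}
  (f : Basis (PosRoot b) ℂ (nilBar b))

lemma lie_uElt_cartan (hf : ∀ α : PosRoot b, (f α : g) ∈ rootSpace H (-(α.form : H → ℂ)))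
    (h : H) : ⁅uElt f, (1 : MvPolynomial (PosRoot b) ℂ) ⊗ₜ[ℂ] (h : g)⁆ =
      ∑ α : PosRoot b, (α.form h • MvPolynomial.X α) ⊗ₜ[ℂ] (f α : g) := by
  rw [lie_uElt_tmul]
  refine Finset.sum_congr rfl fun α _ ↦ ?_
  have h1 : ⁅h, (f α : g)⁆ = (-(α.form : H → ℂ)) h • (f α : g) :=
    lie_eq_smul_of_mem_rootSpace (hf α) h
  have h2 : ⁅(f α : g), (h : g)⁆ = α.form h • (f α : g) := by
    rw [← lie_skew, ← LieSubalgebra.coe_bracket_of_module, h1, Pi.neg_apply, neg_smul, neg_neg]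
  rw [h2, mul_one, TensorProduct.smul_tmul]

/-- Write e^t = 1 + t·`expQuot` at t = -ad u. Already [u, h] lies in n̄, so the correction to h does
as well, and the Bernoulli series undoes `expQuot`. Only the term linear in u survives. -/
lemma expNegAd_cartan (hf : ∀ α : PosRoot b, (f α : g) ∈ rootSpace H (-(α.form : H → ℂ)))
    (h : H) : ∃ w ∈ (nilBar b).baseChange (MvPolynomial (PosRoot b) ℂ),
      expNegAd (uElt f) ((1 : MvPolynomial (PosRoot b) ℂ) ⊗ₜ[ℂ] (h : g)) = 1 ⊗ₜ[ℂ] (h : g) + w ∧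
      psEval (bernoulli'PowerSeries ℂ)
        (LieAlgebra.ad ℂ (MvPolynomial (PosRoot b) ℂ ⊗[ℂ] g) (uElt f)) w =
      -⁅uElt f, (1 : MvPolynomial (PosRoot b) ℂ) ⊗ₜ[ℂ] (h : g)⁆ := by
  have hu := isNilpotent_ad_uElt f hf
  have hmem : -⁅uElt f, (1 : MvPolynomial (PosRoot b) ℂ) ⊗ₜ[ℂ] (h : g)⁆ ∈
      (nilBar b).baseChange (MvPolynomial (PosRoot b) ℂ) := by
    rw [lie_uElt_cartan f hf]
    exact neg_mem (sum_mem fun α _ ↦ Submodule.tmul_mem_baseChange_of_mem _ (f α).2)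
  refine ⟨psEval expQuot (-LieAlgebra.ad ℂ (MvPolynomial (PosRoot b) ℂ ⊗[ℂ] g) (uElt f))
    (-⁅uElt f, (1 : MvPolynomial (PosRoot b) ℂ) ⊗ₜ[ℂ] (h : g)⁆), ?_, ?_, ?_⟩
  · rw [psEval_neg _ hu]
    exact psEval_mem f _ hmem
  · have : PowerSeries.exp ℂ = 1 + expQuot * PowerSeries.X := by
      rw [mul_comm, X_mul_expQuot]; ring
    rw [expNegAd, this, psEval_add, psEval_mul _ _ hu.neg, psEval_one hu.neg, psEval_X hu.neg]
    rfl
  · rw [← End.mul_apply, psEval_neg _ hu, ← psEval_mul _ _ hu, bernoulli_mul_expQuot,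
      psEval_one hu, End.one_apply]

/-- A Cartan element acts through an Euler operator. -/
lemma diffOp_cartan (hf : ∀ α : PosRoot b, (f α : g) ∈ rootSpace H (-(α.form : H → ℂ)))
    (lam : Dual ℂ H) (h : H) : diffOp f lam (h : g) =
      ∑ α : PosRoot b, α.form h • (Weyl.x α * Weyl.d α) + algebraMap ℂ _ ((lam + rho b) h) := by
  classical
  obtain ⟨w, hw, h1, h2⟩ := expNegAd_cartan f hf h
  have h3 : vectorElt f (h : g) =
      -⁅uElt f, (1 : MvPolynomial (PosRoot b) ℂ) ⊗ₜ[ℂ] (h : g)⁆ := by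
    rw [vectorElt, h1, map_add, bigProj_eq_self hw, bigProj_tmul,
      nilBarProj_eq_zero (Submodule.mem_sup_left h.2), TensorProduct.tmul_zero, zero_add, h2]
  rw [diffOp_eq f hf]
  congr 1
  · refine Finset.sum_congr rfl fun α _ ↦ ?_
    rw [vectorField, MvPolynomial.mkDerivation_X, h3, map_neg (coordForm f α), neg_neg, lie_uElt_cartan f hf,
      map_sum]
    simp [coordForm_tmul_self, Weyl.ofPoly]
  · rw [potential, h1, map_add, extForm_cartan_of_mem _ hw, add_zero, extForm_tmul,
      LinearMap.comp_apply, cartanPart_coe, map_smul, map_one, Algebra.algebraMap_eq_smul_one]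

/-- On n̄ the projection is invisible because e^{-ad u} preserves n̄, so the two series combine into
t / (e^t - 1). -/
lemma vectorElt_nilBar (hf : ∀ α : PosRoot b, (f α : g) ∈ rootSpace H (-(α.form : H → ℂ)))
    {y : g} (hy : y ∈ nilBar b) : vectorElt f y =
      psEval (bernoulli'PowerSeries ℂ * PowerSeries.rescale (-1) (PowerSeries.exp ℂ))
        (LieAlgebra.ad ℂ (MvPolynomial (PosRoot b) ℂ ⊗[ℂ] g) (uElt f)) (1 ⊗ₜ[ℂ] y) := by
  have hu := isNilpotent_ad_uElt f hf
  have h1 : (1 : MvPolynomial (PosRoot b) ℂ) ⊗ₜ[ℂ] y ∈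
      (nilBar b).baseChange (MvPolynomial (PosRoot b) ℂ) :=
    Submodule.tmul_mem_baseChange_of_mem _ hy
  rw [psEval_mul _ _ hu, End.mul_apply, vectorElt, expNegAd, psEval_neg _ hu,
    bigProj_eq_self (psEval_mem f _ h1)]

lemma potential_nilBar (hf : ∀ α : PosRoot b, (f α : g) ∈ rootSpace H (-(α.form : H → ℂ)))
    (μ : Dual ℂ H) {y : g} (hy : y ∈ nilBar b) : potential f μ y = 0 := by
  have hu := isNilpotent_ad_uElt f hf
  rw [potential, expNegAd, psEval_neg _ hu]
  exact extForm_cartan_of_mem _ (psEval_mem f _ (Submodule.tmul_mem_baseChange_of_mem _ hy))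

lemma coeff_zero_bernoulli_mul_exp : PowerSeries.coeff 0
    (bernoulli'PowerSeries ℂ * PowerSeries.rescale (-1) (PowerSeries.exp ℂ)) = 1 := by
  simp [PowerSeries.coeff_mul, bernoulli'PowerSeries, PowerSeries.coeff_rescale]

/-- For a root vector of the opposite nilradical, the operator is `-∂_α` up to terms with
coefficients in any space of polynomials that contains the variables other than `x_θ` and is stable
under multiplication by them. -/
lemma exists_diffOp_negRoot (hf : ∀ α : PosRoot b, (f α : g) ∈ rootSpace H (-(α.form : H → ℂ)))
    {θ : PosRoot b} (hθ : IsMaximalRoot θ) (J : Submodule ℂ (MvPolynomial (PosRoot b) ℂ))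
    (hJ : ∀ γ, γ ≠ θ → MvPolynomial.X γ ∈ J)
    (hJ' : ∀ γ, γ ≠ θ → ∀ p ∈ J, MvPolynomial.X γ * p ∈ J) (lam : Dual ℂ H) (α : PosRoot b) :
    ∃ p : PosRoot b → MvPolynomial (PosRoot b) ℂ, (∀ β, p β ∈ J) ∧
      diffOp f lam (f α : g) = -Weyl.d α - ∑ β, Weyl.ofPoly (p β) * Weyl.d β := by
  classical
  have hu := isNilpotent_ad_uElt f hf
  -- Since f_θ commutes with n̄, the variable x_θ drops out of ad u on n̄. Every correction term
  -- then has coefficients in `J`, which is kept abstract so that it can later be `lowering θ`.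
  let N : Submodule ℂ (MvPolynomial (PosRoot b) ℂ ⊗[ℂ] g) :=
    Submodule.span ℂ {w | ∃ p ∈ J, ∃ y ∈ nilBar b, w = p ⊗ₜ[ℂ] y}
  have h1 : ∀ w ∈ N, LieAlgebra.ad ℂ (MvPolynomial (PosRoot b) ℂ ⊗[ℂ] g) (uElt f) w ∈ N := by
    intro w hw
    have : N ≤ N.comap (LieAlgebra.ad ℂ (MvPolynomial (PosRoot b) ℂ ⊗[ℂ] g) (uElt f)) := by
      refine Submodule.span_le.mpr ?_
      rintro _ ⟨p, hp, y, hy, rfl⟩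
      change ⁅uElt f, p ⊗ₜ[ℂ] y⁆ ∈ N
      rw [lie_uElt_tmul]
      refine sum_mem fun γ _ ↦ ?_
      by_cases hγ : γ = θ
      · rw [hγ, lie_eq_zero_of_isMaximalRoot hθ (hf θ) hy, TensorProduct.tmul_zero]
        exact zero_mem _
      · exact Submodule.subset_span ⟨_, hJ' γ hγ p hp, _, lie_mem_nilBar b (f γ).2 hy, rfl⟩
    exact this hw
  have h2 : LieAlgebra.ad ℂ (MvPolynomial (PosRoot b) ℂ ⊗[ℂ] g) (uElt f)
      (1 ⊗ₜ[ℂ] (f α : g)) ∈ N := by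
    change ⁅uElt f, (1 : MvPolynomial (PosRoot b) ℂ) ⊗ₜ[ℂ] (f α : g)⁆ ∈ N
    rw [lie_uElt_tmul]
    refine sum_mem fun γ _ ↦ ?_
    by_cases hγ : γ = θ
    · rw [hγ, lie_eq_zero_of_isMaximalRoot hθ (hf θ) (f α).2, TensorProduct.tmul_zero]
      exact zero_mem _
    · rw [mul_one]
      exact Submodule.subset_span ⟨_, hJ γ hγ, _, lie_mem_nilBar b (f γ).2 (f α).2, rfl⟩
  have h3 := psEval_apply_sub_mem hu coeff_zero_bernoulli_mul_exp h2 h1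
  rw [← vectorElt_nilBar f hf (f α).2] at h3
  refine ⟨fun β ↦ coordForm f β (vectorElt f (f α : g) - 1 ⊗ₜ[ℂ] (f α : g)), fun β ↦ ?_, ?_⟩
  · have : N ≤ J.comap ((coordForm f β).restrictScalars ℂ) := by
      refine Submodule.span_le.mpr ?_
      rintro _ ⟨p, hp, y, hy, rfl⟩
      change extForm _ _ _ ∈ J
      rw [extForm_tmul]
      exact J.smul_mem _ hp
    exact this h3
  · have h4 : Weyl.d α = ∑ β, Weyl.ofPoly (coordForm f β
        ((1 : MvPolynomial (PosRoot b) ℂ) ⊗ₜ[ℂ] (f α : g))) * Weyl.d β := by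
      simp [coordForm_tmul_self]
    rw [diffOp_eq f hf, potential_nilBar f hf _ (f α).2, map_zero, add_zero, weylOfDer, h4,
      ← Finset.sum_neg_distrib, ← Finset.sum_sub_distrib]
    refine Finset.sum_congr rfl fun β _ ↦ ?_
    beta_reduce
    rw [vectorField, MvPolynomial.mkDerivation_X, map_sub (coordForm f β), map_sub, map_neg]
    noncomm_ring

/-- The lowest root vector acts as `-∂_θ`. -/
lemma diffOp_maximalRoot (hf : ∀ α : PosRoot b, (f α : g) ∈ rootSpace H (-(α.form : H → ℂ)))
    {θ : PosRoot b} (hθ : IsMaximalRoot θ) (lam : Dual ℂ H) :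
    diffOp f lam (f θ : g) = -Weyl.d θ := by
  classical
  have hu := isNilpotent_ad_uElt f hf
  have h2 : LieAlgebra.ad ℂ (MvPolynomial (PosRoot b) ℂ ⊗[ℂ] g) (uElt f)
      (1 ⊗ₜ[ℂ] (f θ : g)) ∈ (⊥ : Submodule ℂ (MvPolynomial (PosRoot b) ℂ ⊗[ℂ] g)) := by
    rw [Submodule.mem_bot]
    change ⁅uElt f, (1 : MvPolynomial (PosRoot b) ℂ) ⊗ₜ[ℂ] (f θ : g)⁆ = 0
    rw [lie_uElt_tmul]
    refine Finset.sum_eq_zero fun γ _ ↦ ?_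
    rw [← lie_skew, lie_eq_zero_of_isMaximalRoot hθ (hf θ) (f γ).2, neg_zero,
      TensorProduct.tmul_zero]
  have h3 := psEval_apply_sub_mem hu coeff_zero_bernoulli_mul_exp h2
    (fun w hw ↦ by rw [(Submodule.mem_bot ℂ).mp hw, map_zero]; exact zero_mem _)
  rw [← vectorElt_nilBar f hf (f θ).2, Submodule.mem_bot, sub_eq_zero] at h3
  rw [diffOp_eq f hf, potential_nilBar f hf _ (f θ).2, map_zero, add_zero, weylOfDer]
  simp [vectorField, h3, coordForm_tmul_self]

end Formulas

/-! ### Weight spaces of commutative subalgebras of the enveloping algebra -/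

section Enveloping

lemma commute_lift {L B : Type*} [LieRing L] [LieAlgebra ℂ L] [Ring B] [Algebra ℂ B]
    (φ : L →ₗ⁅ℂ⁆ B) {z : B} (h : ∀ x, Commute z (φ x)) (y : UniversalEnvelopingAlgebra ℂ L) :
    Commute z (UniversalEnvelopingAlgebra.lift ℂ φ y) := by
  let Z : Subalgebra ℂ B := Subalgebra.centralizer ℂ {z}
  let ψ : L →ₗ⁅ℂ⁆ Z :=
    { toFun := fun x ↦ ⟨φ x, by
        rw [Subalgebra.mem_centralizer_iff]
        rintro _ rfl
        exact h x⟩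
      map_add' := fun x y ↦ Subtype.ext (by simp)
      map_smul' := fun c x ↦ Subtype.ext (by simp)
      map_lie' := fun {x y} ↦ Subtype.ext (by
        simp [LieRing.of_associative_ring_bracket]) }
  have h1 : UniversalEnvelopingAlgebra.lift ℂ φ =
      Z.val.comp (UniversalEnvelopingAlgebra.lift ℂ ψ) := by
    apply UniversalEnvelopingAlgebra.hom_ext
    ext x
    simp [ψ]
  have h2 := (UniversalEnvelopingAlgebra.lift ℂ ψ y).2
  rw [Subalgebra.mem_centralizer_iff] at h2
  rw [h1]
  exact h2 z rfl

lemma envelopingAction_ι (g M : Type*) [LieRing g] [LieAlgebra ℂ g] [AddCommGroup M] [Module ℂ M]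
    [LieRingModule g M] [LieModule ℂ g M] (x : g) (v : M) :
    envelopingAction g M (UniversalEnvelopingAlgebra.ι ℂ x) v = ⁅x, v⁆ := by
  simp [envelopingAction]

/-- The Casimir element `h² - 2h + 4ef` of an `sl₂`-triple. -/
def casimir {L : Type*} [LieRing L] [LieAlgebra ℂ L] (h e f : L) :
    UniversalEnvelopingAlgebra ℂ L :=
  UniversalEnvelopingAlgebra.ι ℂ h * UniversalEnvelopingAlgebra.ι ℂ h -
    (2 : ℂ) • UniversalEnvelopingAlgebra.ι ℂ h +
    (4 : ℂ) • (UniversalEnvelopingAlgebra.ι ℂ e * UniversalEnvelopingAlgebra.ι ℂ f)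

/-- Commutation with e, f and h is enough, as they span `L`. Placing f on the right makes the
element act by m² - 2m on a vector of h-weight m killed by f. -/
lemma casimir_mem_center {L : Type*} [LieRing L] [LieAlgebra ℂ L] {h e f : L}
    (t : IsSl2Triple h e f) (hL : ∀ x : L, ∃ c₁ c₂ c₃ : ℂ, x = c₁ • e + c₂ • f + c₃ • h) :
    casimir h e f ∈ Subalgebra.center ℂ (UniversalEnvelopingAlgebra ℂ L) := by
  have hef : ∀ x y : L, UniversalEnvelopingAlgebra.ι ℂ x * UniversalEnvelopingAlgebra.ι ℂ y =
      UniversalEnvelopingAlgebra.ι ℂ y * UniversalEnvelopingAlgebra.ι ℂ x +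
        UniversalEnvelopingAlgebra.ι ℂ ⁅x, y⁆ := fun x y ↦ by
    rw [LieHom.map_lie, LieRing.of_associative_ring_bracket]; abel
  have h1 := hef h e
  have h2 := hef h f
  have h3 := hef f e
  rw [t.lie_h_e_smul ℂ, map_smul] at h1
  rw [t.lie_lie_smul_f ℂ, map_neg, map_smul] at h2
  rw [← lie_skew, t.lie_e_f, map_neg] at h3
  have hh : Commute (casimir h e f) (UniversalEnvelopingAlgebra.ι ℂ h) := by
    rw [Commute, SemiconjBy, casimir]
    generalize UniversalEnvelopingAlgebra.ι ℂ h = h' at *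
    generalize UniversalEnvelopingAlgebra.ι ℂ e = e' at *
    generalize UniversalEnvelopingAlgebra.ι ℂ f = f' at *
    have h4 : h' * (e' * f') = e' * f' * h' := by
      rw [← mul_assoc, h1, add_mul, mul_assoc, h2]
      simp only [mul_add, mul_neg, mul_smul_comm, smul_mul_assoc, mul_assoc]
      abel
    simp only [sub_mul, mul_sub, add_mul, mul_add, mul_smul_comm, smul_mul_assoc, h4, mul_assoc]
  have he : Commute (casimir h e f) (UniversalEnvelopingAlgebra.ι ℂ e) := by
    rw [Commute, SemiconjBy, casimir]
    generalize UniversalEnvelopingAlgebra.ι ℂ h = h' at *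
    generalize UniversalEnvelopingAlgebra.ι ℂ e = e' at *
    generalize UniversalEnvelopingAlgebra.ι ℂ f = f' at *
    simp only [sub_mul, add_mul, smul_mul_assoc, mul_assoc, h1, h3, mul_add, mul_smul_comm,
      mul_neg, mul_sub]
    rw [← mul_assoc h' e' h', h1]
    simp only [add_mul, smul_mul_assoc, mul_assoc, smul_add]
    module
  have hf : Commute (casimir h e f) (UniversalEnvelopingAlgebra.ι ℂ f) := by
    rw [Commute, SemiconjBy, casimir]
    generalize UniversalEnvelopingAlgebra.ι ℂ h = h' at *
    generalize UniversalEnvelopingAlgebra.ι ℂ e = e' at *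
    generalize UniversalEnvelopingAlgebra.ι ℂ f = f' at *
    have h4 : f' * (e' * f') = e' * (f' * f') - (f' * h' - (2 : ℂ) • f') := by
      rw [← mul_assoc, h3, add_mul, neg_mul, h2, mul_assoc]
      abel
    simp only [sub_mul, add_mul, smul_mul_assoc, mul_assoc, h2, h4, mul_add, mul_smul_comm,
      mul_neg, mul_sub]
    rw [← mul_assoc h' f' h', h2]
    simp only [add_mul, neg_mul, smul_mul_assoc, mul_assoc]
    module
  rw [Subalgebra.mem_center_iff]
  intro y
  have key := commute_lift (UniversalEnvelopingAlgebra.ι ℂ (L := L)) (z := casimir h e f) (by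
    intro x
    obtain ⟨c₁, c₂, c₃, rfl⟩ := hL x
    rw [map_add, map_add, map_smul, map_smul, map_smul]
    exact ((he.smul_right _).add_right (hf.smul_right _)).add_right (hh.smul_right _)) y
  have hid : UniversalEnvelopingAlgebra.lift ℂ (UniversalEnvelopingAlgebra.ι ℂ (L := L)) =
      AlgHom.id ℂ _ := by
    apply UniversalEnvelopingAlgebra.hom_ext
    ext x
    simp
  rw [hid] at key
  exact key.symm

end Enveloping

/-! ### Generalised weight spaces and characters of a commutative subalgebra. -/

section GammaWeights

variable {g : Type*} [LieRing g] [LieAlgebra ℂ g] {M : Type*} [AddCommGroup M] [Module ℂ M]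
  [LieRingModule g M] [LieModule ℂ g M]

lemma gammaWeightSpace_le {Γ : Subalgebra ℂ (UniversalEnvelopingAlgebra ℂ g)} (χ : Γ →ₐ[ℂ] ℂ)
    (a : Γ) : gammaWeightSpace M Γ χ ≤ (envelopingAction g M a).maxGenEigenspace (χ a) := by
  rintro v ⟨k, hk⟩
  rw [Module.End.mem_maxGenEigenspace]
  refine ⟨k, ?_⟩
  rw [← Algebra.algebraMap_eq_smul_one]
  exact hk a

variable {Γ : Subalgebra ℂ (UniversalEnvelopingAlgebra ℂ g)}

lemma commute_envelopingAction (hΓ : ∀ y ∈ Γ, ∀ z ∈ Γ, y * z = z * y) (a c : Γ) :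
    Commute (envelopingAction g M a) (envelopingAction g M c) := by
  rw [Commute, SemiconjBy, ← map_mul, ← map_mul, hΓ a a.2 c c.2]

lemma iSupIndep_gammaWeightSpace (hΓ : ∀ y ∈ Γ, ∀ z ∈ Γ, y * z = z * y) :
    iSupIndep fun χ : Γ →ₐ[ℂ] ℂ ↦ gammaWeightSpace M Γ χ := by
  have h := Module.End.independent_iInf_maxGenEigenspace_of_forall_mapsTo
    (fun a : Γ ↦ envelopingAction g M a) fun a c φ ↦
      Module.End.mapsTo_maxGenEigenspace_of_comm (commute_envelopingAction hΓ c a) φ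
  have h' := h.comp (f := fun χ : Γ →ₐ[ℂ] ℂ ↦ (χ : Γ → ℂ)) DFunLike.coe_injective
  exact h'.mono fun χ ↦ le_iInf fun a ↦ gammaWeightSpace_le χ a

/-- A family of generalised eigenvalues of a commutative algebra with a common generalised
eigenvector is a character. -/
lemma exists_algHom_of_mem_maxGenEigenspace (hΓ : ∀ y ∈ Γ, ∀ z ∈ Γ, y * z = z * y) {χ : Γ → ℂ}
    {v : M} (hv : v ≠ 0) (h : ∀ a : Γ, v ∈ (envelopingAction g M a).maxGenEigenspace (χ a)) :
    ∃ χ' : Γ →ₐ[ℂ] ℂ, ∀ a, χ' a = χ a := by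
  have huniq (a : Γ) (c : ℂ) (hc : v ∈ (envelopingAction g M a).maxGenEigenspace c) :
      χ a = c := by
    by_contra hne
    exact hv (Submodule.disjoint_def.mp
      (Module.End.disjoint_genEigenspace (envelopingAction g M a) hne ⊤ ⊤) v (h a) hc)
  have hscal (c : ℂ) : χ (algebraMap ℂ Γ c) = c := by
    apply huniq
    rw [Module.End.mem_maxGenEigenspace]
    refine ⟨1, ?_⟩
    have : ((algebraMap ℂ Γ c : Γ) : UniversalEnvelopingAlgebra ℂ g) = algebraMap ℂ _ c := rfl
    rw [this, AlgHom.commutes, Algebra.algebraMap_eq_smul_one, sub_self, pow_one,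
      LinearMap.zero_apply]
  have hadd {A B : End ℂ M} {s t : ℂ} (hAB : Commute A B) (hA : v ∈ A.maxGenEigenspace s)
      (hB : v ∈ B.maxGenEigenspace t) : v ∈ (A + B).maxGenEigenspace (s + t) := by
    have := Module.End.genEigenspace_inf_le_add A B s t ⊤ ⊤ hAB ⟨hA, hB⟩
    simpa using this
  refine ⟨{ toFun := χ, map_one' := ?_, map_mul' := ?_, map_zero' := ?_, map_add' := ?_,
            commutes' := hscal }, fun a ↦ rfl⟩
  · simpa using hscal 1
  · intro a c
    apply huniq
    have hac := commute_envelopingAction (M := M) hΓ a c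
    set A := envelopingAction g M a
    set C := envelopingAction g M c
    -- Multiplicativity reduces to additivity: on `v` the first summand has generalised eigenvalue 0
    -- and the second χ(a)χ(c).
    have h1 : envelopingAction g M ((a * c : Γ) : UniversalEnvelopingAlgebra ℂ g) =
        (A - χ a • (1 : End ℂ M)) * C + χ a • C := by
      rw [Subalgebra.coe_mul, map_mul, sub_mul, smul_mul_assoc, one_mul, sub_add_cancel]
    have hcomm : Commute (A - χ a • (1 : End ℂ M)) C :=
      hac.sub_left ((Commute.one_left C).smul_left _)
    have h2 : v ∈ ((A - χ a • (1 : End ℂ M)) * C).maxGenEigenspace 0 := by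
      obtain ⟨k, hk⟩ := (Module.End.mem_maxGenEigenspace _ _ _).mp (h a)
      rw [Module.End.mem_maxGenEigenspace]
      refine ⟨k, ?_⟩
      rw [zero_smul, sub_zero, hcomm.mul_pow, (hcomm.pow_pow k k).eq, End.mul_apply, hk, map_zero]
    have h3 : v ∈ (χ a • C).maxGenEigenspace (χ a * χ c) := by
      obtain ⟨k, hk⟩ := (Module.End.mem_maxGenEigenspace _ _ _).mp (h c)
      rw [Module.End.mem_maxGenEigenspace]
      refine ⟨k, ?_⟩
      rw [mul_smul, ← smul_sub, smul_pow, LinearMap.smul_apply, hk, smul_zero]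
    rw [h1]
    have := hadd ((hcomm.mul_left (Commute.refl C)).smul_right (χ a)) h2 h3
    rwa [zero_add] at this
  · simpa using hscal 0
  · intro a c
    apply huniq
    rw [Subalgebra.coe_add, map_add]
    exact hadd (commute_envelopingAction hΓ a c) (h a) (h c)

/-- A finite-dimensional `Γ`-stable subspace lies in the sum of the `Γ`-weight spaces. -/
lemma le_iSup_gammaWeightSpace (hΓ : ∀ y ∈ Γ, ∀ z ∈ Γ, y * z = z * y) (N : Submodule ℂ M)
    [FiniteDimensional ℂ N] (hN : ∀ a : Γ, ∀ v ∈ N, envelopingAction g M a v ∈ N) :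
    N ≤ ⨆ χ : Γ →ₐ[ℂ] ℂ, gammaWeightSpace M Γ χ := by
  let T (a : Γ) : End ℂ N := (envelopingAction g M a).restrict (hN a)
  have hT (a : Γ) (c : ℂ) (k : ℕ) (v : N) : (((T a - c • (1 : End ℂ N)) ^ k) v : M) =
      ((envelopingAction g M a - c • (1 : End ℂ M)) ^ k) (v : M) := by
    induction k generalizing v with
    | zero => rfl
    | succ k ih => rw [pow_succ, pow_succ, End.mul_apply, End.mul_apply, ih]; rfl
  have h1 := Module.End.iSup_iInf_maxGenEigenspace_eq_top_of_iSup_maxGenEigenspace_eq_top_of_commute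
    T (fun a c _ ↦ LinearMap.ext fun v ↦ Subtype.ext
      (LinearMap.congr_fun (commute_envelopingAction (M := M) hΓ a c) (v : M)))
    (fun a ↦ Module.End.iSup_maxGenEigenspace_eq_top (T a))
  have h2 : (⊤ : Submodule ℂ N) ≤
      (⨆ χ : Γ →ₐ[ℂ] ℂ, gammaWeightSpace M Γ χ).comap N.subtype := by
    rw [← h1]
    refine iSup_le fun χ v hv ↦ ?_
    rw [Submodule.mem_comap, Submodule.subtype_apply]
    by_cases hv0 : v = 0
    · rw [hv0]; exact zero_mem _
    have hv' (a : Γ) : v ∈ (T a).maxGenEigenspace (χ a) := (Submodule.mem_iInf _).mp hv a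
    obtain ⟨χ', hχ'⟩ := exists_algHom_of_mem_maxGenEigenspace (M := M) hΓ (χ := χ) (v := v)
      (by simpa using hv0) (by
        intro a
        obtain ⟨k, hk⟩ := (Module.End.mem_maxGenEigenspace _ _ _).mp (hv' a)
        rw [Module.End.mem_maxGenEigenspace]
        exact ⟨k, by rw [← hT, hk]; rfl⟩)
    -- The definition asks for one exponent valid for all elements of Γ; the dimension of `N` is
    -- such a bound.
    refine le_iSup (fun χ : Γ →ₐ[ℂ] ℂ ↦ gammaWeightSpace M Γ χ) χ' ⟨finrank ℂ N, fun a ↦ ?_⟩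
    have h3 := hv' a
    rw [Module.End.maxGenEigenspace_eq_genEigenspace_finrank, Module.End.mem_genEigenspace_nat,
      LinearMap.mem_ker] at h3
    rw [hχ', Algebra.algebraMap_eq_smul_one, ← hT, h3]
    rfl
  intro v hv
  exact h2 (Submodule.mem_top (x := (⟨v, hv⟩ : N)))

end GammaWeights

/-! ### The subalgebra attached to a root -/

section GammaTheta

variable {g : Type*} [LieRing g] [LieAlgebra ℂ g] [FiniteDimensional ℂ g] [LieAlgebra.IsSimple ℂ g]
  {H : LieSubalgebra ℂ g} [H.IsCartanSubalgebra] {b : (rootSystem H).Base}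

/-- The map of enveloping algebras induced by the inclusion of `s_θ`. -/
def sl2Incl (θ : PosRoot b) : UniversalEnvelopingAlgebra ℂ (sl2SubalgebraOfRoot θ.isNonZero) →ₐ[ℂ]
    UniversalEnvelopingAlgebra ℂ g :=
  UniversalEnvelopingAlgebra.lift ℂ ((UniversalEnvelopingAlgebra.ι ℂ).comp
    (sl2SubalgebraOfRoot θ.isNonZero).incl)

@[simp] lemma sl2Incl_ι (θ : PosRoot b) (x : sl2SubalgebraOfRoot θ.isNonZero) :
    sl2Incl θ (UniversalEnvelopingAlgebra.ι ℂ x) = UniversalEnvelopingAlgebra.ι ℂ (x : g) := by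
  simp [sl2Incl]

lemma gammaTheta_eq (θ : PosRoot b) : gammaTheta θ = Algebra.adjoin ℂ
    (UniversalEnvelopingAlgebra.ι ℂ '' (H : Set g) ∪ sl2Incl θ '' (Subalgebra.center ℂ
      (UniversalEnvelopingAlgebra ℂ (sl2SubalgebraOfRoot θ.isNonZero)) : Set _)) := rfl

variable {θ : PosRoot b} {h₀ e₀ f₀ : g}

lemma exists_sl2Triple (θ : PosRoot b) : ∃ h₀ e₀ f₀ : g, IsSl2Triple h₀ e₀ f₀ ∧
    e₀ ∈ rootSpace H (θ.form : H → ℂ) ∧ f₀ ∈ rootSpace H (-(θ.form : H → ℂ)) :=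
  exists_isSl2Triple_of_weight_isNonZero θ.isNonZero

/-- The neutral element of the `sl₂`-triple, as an element of the Cartan subalgebra. -/
lemma exists_cartan_eq (t : IsSl2Triple h₀ e₀ f₀) (he : e₀ ∈ rootSpace H (θ.form : H → ℂ))
    (hf : f₀ ∈ rootSpace H (-(θ.form : H → ℂ))) : ∃ h : H, (h : g) = h₀ ∧ θ.form h = 2 :=
  ⟨coroot θ.1.1, (t.h_eq_coroot θ.isNonZero he hf).symm, root_apply_coroot θ.isNonZero⟩

lemma mem_sl2_iff (t : IsSl2Triple h₀ e₀ f₀) (he : e₀ ∈ rootSpace H (θ.form : H → ℂ))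
    (hf : f₀ ∈ rootSpace H (-(θ.form : H → ℂ))) {x : g} :
    x ∈ sl2SubalgebraOfRoot θ.isNonZero ↔ ∃ c₁ c₂ c₃ : ℂ, x = c₁ • e₀ + c₂ • f₀ + c₃ • h₀ := by
  rw [mem_sl2SubalgebraOfRoot_iff θ.isNonZero t he hf, t.lie_e_f]

lemma lie_cartan_of_mem {α : Dual ℂ H} {x : g} (hx : x ∈ rootSpace H (α : H → ℂ)) (h : H) :
    ⁅(h : g), x⁆ = α h • x := by
  rw [← LieSubalgebra.coe_bracket_of_module]
  exact lie_eq_smul_of_mem_rootSpace hx h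

/-- A Cartan element differs from a multiple of the neutral element by an element commuting with
`s_θ`. -/
lemma lie_cartan_sub (t : IsSl2Triple h₀ e₀ f₀) (he : e₀ ∈ rootSpace H (θ.form : H → ℂ))
    (hf : f₀ ∈ rootSpace H (-(θ.form : H → ℂ))) (h : H) {x : g}
    (hx : x ∈ sl2SubalgebraOfRoot θ.isNonZero) : ⁅(h : g) - (θ.form h / 2) • h₀, x⁆ = 0 := by
  obtain ⟨c₁, c₂, c₃, rfl⟩ := (mem_sl2_iff t he hf).mp hx
  obtain ⟨h', hh', -⟩ := exists_cartan_eq t he hf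
  have h1 : ⁅(h : g), h₀⁆ = 0 := by
    rw [← hh']
    simpa using congrArg Subtype.val (trivial_lie_zero H H h h')
  have h2 : ⁅(h : g), e₀⁆ = θ.form h • e₀ := lie_cartan_of_mem he h
  have h3 : ⁅(h : g), f₀⁆ = (-θ.form) h • f₀ := lie_cartan_of_mem (α := -θ.form) hf h
  simp only [sub_lie, lie_add, lie_smul, smul_lie, h1, h2, h3, t.lie_h_e_smul ℂ,
    t.lie_lie_smul_f ℂ, lie_self, smul_zero, LinearMap.neg_apply]
  module

/-- A Cartan element h is (θ(h)/2) h₀ plus an element commuting with s_θ. Both summands commute with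
the center of U(s_θ), the first because h₀ lies in s_θ. -/
theorem gammaTheta_mul_comm (θ : PosRoot b) :
    ∀ y ∈ gammaTheta θ, ∀ z ∈ gammaTheta θ, y * z = z * y := by
  obtain ⟨h₀, e₀, f₀, t, he, hf⟩ := exists_sl2Triple θ
  obtain ⟨h', hh', -⟩ := exists_cartan_eq t he hf
  have hι {x y : g} (hxy : ⁅x, y⁆ = 0) : Commute (UniversalEnvelopingAlgebra.ι ℂ x)
      (UniversalEnvelopingAlgebra.ι ℂ y) := by
    rw [commute_iff_lie_eq, ← LieHom.map_lie, hxy, map_zero]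
  have hHc : ∀ h : H, ∀ c ∈ Subalgebra.center ℂ
      (UniversalEnvelopingAlgebra ℂ (sl2SubalgebraOfRoot θ.isNonZero)),
      Commute (UniversalEnvelopingAlgebra.ι ℂ (h : g)) (sl2Incl θ c) := by
    intro h c hc
    have h1 : Commute (UniversalEnvelopingAlgebra.ι ℂ ((h : g) - (θ.form h / 2) • h₀))
        (sl2Incl θ c) := by
      apply commute_lift
      intro x
      exact hι (lie_cartan_sub t he hf h x.2)
    have h2 : Commute (UniversalEnvelopingAlgebra.ι ℂ h₀) (sl2Incl θ c) := by
      have hmem : h₀ ∈ sl2SubalgebraOfRoot θ.isNonZero :=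
        (mem_sl2_iff t he hf).mpr ⟨0, 0, 1, by simp⟩
      have h3 := Subalgebra.mem_center_iff.mp hc (UniversalEnvelopingAlgebra.ι ℂ ⟨h₀, hmem⟩)
      have h4 := congrArg (sl2Incl θ) h3
      rwa [map_mul, map_mul, sl2Incl_ι] at h4
    have h5 := h1.add_left (h2.smul_left (θ.form h / 2))
    rwa [map_sub, map_smul, sub_add_cancel] at h5
  have hs : ∀ y ∈ UniversalEnvelopingAlgebra.ι ℂ '' (H : Set g) ∪ sl2Incl θ '' (Subalgebra.center ℂ
      (UniversalEnvelopingAlgebra ℂ (sl2SubalgebraOfRoot θ.isNonZero)) : Set _),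
      ∀ z ∈ UniversalEnvelopingAlgebra.ι ℂ '' (H : Set g) ∪ sl2Incl θ '' (Subalgebra.center ℂ
      (UniversalEnvelopingAlgebra ℂ (sl2SubalgebraOfRoot θ.isNonZero)) : Set _), y * z = z * y := by
    rintro _ (⟨h, hh, rfl⟩ | ⟨c, hc, rfl⟩) _ (⟨k, hk, rfl⟩ | ⟨d, hd, rfl⟩)
    · refine hι ?_
      simpa using congrArg Subtype.val (trivial_lie_zero H H ⟨h, hh⟩ ⟨k, hk⟩)
    · exact hHc ⟨h, hh⟩ d hd
    · exact (hHc ⟨k, hk⟩ c hc).symm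
    · rw [← map_mul, ← map_mul, Subalgebra.mem_center_iff.mp hd c]
  have := Algebra.isMulCommutative_adjoin ℂ hs
  intro y hy z hz
  rw [gammaTheta_eq] at hy hz
  exact setLike_mul_comm hy hz

/-! ### Weight modules with locally nilpotent f₀ and their multiplicities. -/

variable {M : Type*} [AddCommGroup M] [Module ℂ M] [LieRingModule g M] [LieModule ℂ g M]

/-- The weight space of `M` as a vector space. -/
def wtSpace (H : LieSubalgebra ℂ g) [H.IsCartanSubalgebra] (M : Type*) [AddCommGroup M] [Module ℂ M]
    [LieRingModule g M] [LieModule ℂ g M] (μ : Dual ℂ H) : Submodule ℂ M :=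
  (LieModule.weightSpace M (μ : H → ℂ)).toSubmodule

lemma mem_wtSpace {μ : Dual ℂ H} {v : M} :
    v ∈ wtSpace H M μ ↔ ∀ h : H, ⁅(h : g), v⁆ = μ h • v := by
  rw [wtSpace, LieSubmodule.mem_toSubmodule, LieModule.mem_weightSpace]
  rfl

lemma wtSpace_le_genWeightSpace (μ : Dual ℂ H) :
    wtSpace H M μ ≤ (LieModule.genWeightSpace M (μ : H → ℂ)).toSubmodule :=
  LieModule.weightSpace_le_genWeightSpace M _

lemma iSupIndep_genWeightSpace_dual : iSupIndep fun μ : Dual ℂ H ↦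
    (LieModule.genWeightSpace M (μ : H → ℂ)).toSubmodule :=
  (LieSubmodule.iSupIndep_toSubmodule.mpr
    (LieModule.iSupIndep_genWeightSpace ℂ H M)).comp (f := fun μ : Dual ℂ H ↦ (μ : H → ℂ))
    DFunLike.coe_injective

/-- In a weight module generalised weight vectors are weight vectors. -/
lemma genWeightSpace_le_wtSpace (hM : ⨆ μ : Dual ℂ H, wtSpace H M μ = ⊤) (μ : Dual ℂ H) :
    (LieModule.genWeightSpace M (μ : H → ℂ)).toSubmodule ≤ wtSpace H M μ := by
  intro v hv
  have h1 : v ∈ wtSpace H M μ ⊔ ⨆ ν, ⨆ (_ : ν ≠ μ), wtSpace H M ν := by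
    have h2 : (⊤ : Submodule ℂ M) ≤ wtSpace H M μ ⊔ ⨆ ν, ⨆ (_ : ν ≠ μ), wtSpace H M ν := by
      rw [← hM]
      refine iSup_le fun ν ↦ ?_
      by_cases h : ν = μ
      · rw [h]; exact le_sup_left
      · exact le_sup_of_le_right (le_iSup₂_of_le ν h le_rfl)
    exact h2 Submodule.mem_top
  obtain ⟨x, hx, y, hy, rfl⟩ := Submodule.mem_sup.mp h1
  have h3 : y ∈ ⨆ ν, ⨆ (_ : ν ≠ μ), (LieModule.genWeightSpace M (ν : H → ℂ)).toSubmodule :=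
    (iSup₂_mono fun ν _ ↦ wtSpace_le_genWeightSpace ν) hy
  have h4 : y ∈ (LieModule.genWeightSpace M (μ : H → ℂ)).toSubmodule := by
    have := sub_mem hv (wtSpace_le_genWeightSpace μ hx)
    rwa [add_sub_cancel_left] at this
  have h5 : y = 0 := Submodule.disjoint_def.mp (iSupIndep_genWeightSpace_dual (M := M) μ) y h4 h3
  rw [h5, add_zero]
  exact hx

lemma lie_mem_wtSpace {μ α : Dual ℂ H} {x : g} (hx : x ∈ rootSpace H (α : H → ℂ)) {v : M}
    (hv : v ∈ wtSpace H M μ) : ⁅x, v⁆ ∈ wtSpace H M (μ + α) := by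
  rw [mem_wtSpace] at hv ⊢
  intro h
  rw [leibniz_lie, lie_cartan_of_mem hx, hv, smul_lie, lie_smul, ← add_smul, LinearMap.add_apply,
    add_comm]

/-- The part of a weight space killed by the `k`-th power of `f₀`. -/
def killedBy (H : LieSubalgebra ℂ g) [H.IsCartanSubalgebra] (M : Type*) [AddCommGroup M]
    [Module ℂ M] [LieRingModule g M] [LieModule ℂ g M] (f₀ : g) (μ : Dual ℂ H) (k : ℕ) :
    Submodule ℂ M :=
  wtSpace H M μ ⊓ LinearMap.ker (LieModule.toEnd ℂ g M f₀ ^ k)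

/-- Induction on `k`, for all weights at once: f₀ maps the space for μ and k + 1 into the one for μ
- θ and k, with kernel inside the case k = 1. -/
lemma finiteDimensional_killedBy (hf : f₀ ∈ rootSpace H (-(θ.form : H → ℂ)))
    (hfin : ∀ μ : Dual ℂ H, FiniteDimensional ℂ (killedBy H M f₀ μ 1)) (μ : Dual ℂ H) (k : ℕ) :
    FiniteDimensional ℂ (killedBy H M f₀ μ k) := by
  induction k generalizing μ with
  | zero =>
    have : killedBy H M f₀ μ 0 = ⊥ := by
      rw [eq_bot_iff]
      intro v hv
      simpa using hv.2
    rw [this]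
    infer_instance
  | succ k ih =>
    refine Module.Finite.iff_fg.mpr ?_
    refine Submodule.fg_of_fg_map_of_fg_inf_ker (LieModule.toEnd ℂ g M f₀) ?_ ?_
    · have h1 : (killedBy H M f₀ μ (k + 1)).map (LieModule.toEnd ℂ g M f₀) ≤
          killedBy H M f₀ (μ + -θ.form) k := by
        rintro _ ⟨v, hv, rfl⟩
        refine ⟨lie_mem_wtSpace (α := -θ.form) hf hv.1, ?_⟩
        rw [SetLike.mem_coe, LinearMap.mem_ker, ← End.mul_apply, ← pow_succ]
        exact hv.2
      have := ih (μ + -θ.form)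
      exact Module.Finite.iff_fg.mp (Submodule.finiteDimensional_of_le h1)
    · have h1 : killedBy H M f₀ μ (k + 1) ⊓ LinearMap.ker (LieModule.toEnd ℂ g M f₀) ≤
          killedBy H M f₀ μ 1 := by
        intro v hv
        exact ⟨hv.1.1, by simpa using hv.2⟩
      have := hfin μ
      exact Module.Finite.iff_fg.mp (Submodule.finiteDimensional_of_le h1)

lemma ι_mem_gammaTheta (h : H) : UniversalEnvelopingAlgebra.ι ℂ (h : g) ∈ gammaTheta θ :=
  Algebra.subset_adjoin (Or.inl ⟨h, h.2, rfl⟩)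

lemma sl2Incl_mem_gammaTheta {c : UniversalEnvelopingAlgebra ℂ (sl2SubalgebraOfRoot θ.isNonZero)}
    (hc : c ∈ Subalgebra.center ℂ _) : sl2Incl θ c ∈ gammaTheta θ :=
  Algebra.subset_adjoin (Or.inr ⟨c, hc, rfl⟩)

lemma commute_sl2Incl (t : IsSl2Triple h₀ e₀ f₀) (he : e₀ ∈ rootSpace H (θ.form : H → ℂ))
    (hf : f₀ ∈ rootSpace H (-(θ.form : H → ℂ)))
    {c : UniversalEnvelopingAlgebra ℂ (sl2SubalgebraOfRoot θ.isNonZero)}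
    (hc : c ∈ Subalgebra.center ℂ _) :
    Commute (envelopingAction g M (sl2Incl θ c)) (LieModule.toEnd ℂ g M f₀) := by
  have hmem : f₀ ∈ sl2SubalgebraOfRoot θ.isNonZero :=
    (mem_sl2_iff t he hf).mpr ⟨0, 1, 0, by simp⟩
  have h3 := Subalgebra.mem_center_iff.mp hc (UniversalEnvelopingAlgebra.ι ℂ ⟨f₀, hmem⟩)
  have h4 := congrArg (fun y ↦ envelopingAction g M (sl2Incl θ y)) h3
  simp only [map_mul, sl2Incl_ι] at h4
  have h5 : envelopingAction g M (UniversalEnvelopingAlgebra.ι ℂ f₀) =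
      LieModule.toEnd ℂ g M f₀ := LinearMap.ext fun v ↦ envelopingAction_ι g M f₀ v
  rw [h5] at h4
  exact h4.symm

/-- On generators: `H` acts by scalars, and the center of U(s_θ) commutes with both `H` and f₀. -/
lemma envelopingAction_mem_killedBy (t : IsSl2Triple h₀ e₀ f₀)
    (he : e₀ ∈ rootSpace H (θ.form : H → ℂ)) (hf : f₀ ∈ rootSpace H (-(θ.form : H → ℂ)))
    (μ : Dual ℂ H) (k : ℕ) (a : gammaTheta θ) :
    ∀ v ∈ killedBy H M f₀ μ k, envelopingAction g M a v ∈ killedBy H M f₀ μ k := by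
  obtain ⟨a, ha⟩ := a
  change ∀ v ∈ killedBy H M f₀ μ k, envelopingAction g M a v ∈ killedBy H M f₀ μ k
  rw [gammaTheta_eq] at ha
  induction ha using Algebra.adjoin_induction with
  | mem a h =>
    rcases h with ⟨h, hh, rfl⟩ | ⟨c, hc, rfl⟩
    · intro v hv
      have h1 := (mem_wtSpace.mp hv.1) ⟨h, hh⟩
      rw [envelopingAction_ι, h1]
      exact Submodule.smul_mem _ _ hv
    · intro v hv
      refine ⟨?_, ?_⟩
      · rw [SetLike.mem_coe, mem_wtSpace]
        intro h
        have h1 := gammaTheta_mul_comm θ _ (sl2Incl_mem_gammaTheta hc) _ (ι_mem_gammaTheta h)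
        have h2 := LinearMap.congr_fun (congrArg (envelopingAction g M) h1) v
        rw [map_mul, map_mul, End.mul_apply, End.mul_apply, envelopingAction_ι, envelopingAction_ι,
          mem_wtSpace.mp hv.1, map_smul] at h2
        exact h2.symm
      · have h1 := (commute_sl2Incl (M := M) t he hf hc).pow_right k
        rw [SetLike.mem_coe, LinearMap.mem_ker, ← End.mul_apply, ← h1.eq, End.mul_apply, LinearMap.mem_ker.mp hv.2,
          map_zero]
  | algebraMap r =>
    intro v hv
    rw [AlgHom.commutes, Module.algebraMap_end_apply]
    exact Submodule.smul_mem _ _ hv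
  | add x y _ _ hx hy =>
    intro v hv
    rw [map_add, LinearMap.add_apply]
    exact add_mem (hx v hv) (hy v hv)
  | mul x y _ _ hx hy =>
    intro v hv
    rw [map_mul, End.mul_apply]
    exact hx _ (hy v hv)

/-- Decomposition into `Γ_θ`-weight spaces. -/
theorem isGammaWeightModule_of_locallyNilpotent (t : IsSl2Triple h₀ e₀ f₀)
    (he : e₀ ∈ rootSpace H (θ.form : H → ℂ)) (hf : f₀ ∈ rootSpace H (-(θ.form : H → ℂ)))
    (hM : ⨆ μ : Dual ℂ H, wtSpace H M μ = ⊤)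
    (hnil : ∀ v : M, ∃ n : ℕ, (LieModule.toEnd ℂ g M f₀ ^ n) v = 0)
    (hfin : ∀ μ : Dual ℂ H, FiniteDimensional ℂ (killedBy H M f₀ μ 1)) :
    IsGammaWeightModule M (gammaTheta θ) := by
  classical
  have key : DirectSum.IsInternal fun χ : gammaTheta θ →ₐ[ℂ] ℂ ↦
      gammaWeightSpace M (gammaTheta θ) χ := by
    rw [DirectSum.isInternal_submodule_iff_iSupIndep_and_iSup_eq_top]
    refine ⟨iSupIndep_gammaWeightSpace (gammaTheta_mul_comm θ), ?_⟩
    rw [eq_top_iff, ← hM]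
    refine iSup_le fun μ v hv ↦ ?_
    obtain ⟨n, hn⟩ := hnil v
    have := finiteDimensional_killedBy hf hfin μ n
    exact le_iSup_gammaWeightSpace (gammaTheta_mul_comm θ) (killedBy H M f₀ μ n)
      (envelopingAction_mem_killedBy t he hf μ n) ⟨hv, hn⟩
  unfold IsGammaWeightModule
  convert key

/-- A quadratic in k takes the value c at most twice: two distinct solutions k and l satisfy k + l =
m - 1, so a third is impossible. -/
lemma exists_forall_ge_ne (m c : ℂ) :
    ∃ K : ℕ, ∀ k : ℕ, K ≤ k → (m - 2 * k) * (m - 2 * k) - 2 * (m - 2 * k) ≠ c := by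
  by_contra! hcon
  obtain ⟨k₁, -, h₁⟩ := hcon 0
  obtain ⟨k₂, h12, h₂⟩ := hcon (k₁ + 1)
  obtain ⟨k₃, h23, h₃⟩ := hcon (k₂ + 1)
  have aux {k l : ℕ} (hkl : k < l) (hk : (m - 2 * k) * (m - 2 * k) - 2 * (m - 2 * k) = c)
      (hl : (m - 2 * l) * (m - 2 * l) - 2 * (m - 2 * l) = c) : (k : ℂ) + l = m - 1 := by
    have h : ((l : ℂ) - k) * (k + l - (m - 1)) = 0 := by linear_combination (hl - hk) / 4
    rcases mul_eq_zero.mp h with h | h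
    · have : l = k := by exact_mod_cast sub_eq_zero.mp h
      omega
    · exact sub_eq_zero.mp h
  have e1 := aux (show k₁ < k₂ by omega) h₁ h₂
  have e2 := aux (show k₁ < k₃ by omega) h₁ h₃
  have : (k₂ : ℂ) = k₃ := by linear_combination e1 - e2
  have : k₂ = k₃ := by exact_mod_cast this
  omega

/-- Finiteness of the multiplicities. -/
theorem hasFiniteGammaMultiplicities_of_locallyNilpotent (t : IsSl2Triple h₀ e₀ f₀)
    (he : e₀ ∈ rootSpace H (θ.form : H → ℂ)) (hf : f₀ ∈ rootSpace H (-(θ.form : H → ℂ)))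
    (hM : ⨆ μ : Dual ℂ H, wtSpace H M μ = ⊤)
    (hnil : ∀ v : M, ∃ n : ℕ, (LieModule.toEnd ℂ g M f₀ ^ n) v = 0)
    (hfin : ∀ μ : Dual ℂ H, FiniteDimensional ℂ (killedBy H M f₀ μ 1)) :
    HasFiniteGammaMultiplicities M (gammaTheta θ) := by
  intro χ
  obtain ⟨h', hh', hθh'⟩ := exists_cartan_eq t he hf
  let μ : Dual ℂ H :=
    { toFun := fun h ↦ χ ⟨_, ι_mem_gammaTheta h⟩
      map_add' := fun x y ↦ by
        rw [← map_add]; congr 1; ext; simp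
      map_smul' := fun c x ↦ by
        rw [RingHom.id_apply, ← map_smul]; congr 1; ext; simp }
  have hmem : ∀ {x : g} (c₁ c₂ c₃ : ℂ), x = c₁ • e₀ + c₂ • f₀ + c₃ • h₀ →
      x ∈ sl2SubalgebraOfRoot θ.isNonZero := fun c₁ c₂ c₃ h ↦
    (mem_sl2_iff t he hf).mpr ⟨c₁, c₂, c₃, h⟩
  let hs : sl2SubalgebraOfRoot θ.isNonZero := ⟨h₀, hmem 0 0 1 (by simp)⟩
  let es : sl2SubalgebraOfRoot θ.isNonZero := ⟨e₀, hmem 1 0 0 (by simp)⟩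
  let fs : sl2SubalgebraOfRoot θ.isNonZero := ⟨f₀, hmem 0 1 0 (by simp)⟩
  have ts : IsSl2Triple hs es fs :=
    { h_ne_zero := fun h ↦ t.h_ne_zero (congrArg Subtype.val h)
      lie_e_f := Subtype.ext t.lie_e_f
      lie_h_e_nsmul := Subtype.ext t.lie_h_e_nsmul
      lie_h_f_nsmul := Subtype.ext t.lie_h_f_nsmul }
  have hcas := casimir_mem_center ts fun x ↦ by
    obtain ⟨c₁, c₂, c₃, h⟩ := (mem_sl2_iff t he hf).mp x.2
    exact ⟨c₁, c₂, c₃, Subtype.ext h⟩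
  let C : gammaTheta θ := ⟨sl2Incl θ (casimir hs es fs), sl2Incl_mem_gammaTheta hcas⟩
  have hC (v : M) : envelopingAction g M C v = ⁅h₀, ⁅h₀, v⁆⁆ - (2 : ℂ) • ⁅h₀, v⁆ +
      (4 : ℂ) • ⁅e₀, ⁅f₀, v⁆⁆ := by
    simp only [C, casimir, map_add, map_sub, map_mul, map_smul, sl2Incl_ι, LinearMap.add_apply,
      LinearMap.sub_apply, LinearMap.smul_apply, End.mul_apply, envelopingAction_ι, hs, es, fs]
  -- From `K` on, χ(C) is not the Casimir eigenvalue of a vector killed by f₀ of h₀-weight μ(h') -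
  -- 2k.
  obtain ⟨K, hK⟩ := exists_forall_ge_ne (μ h') (χ C)
  have hle : gammaWeightSpace M (gammaTheta θ) χ ≤ killedBy H M f₀ μ K := by
    intro v hv
    have hvμ : v ∈ wtSpace H M μ := by
      apply genWeightSpace_le_wtSpace hM
      rw [LieSubmodule.mem_toSubmodule, LieModule.mem_genWeightSpace]
      intro h
      obtain ⟨k, hk⟩ := hv
      refine ⟨k, ?_⟩
      have h1 := hk ⟨_, ι_mem_gammaTheta h⟩
      have h2 : envelopingAction g M (UniversalEnvelopingAlgebra.ι ℂ (h : g)) =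
          LieModule.toEnd ℂ H M h := LinearMap.ext fun v ↦ envelopingAction_ι g M h v
      rw [h2, Algebra.algebraMap_eq_smul_one] at h1
      exact h1
    refine ⟨hvμ, ?_⟩
    rw [SetLike.mem_coe, LinearMap.mem_ker]
    by_contra hne
    classical
    have hex := hnil v
    set n := Nat.find hex with hn
    have hn0 : (LieModule.toEnd ℂ g M f₀ ^ n) v = 0 := Nat.find_spec hex
    have hKn : K < n := by
      by_contra hcon
      refine hne ?_
      rw [← Nat.sub_add_cancel (not_lt.mp hcon), pow_add, End.mul_apply, hn0, map_zero]
    -- Here f₀^k v is the last nonzero vector of the string. It is a Casimir eigenvector and, as C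
    -- commutes with f₀, also a generalised eigenvector for χ(C), so the two eigenvalues agree.
    obtain ⟨k, hk⟩ : ∃ k, n = k + 1 := ⟨n - 1, by omega⟩
    have hk0 : (LieModule.toEnd ℂ g M f₀ ^ k) v ≠ 0 := Nat.find_min hex (by omega)
    have hfk : ⁅f₀, (LieModule.toEnd ℂ g M f₀ ^ k) v⁆ = 0 := by
      rw [hk, pow_succ', End.mul_apply] at hn0
      exact hn0
    have hwt (j : ℕ) : ⁅h₀, (LieModule.toEnd ℂ g M f₀ ^ j) v⁆ =
        (μ h' - 2 * j) • (LieModule.toEnd ℂ g M f₀ ^ j) v := by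
      induction j with
      | zero => simpa [hh'] using (mem_wtSpace.mp hvμ) h'
      | succ j ih =>
        rw [pow_succ', End.mul_apply, LieModule.toEnd_apply_apply, leibniz_lie, ih,
          t.lie_lie_smul_f ℂ, lie_smul, neg_lie, smul_lie]
        push_cast
        module
    refine hK k (by omega) ?_
    have hCk := hC ((LieModule.toEnd ℂ g M f₀ ^ k) v)
    rw [hfk, hwt, lie_smul, hwt, lie_zero, smul_zero, add_zero, smul_smul, smul_smul,
      ← sub_smul] at hCk
    obtain ⟨l, hl⟩ := (Module.End.mem_maxGenEigenspace _ _ _).mp (gammaWeightSpace_le χ C hv)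
    have hcomm : Commute (envelopingAction g M C) (LieModule.toEnd ℂ g M f₀) :=
      commute_sl2Incl t he hf hcas
    have h1 : (LieModule.toEnd ℂ g M f₀ ^ k) v ∈
        (envelopingAction g M C).maxGenEigenspace (χ C) := by
      rw [Module.End.mem_maxGenEigenspace]
      refine ⟨l, ?_⟩
      have h2 : Commute ((envelopingAction g M C - χ C • (1 : End ℂ M)) ^ l)
          (LieModule.toEnd ℂ g M f₀ ^ k) :=
        (hcomm.sub_left ((Commute.one_left _).smul_left _)).pow_pow l k
      rw [← End.mul_apply, h2.eq, End.mul_apply, hl, map_zero]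
    by_contra hne'
    refine hk0 (Submodule.disjoint_def.mp
      (Module.End.disjoint_genEigenspace (envelopingAction g M C) hne' 1 ⊤) _ ?_ h1)
    exact Module.End.mem_eigenspace_iff.mpr hCk
  have := finiteDimensional_killedBy hf hfin μ K
  exact Submodule.finiteDimensional_of_le hle

end GammaTheta

/-! ### Degrees of polynomials -/

section Degree

variable {σ : Type*}

lemma coeff_X_mul_pderiv (i : σ) (k : σ →₀ ℕ) (p : MvPolynomial σ ℂ) :
    MvPolynomial.coeff k (MvPolynomial.X i * MvPolynomial.pderiv i p) =
      k i * MvPolynomial.coeff k p := by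
  classical
  rw [MvPolynomial.coeff_X_mul', MvPolynomial.coeff_pderiv]
  split_ifs with h
  · have h1 : Finsupp.single i 1 ≤ k := by
      rw [Finsupp.single_le_iff, Nat.one_le_iff_ne_zero]
      exact Finsupp.mem_support_iff.mp h
    have h2 : (k - Finsupp.single i 1 : σ →₀ ℕ) i + 1 = k i := by
      have := Finsupp.single_le_iff.mp h1
      simp only [Finsupp.coe_tsub, Pi.sub_apply, Finsupp.single_eq_same]
      omega
    rw [tsub_add_cancel_of_le h1, ← h2]
    push_cast
    ring
  · rw [Finsupp.notMem_support_iff.mp h, Nat.cast_zero, zero_mul]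

lemma coeff_pderiv_X_mul (i : σ) (k : σ →₀ ℕ) (p : MvPolynomial σ ℂ) :
    MvPolynomial.coeff k (MvPolynomial.pderiv i (MvPolynomial.X i * p)) =
      (k i + 1) * MvPolynomial.coeff k p := by
  rw [MvPolynomial.coeff_pderiv, add_comm k, MvPolynomial.coeff_X_mul, mul_comm]

/-- The degree of a monomial in the variables other than `θ`. -/
def degOff (θ : σ) (k : σ →₀ ℕ) : ℕ := (k.erase θ).degree

lemma degOff_add_single_of_ne {θ i : σ} (h : i ≠ θ) (k : σ →₀ ℕ) :
    degOff θ (k + Finsupp.single i 1) = degOff θ k + 1 := by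
  rw [degOff, degOff, Finsupp.erase_add, Finsupp.erase_single_ne h.symm, map_add,
    Finsupp.degree_single]

lemma degOff_add_single_self (θ : σ) (k : σ →₀ ℕ) :
    degOff θ (k + Finsupp.single θ 1) = degOff θ k := by
  simp [degOff, Finsupp.erase_add]

/-- The polynomials of degree less than `d` in the variables other than `θ`. -/
def degOffLT (θ : σ) (d : ℕ) : Submodule ℂ (MvPolynomial σ ℂ) where
  carrier := {p | ∀ k, d ≤ degOff θ k → MvPolynomial.coeff k p = 0}
  zero_mem' := by simp
  add_mem' := fun hp hq k hk ↦ by rw [MvPolynomial.coeff_add, hp k hk, hq k hk, add_zero]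
  smul_mem' := fun c p hp k hk ↦ by rw [MvPolynomial.coeff_smul, hp k hk, smul_zero]

lemma degOffLT_mono (θ : σ) {d e : ℕ} (h : d ≤ e) : degOffLT θ d ≤ degOffLT θ e :=
  fun _ hp k hk ↦ hp k (h.trans hk)

lemma pderiv_mem_degOffLT_of_ne {θ i : σ} (h : i ≠ θ) {d : ℕ} {p : MvPolynomial σ ℂ}
    (hp : p ∈ degOffLT θ (d + 1)) : MvPolynomial.pderiv i p ∈ degOffLT θ d := by
  intro k hk
  rw [MvPolynomial.coeff_pderiv, hp _ (by rw [degOff_add_single_of_ne h]; omega), zero_mul]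

lemma pderiv_mem_degOffLT {θ i : σ} {d : ℕ} {p : MvPolynomial σ ℂ}
    (hp : p ∈ degOffLT θ d) : MvPolynomial.pderiv i p ∈ degOffLT θ d := by
  by_cases h : i = θ
  · subst h
    intro k hk
    rw [MvPolynomial.coeff_pderiv, hp _ (by rwa [degOff_add_single_self]), zero_mul]
  · exact pderiv_mem_degOffLT_of_ne h (degOffLT_mono θ (Nat.le_succ d) hp)

lemma X_mul_mem_degOffLT {θ i : σ} (h : i ≠ θ) {d : ℕ} {p : MvPolynomial σ ℂ}
    (hp : p ∈ degOffLT θ d) : MvPolynomial.X i * p ∈ degOffLT θ (d + 1) := by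
  classical
  intro k hk
  rw [MvPolynomial.coeff_X_mul']
  split_ifs with hi
  · have h1 : Finsupp.single i 1 ≤ k := by
      rw [Finsupp.single_le_iff, Nat.one_le_iff_ne_zero]
      exact Finsupp.mem_support_iff.mp hi
    apply hp
    rw [← tsub_add_cancel_of_le h1, degOff_add_single_of_ne h] at hk
    omega
  · rfl

/-- The polynomials whose operators lower the degree in the variables other than `θ`. -/
def lowering (θ : σ) : Submodule ℂ (MvPolynomial σ ℂ) where
  carrier := {p | ∀ d, ∀ q ∈ degOffLT θ (d + 1), gtRep θ (Weyl.ofPoly p) q ∈ degOffLT θ d}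
  zero_mem' := fun d q _ ↦ by simp
  add_mem' := fun hp hq d r hr ↦ by
    rw [map_add, map_add, LinearMap.add_apply]
    exact add_mem (hp d r hr) (hq d r hr)
  smul_mem' := fun c p hp d r hr ↦ by
    rw [map_smul, map_smul, LinearMap.smul_apply]
    exact Submodule.smul_mem _ _ (hp d r hr)

lemma ofPoly_X (i : σ) : Weyl.ofPoly (MvPolynomial.X i : MvPolynomial σ ℂ) = Weyl.x i := by
  simp [Weyl.ofPoly]

lemma X_mem_lowering {θ i : σ} (h : i ≠ θ) : MvPolynomial.X i ∈ lowering θ := by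
  intro d q hq
  rw [ofPoly_X, gtRep_x_of_ne h, LinearMap.neg_apply, pd_apply]
  exact neg_mem (pderiv_mem_degOffLT_of_ne h hq)

/-- The extra factor acts as one more derivative, which never raises the degree. With
`X_mem_lowering` this lets `lowering θ` serve as `J` in `exists_diffOp_negRoot`. -/
lemma X_mul_mem_lowering {θ i : σ} (h : i ≠ θ) {p : MvPolynomial σ ℂ} (hp : p ∈ lowering θ) :
    MvPolynomial.X i * p ∈ lowering θ := by
  intro d q hq
  rw [map_mul, map_mul, ofPoly_X, gtRep_x_of_ne h, End.mul_apply, LinearMap.neg_apply, pd_apply]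
  exact neg_mem (pderiv_mem_degOffLT (hp d q hq))

end Degree

/-! ### The modules `W(lam)` -/

section Main

variable {g : Type*} [LieRing g] [LieAlgebra ℂ g] {σ : Type*}

/-- The identification of `GTModule θ Φ` with the polynomials. -/
def gtEquiv (θ : σ) (Φ : g →ₗ⁅ℂ⁆ Weyl σ) : MvPolynomial σ ℂ ≃ₗ[ℂ] GTModule θ Φ :=
  LinearEquiv.ofBijective (gtPolyMap θ) (gtPolyMap_bijective θ)

lemma lie_gtEquiv (θ : σ) (Φ : g →ₗ⁅ℂ⁆ Weyl σ) (a : g) (p : MvPolynomial σ ℂ) :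
    ⁅a, gtEquiv θ Φ p⁆ = gtEquiv θ Φ (gtRep θ (Φ a) p) :=
  smul_gtPolyMap θ (Φ a) p

variable [FiniteDimensional ℂ g] [LieAlgebra.IsSimple ℂ g]
  {H : LieSubalgebra ℂ g} [H.IsCartanSubalgebra] {b : (rootSystem H).Base}

open Classical in
/-- The weight of a monomial. -/
def monomialWt (θ : PosRoot b) (lam : Dual ℂ H) (k : PosRoot b →₀ ℕ) : Dual ℂ H :=
  lam + rho b + ∑ α : PosRoot b, (if α = θ then (k α : ℂ) else -(k α + 1)) • α.form

lemma monomialWt_add_single (θ : PosRoot b) (lam : Dual ℂ H) (k : PosRoot b →₀ ℕ) :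
    monomialWt θ lam (k + Finsupp.single θ 1) = monomialWt θ lam k + θ.form := by
  classical
  have h : ∀ α : PosRoot b, (if α = θ then ((k + Finsupp.single θ 1 : PosRoot b →₀ ℕ) α : ℂ) else
      -(((k + Finsupp.single θ 1 : PosRoot b →₀ ℕ) α : ℂ) + 1)) • α.form =
      (if α = θ then (k α : ℂ) else -(k α + 1)) • α.form + if α = θ then α.form else 0 := by
    intro α
    split_ifs with hα
    · subst hα
      simp [add_smul]
    · simp [Ne.symm hα]
  simp only [monomialWt, h, Finset.sum_add_distrib, Finset.sum_ite_eq', Finset.mem_univ, if_true,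
    add_assoc]

-- Evaluation at `heightElt b` turns equality of weights into equality of integers; subtracting the
-- weight of 1 removes the constants.
open Classical in
lemma sum_height_eq {θ : PosRoot b} {lam : Dual ℂ H} {k l : PosRoot b →₀ ℕ}
    (h : monomialWt θ lam k = monomialWt θ lam l) :
    ∑ α : PosRoot b, (if α = θ then (k α : ℤ) else -(k α : ℤ)) * b.height α.1 =
      ∑ α : PosRoot b, (if α = θ then (l α : ℤ) else -(l α : ℤ)) * b.height α.1 := by
  have key (m : PosRoot b →₀ ℕ) :
      (((∑ α : PosRoot b, (if α = θ then (m α : ℤ) else -(m α : ℤ)) * b.height α.1 : ℤ)) : ℂ) =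
        monomialWt θ lam m (heightElt b) - monomialWt θ lam 0 (heightElt b) := by
    simp only [monomialWt, LinearMap.add_apply, LinearMap.sum_apply, LinearMap.smul_apply,
      PosRoot.form_heightElt, smul_eq_mul, add_sub_add_left_eq_sub, ← Finset.sum_sub_distrib]
    push_cast
    refine Finset.sum_congr rfl fun α _ ↦ ?_
    split_ifs
    · simp
    · simp only [Pi.zero_apply, Nat.cast_zero]
      ring
  have h1 := key k
  rw [h, ← key l] at h1
  exact_mod_cast h1

lemma sum_height_eq_of_apply_eq_zero {θ : PosRoot b} {lam : Dual ℂ H} {k l : PosRoot b →₀ ℕ}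
    (h : monomialWt θ lam k = monomialWt θ lam l) (hk : k θ = 0) (hl : l θ = 0) :
    ∑ α : PosRoot b, (k α : ℤ) * b.height α.1 = ∑ α : PosRoot b, (l α : ℤ) * b.height α.1 := by
  classical
  have aux (m : PosRoot b →₀ ℕ) (hm : m θ = 0) :
      ∑ α : PosRoot b, (if α = θ then (m α : ℤ) else -(m α : ℤ)) * b.height α.1 =
        -∑ α : PosRoot b, (m α : ℤ) * b.height α.1 := by
    rw [← Finset.sum_neg_distrib]
    refine Finset.sum_congr rfl fun α _ ↦ ?_
    split_ifs with hα
    · subst hα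
      simp [hm]
    · ring
  have h1 := sum_height_eq h
  rw [aux k hk, aux l hl] at h1
  exact neg_injective h1

/-- Without X_θ, all exponents enter the height with the same sign and a coefficient of absolute
value at least one, so the weight bounds each exponent. -/
lemma finite_setOf_monomialWt_eq (θ : PosRoot b) (lam μ : Dual ℂ H) :
    {k : PosRoot b →₀ ℕ | k θ = 0 ∧ monomialWt θ lam k = μ}.Finite := by
  classical
  rcases Set.eq_empty_or_nonempty {k : PosRoot b →₀ ℕ | k θ = 0 ∧ monomialWt θ lam k = μ}
    with h | ⟨l, hl0, hl⟩
  · rw [h]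
    exact Set.finite_empty
  · have hnonneg (m : PosRoot b →₀ ℕ) (α : PosRoot b) : 0 ≤ (m α : ℤ) * b.height α.1 :=
      mul_nonneg (by positivity) (by have := α.one_le_height; omega)
    obtain ⟨B, hB⟩ : ∃ B : ℕ, ∑ α : PosRoot b, (l α : ℤ) * b.height α.1 = B :=
      Int.eq_ofNat_of_zero_le (Finset.sum_nonneg fun α _ ↦ hnonneg l α)
    refine (Set.finite_Icc (0 : PosRoot b →₀ ℕ) (Finsupp.equivFunOnFinite.symm fun _ ↦ B)).subset ?_
    rintro k ⟨hk0, hk⟩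
    refine ⟨zero_le, fun α ↦ ?_⟩
    have h1 := sum_height_eq_of_apply_eq_zero (hk.trans hl.symm) hk0 hl0
    have h2 := Finset.single_le_sum (fun α _ ↦ hnonneg k α) (Finset.mem_univ α)
    rw [h1, hB] at h2
    have h3 := α.one_le_height
    have h4 : (k α : ℤ) ≤ B := by nlinarith [Int.natCast_nonneg (k α)]
    simpa using h4

/-- Relative to the constant 1, monomials free of X_θ have height at most 0, while positive powers
of X_θ have positive height. -/
lemma monomialWt_ne (θ : PosRoot b) (lam : Dual ℂ H) {k : PosRoot b →₀ ℕ} (hk : k θ = 0) (n : ℕ) :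
    monomialWt θ lam k ≠ monomialWt θ lam (Finsupp.single θ (n + 1)) := by
  classical
  intro h
  have h1 := sum_height_eq h
  have h2 : ∑ α : PosRoot b, (if α = θ then (k α : ℤ) else -(k α : ℤ)) * b.height α.1 ≤ 0 := by
    refine Finset.sum_nonpos fun α _ ↦ ?_
    have := α.one_le_height
    split_ifs with hα
    · subst hα
      simp [hk]
    · nlinarith [Int.natCast_nonneg (k α)]
  have h3 : ∑ α : PosRoot b, (if α = θ then ((Finsupp.single θ (n + 1) : PosRoot b →₀ ℕ) α : ℤ)
      else -((Finsupp.single θ (n + 1) : PosRoot b →₀ ℕ) α : ℤ)) * b.height α.1 =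
      ((n + 1 : ℕ) : ℤ) * b.height θ.1 := by
    rw [Finset.sum_eq_single θ]
    · simp
    · intro α _ hα
      simp [hα]
    · simp
  rw [h1, h3] at h2
  have := θ.one_le_height
  push_cast at h2
  nlinarith

variable (f : Basis (PosRoot b) ℂ (nilBar b))

/-- For α ≠ θ the Fourier transform turns x_α ∂_α into -∂_α X_α, with eigenvalue -(k_α + 1) on a
monomial; for θ the eigenvalue is k_θ. This explains the form of `monomialWt`. -/
lemma coeff_gtRep_diffOp_cartan (hf : ∀ α : PosRoot b, (f α : g) ∈ rootSpace H (-(α.form : H → ℂ)))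
    (θ : PosRoot b) (lam : Dual ℂ H) (h : H) (k : PosRoot b →₀ ℕ)
    (p : MvPolynomial (PosRoot b) ℂ) :
    MvPolynomial.coeff k (gtRep θ (diffOp f lam (h : g)) p) =
      monomialWt θ lam k h * MvPolynomial.coeff k p := by
  classical
  have key (α : PosRoot b) : MvPolynomial.coeff k (gtRep θ (Weyl.x α * Weyl.d α) p) =
      (if α = θ then (k α : ℂ) else -(k α + 1)) * MvPolynomial.coeff k p := by
    rw [map_mul, End.mul_apply]
    split_ifs with hα
    · subst hα
      rw [gtRep_x_self, gtRep_d_self, mulX_apply, pd_apply, coeff_X_mul_pderiv]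
    · rw [gtRep_x_of_ne hα, gtRep_d_of_ne hα, LinearMap.neg_apply, mulX_apply, pd_apply,
        MvPolynomial.coeff_neg, coeff_pderiv_X_mul, neg_mul]
  rw [diffOp_cartan f hf, map_add, map_sum, AlgHom.commutes, LinearMap.add_apply,
    LinearMap.sum_apply, MvPolynomial.coeff_add, MvPolynomial.coeff_sum,
    Module.algebraMap_end_apply, MvPolynomial.coeff_smul]
  simp only [map_smul, LinearMap.smul_apply, MvPolynomial.coeff_smul, key, monomialWt,
    LinearMap.add_apply, LinearMap.sum_apply, smul_eq_mul, add_mul, Finset.sum_mul]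
  rw [add_comm]
  congr 1
  refine Finset.sum_congr rfl fun α _ ↦ ?_
  ring

variable (hf : ∀ α : PosRoot b, (f α : g) ∈ rootSpace H (-(α.form : H → ℂ)))

lemma gtEquiv_mem_wtSpace_iff (θ : PosRoot b) (lam μ : Dual ℂ H)
    (p : MvPolynomial (PosRoot b) ℂ) :
    gtEquiv θ (diffOpHom f hf lam) p ∈ wtSpace H (GTModule θ (diffOpHom f hf lam)) μ ↔
      ∀ k, MvPolynomial.coeff k p ≠ 0 → monomialWt θ lam k = μ := by
  have key (h : H) : ⁅(h : g), gtEquiv θ (diffOpHom f hf lam) p⁆ =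
      μ h • gtEquiv θ (diffOpHom f hf lam) p ↔
      ∀ k, monomialWt θ lam k h * MvPolynomial.coeff k p = μ h * MvPolynomial.coeff k p := by
    rw [lie_gtEquiv, ← map_smul, (gtEquiv θ (diffOpHom f hf lam)).injective.eq_iff,
      MvPolynomial.ext_iff]
    refine forall_congr' fun k ↦ ?_
    rw [MvPolynomial.coeff_smul, smul_eq_mul, ← coeff_gtRep_diffOp_cartan f hf θ lam]
    rfl
  rw [mem_wtSpace]
  simp only [key]
  refine ⟨fun H k hk ↦ LinearMap.ext fun h ↦ mul_right_cancel₀ hk (H h k), fun H h k ↦ ?_⟩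
  by_cases hk : MvPolynomial.coeff k p = 0
  · rw [hk, mul_zero, mul_zero]
  · rw [H k hk]

lemma gtEquiv_monomial_mem_wtSpace (θ : PosRoot b) (lam : Dual ℂ H) (k : PosRoot b →₀ ℕ) (c : ℂ) :
    gtEquiv θ (diffOpHom f hf lam) (MvPolynomial.monomial k c) ∈
      wtSpace H (GTModule θ (diffOpHom f hf lam)) (monomialWt θ lam k) := by
  classical
  rw [gtEquiv_mem_wtSpace_iff]
  intro l hl
  rw [MvPolynomial.coeff_monomial] at hl
  rw [show k = l by by_contra h; exact hl (if_neg h)]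

lemma iSup_wtSpace_gtModule (θ : PosRoot b) (lam : Dual ℂ H) :
    ⨆ μ : Dual ℂ H, wtSpace H (GTModule θ (diffOpHom f hf lam)) μ = ⊤ := by
  rw [eq_top_iff]
  intro v _
  obtain ⟨p, rfl⟩ := (gtEquiv θ (diffOpHom f hf lam)).surjective v
  rw [← MvPolynomial.support_sum_monomial_coeff p, map_sum]
  exact sum_mem fun k _ ↦ le_iSup (wtSpace H (GTModule θ (diffOpHom f hf lam))) _
    (gtEquiv_monomial_mem_wtSpace f hf θ lam k _)

lemma isWeightModule_of_iSup_wtSpace {M : Type*} [AddCommGroup M] [Module ℂ M] [LieRingModule g M]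
    [LieModule ℂ g M] (hM : ⨆ μ : Dual ℂ H, wtSpace H M μ = ⊤) : IsWeightModule M H := by
  classical
  have key : DirectSum.IsInternal fun μ : Dual ℂ H ↦
      (LieModule.weightSpace M (μ : H → ℂ)).toSubmodule := by
    rw [DirectSum.isInternal_submodule_iff_iSupIndep_and_iSup_eq_top]
    exact ⟨iSupIndep_genWeightSpace_dual.mono wtSpace_le_genWeightSpace, hM⟩
  unfold IsWeightModule
  convert key

/-- Root spaces are one-dimensional, so f₀ is a nonzero multiple of f_θ, which acts as -∂_θ. -/
lemma exists_gtRep_lowestRoot {θ : PosRoot b} (hθ : IsMaximalRoot θ) (lam : Dual ℂ H) {f₀ : g}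
    (hf₀ : f₀ ∈ rootSpace H (-(θ.form : H → ℂ))) (h0 : f₀ ≠ 0) :
    ∃ c : ℂ, c ≠ 0 ∧ ∀ p, gtRep θ (diffOpHom f hf lam f₀) p = c • MvPolynomial.pderiv θ p := by
  have h1 : (f θ : g) ≠ 0 := fun h ↦ f.ne_zero θ (Subtype.ext h)
  have hrank := finrank_rootSpace_eq_one (-θ.1.1) (by simpa using θ.isNonZero)
  have h2 : (⟨f θ, hf θ⟩ : rootSpace H (-θ.1.1)) ≠ 0 := fun h ↦ h1 (congrArg Subtype.val h)
  obtain ⟨c, hc⟩ := (finrank_eq_one_iff_of_nonzero' _ h2).mp hrank ⟨f₀, hf₀⟩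
  have hc' : c • (f θ : g) = f₀ := congrArg Subtype.val hc
  refine ⟨-c, ?_, fun p ↦ ?_⟩
  · rintro h
    rw [neg_eq_zero.mp h, zero_smul] at hc'
    exact h0 hc'.symm
  · have h3 : diffOpHom f hf lam (f θ : g) = -Weyl.d θ := diffOp_maximalRoot f hf hθ lam
    rw [← hc', map_smul, h3, map_smul, map_neg, gtRep_d_self]
    simp

lemma exists_toEnd_pow_eq_zero {θ : PosRoot b} {lam : Dual ℂ H} {f₀ : g} {c : ℂ}
    (h : ∀ p, gtRep θ (diffOpHom f hf lam f₀) p = c • MvPolynomial.pderiv θ p)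
    (v : GTModule θ (diffOpHom f hf lam)) :
    ∃ n : ℕ, (LieModule.toEnd ℂ g (GTModule θ (diffOpHom f hf lam)) f₀ ^ n) v = 0 := by
  obtain ⟨p, rfl⟩ := (gtEquiv θ (diffOpHom f hf lam)).surjective v
  have key (n : ℕ) : ∀ p : MvPolynomial (PosRoot b) ℂ,
      (∀ k, n ≤ k θ → MvPolynomial.coeff k p = 0) →
      (LieModule.toEnd ℂ g (GTModule θ (diffOpHom f hf lam)) f₀ ^ n)
        (gtEquiv θ (diffOpHom f hf lam) p) = 0 := by
    induction n with
    | zero =>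
      intro p hp
      have : p = 0 := MvPolynomial.ext _ _ fun k ↦ by
        rw [hp k (Nat.zero_le _), MvPolynomial.coeff_zero]
      rw [this, map_zero, map_zero]
    | succ n ih =>
      intro p hp
      rw [pow_succ, End.mul_apply, LieModule.toEnd_apply_apply, lie_gtEquiv, h]
      refine ih _ fun k hk ↦ ?_
      rw [MvPolynomial.coeff_smul, MvPolynomial.coeff_pderiv,
        hp _ (by rw [Finsupp.add_apply, Finsupp.single_eq_same]; omega), zero_mul, smul_zero]
  refine ⟨p.degreeOf θ + 1, key _ p fun k hk ↦ ?_⟩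
  by_contra hne
  have := MvPolynomial.degreeOf_le_iff.mp (le_refl (p.degreeOf θ)) k
    (MvPolynomial.mem_support_iff.mpr hne)
  omega

/-- The vectors killed by `f₀` do not involve `x_θ`. -/
lemma apply_eq_zero_of_lie_eq_zero {θ : PosRoot b} {lam : Dual ℂ H} {f₀ : g} {c : ℂ} (hc : c ≠ 0)
    (h : ∀ p, gtRep θ (diffOpHom f hf lam f₀) p = c • MvPolynomial.pderiv θ p)
    {p : MvPolynomial (PosRoot b) ℂ} (hp : ⁅f₀, gtEquiv θ (diffOpHom f hf lam) p⁆ = 0)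
    {k : PosRoot b →₀ ℕ} (hk : MvPolynomial.coeff k p ≠ 0) : k θ = 0 := by
  rw [lie_gtEquiv, h, map_smul, smul_eq_zero_iff_right hc,
    (gtEquiv θ (diffOpHom f hf lam)).map_eq_zero_iff] at hp
  have h1 := coeff_X_mul_pderiv θ k p
  rw [hp, mul_zero, MvPolynomial.coeff_zero, eq_comm, mul_eq_zero] at h1
  exact_mod_cast h1.resolve_right hk

lemma finiteDimensional_killedBy_one {θ : PosRoot b} {lam : Dual ℂ H} {f₀ : g} {c : ℂ}
    (hc : c ≠ 0) (h : ∀ p, gtRep θ (diffOpHom f hf lam f₀) p = c • MvPolynomial.pderiv θ p)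
    (μ : Dual ℂ H) :
    FiniteDimensional ℂ (killedBy H (GTModule θ (diffOpHom f hf lam)) f₀ μ 1) := by
  have hle : killedBy H (GTModule θ (diffOpHom f hf lam)) f₀ μ 1 ≤
      Submodule.span ℂ ((fun k ↦ gtEquiv θ (diffOpHom f hf lam) (MvPolynomial.monomial k 1)) ''
        {k : PosRoot b →₀ ℕ | k θ = 0 ∧ monomialWt θ lam k = μ}) := by
    rintro v ⟨hv1, hv2⟩
    obtain ⟨p, rfl⟩ := (gtEquiv θ (diffOpHom f hf lam)).surjective v
    rw [SetLike.mem_coe, LinearMap.mem_ker, pow_one] at hv2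
    rw [← MvPolynomial.support_sum_monomial_coeff p, map_sum]
    refine sum_mem fun k hk ↦ ?_
    rw [MvPolynomial.mem_support_iff] at hk
    rw [← mul_one (MvPolynomial.coeff k p), ← smul_eq_mul, ← MvPolynomial.smul_monomial, map_smul]
    exact Submodule.smul_mem _ _ (Submodule.subset_span ⟨k,
      ⟨apply_eq_zero_of_lie_eq_zero f hf hc h hv2 hk,
        (gtEquiv_mem_wtSpace_iff f hf θ lam μ p).mp hv1 k hk⟩, rfl⟩)
  have := FiniteDimensional.span_of_finite ℂ ((finite_setOf_monomialWt_eq θ lam μ).image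
    fun k ↦ gtEquiv θ (diffOpHom f hf lam) (MvPolynomial.monomial k 1))
  exact Submodule.finiteDimensional_of_le hle

end Main

/-! ### Cyclicity -/

section Cyclic

variable {g : Type*} [LieRing g] [LieAlgebra ℂ g]
  [FiniteDimensional ℂ g] [LieAlgebra.IsSimple ℂ g]
  {H : LieSubalgebra ℂ g} [H.IsCartanSubalgebra] {b : (rootSystem H).Base}
  (f : Basis (PosRoot b) ℂ (nilBar b))
  (hf : ∀ α : PosRoot b, (f α : g) ∈ rootSpace H (-(α.form : H → ℂ)))

lemma exists_forall_ge_add_ne (ν : ℂ) : ∃ N : ℕ, ∀ n : ℕ, N ≤ n → ν + n ≠ 0 := by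
  by_cases h : ∃ m : ℕ, ν + m = 0
  · obtain ⟨m, hm⟩ := h
    refine ⟨m + 1, fun n hn h ↦ ?_⟩
    have : (m : ℂ) = n := by linear_combination hm - h
    have : m = n := by exact_mod_cast this
    omega
  · push Not at h
    exact ⟨0, fun n _ ↦ h n⟩

/-- The powers of `x_θ`. -/
def thetaVec (θ : PosRoot b) (lam : Dual ℂ H) (n : ℕ) : GTModule θ (diffOpHom f hf lam) :=
  gtEquiv θ (diffOpHom f hf lam) (MvPolynomial.monomial (Finsupp.single θ n) 1)

lemma thetaVec_mem_wtSpace (θ : PosRoot b) (lam : Dual ℂ H) (n : ℕ) : thetaVec f hf θ lam n ∈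
    wtSpace H (GTModule θ (diffOpHom f hf lam)) (monomialWt θ lam (Finsupp.single θ n)) :=
  gtEquiv_monomial_mem_wtSpace f hf θ lam _ 1

lemma monomialWt_single_succ (θ : PosRoot b) (lam : Dual ℂ H) (n : ℕ) :
    monomialWt θ lam (Finsupp.single θ (n + 1)) =
      monomialWt θ lam (Finsupp.single θ n) + θ.form := by
  rw [Finsupp.single_add, monomialWt_add_single]

variable {θ : PosRoot b} {lam : Dual ℂ H} {h₀ e₀ f₀ : g} {c : ℂ}

lemma lie_thetaVec (h : ∀ p, gtRep θ (diffOpHom f hf lam f₀) p = c • MvPolynomial.pderiv θ p)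
    (n : ℕ) : ⁅f₀, thetaVec f hf θ lam (n + 1)⁆ = (c * (n + 1)) • thetaVec f hf θ lam n := by
  rw [thetaVec, lie_gtEquiv, h, MvPolynomial.pderiv_monomial, Finsupp.single_eq_same,
    ← Finsupp.single_tsub, Nat.add_sub_cancel, one_mul, thetaVec, ← map_smul, map_smul,
    map_smul, mul_smul, ← map_smul _ ((n : ℂ) + 1), MvPolynomial.smul_monomial]
  simp

lemma lie_thetaVec_zero (h : ∀ p, gtRep θ (diffOpHom f hf lam f₀) p = c • MvPolynomial.pderiv θ p) :
    ⁅f₀, thetaVec f hf θ lam 0⁆ = 0 := by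
  rw [thetaVec, lie_gtEquiv, h, MvPolynomial.pderiv_monomial]
  simp

/-- The kernel of f₀ consists of polynomials free of X_θ, and by `monomialWt_ne` none of their
monomials has the weight of X_θ^{n+1}. -/
lemma eq_zero_of_lie_eq_zero (hc : c ≠ 0)
    (h : ∀ p, gtRep θ (diffOpHom f hf lam f₀) p = c • MvPolynomial.pderiv θ p) {n : ℕ}
    {v : GTModule θ (diffOpHom f hf lam)}
    (hv : v ∈ wtSpace H (GTModule θ (diffOpHom f hf lam))
      (monomialWt θ lam (Finsupp.single θ (n + 1)))) (hv0 : ⁅f₀, v⁆ = 0) : v = 0 := by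
  obtain ⟨p, rfl⟩ := (gtEquiv θ (diffOpHom f hf lam)).surjective v
  suffices p = 0 by rw [this, map_zero]
  refine MvPolynomial.ext _ _ fun k ↦ ?_
  rw [MvPolynomial.coeff_zero]
  by_contra hk
  exact monomialWt_ne θ lam (apply_eq_zero_of_lie_eq_zero f hf hc h hv0 hk) n
    ((gtEquiv_mem_wtSpace_iff f hf θ lam _ p).mp hv k hk)

/-- The action of the raising operator on the powers of `x_θ`. -/
lemma lie_raising_thetaVec (t : IsSl2Triple h₀ e₀ f₀) (he : e₀ ∈ rootSpace H (θ.form : H → ℂ))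
    {h' : H} (hh' : (h' : g) = h₀) (hθ' : θ.form h' = 2) (hc : c ≠ 0)
    (h : ∀ p, gtRep θ (diffOpHom f hf lam f₀) p = c • MvPolynomial.pderiv θ p) (n : ℕ) :
    ⁅e₀, thetaVec f hf θ lam n⁆ = (-(monomialWt θ lam 0 h' + n) / c) •
      thetaVec f hf θ lam (n + 1) := by
  have hwt (n : ℕ) : ⁅h₀, thetaVec f hf θ lam n⁆ =
      (monomialWt θ lam 0 h' + 2 * n) • thetaVec f hf θ lam n := by
    rw [← hh', mem_wtSpace.mp (thetaVec_mem_wtSpace f hf θ lam n)]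
    congr 1
    induction n with
    | zero => simp
    | succ n ih =>
      rw [monomialWt_single_succ, LinearMap.add_apply, ih, hθ']
      push_cast
      ring
  -- No formula for π(e₀) is needed: f₀ is injective on this weight space, so both sides may be
  -- compared after applying f₀. With ν the h₀-weight of 1, the sl₂ relations give c (n+1) a_n = c n
  -- a_{n-1} - (ν + 2n), solved by a_n = -(ν + n)/c.
  have hmem (n : ℕ) (a : ℂ) : ⁅e₀, thetaVec f hf θ lam n⁆ - a • thetaVec f hf θ lam (n + 1) ∈
      wtSpace H (GTModule θ (diffOpHom f hf lam))
        (monomialWt θ lam (Finsupp.single θ (n + 1))) := by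
    refine sub_mem ?_ (Submodule.smul_mem _ _ (thetaVec_mem_wtSpace f hf θ lam (n + 1)))
    rw [monomialWt_single_succ]
    exact lie_mem_wtSpace he (thetaVec_mem_wtSpace f hf θ lam n)
  have hcomm (v : GTModule θ (diffOpHom f hf lam)) : ⁅f₀, ⁅e₀, v⁆⁆ = ⁅e₀, ⁅f₀, v⁆⁆ - ⁅h₀, v⁆ := by
    rw [leibniz_lie e₀ f₀ v, t.lie_e_f, add_sub_cancel_left]
  induction n with
  | zero =>
    refine sub_eq_zero.mp (eq_zero_of_lie_eq_zero f hf hc h (hmem 0 _) ?_)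
    rw [lie_sub, lie_smul, lie_thetaVec f hf h, hcomm, lie_thetaVec_zero f hf h, lie_zero, hwt,
      smul_smul, ← neg_zero, ← sub_eq_zero]
    match_scalars
    field_simp
    ring
  | succ n ih =>
    refine sub_eq_zero.mp (eq_zero_of_lie_eq_zero f hf hc h (hmem (n + 1) _) ?_)
    rw [lie_sub, lie_smul, lie_thetaVec f hf h, hcomm, lie_thetaVec f hf h, lie_smul, ih, hwt]
    match_scalars
    field_simp
    ring

lemma thetaVec_mem_of_le (hc : c ≠ 0)
    (h : ∀ p, gtRep θ (diffOpHom f hf lam f₀) p = c • MvPolynomial.pderiv θ p)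
    {S : LieSubmodule ℂ g (GTModule θ (diffOpHom f hf lam))} {n : ℕ}
    (hn : thetaVec f hf θ lam n ∈ S) {m : ℕ} (hm : m ≤ n) : thetaVec f hf θ lam m ∈ S := by
  induction n, hm using Nat.le_induction with
  | base => exact hn
  | succ n hmn ih =>
    refine ih ?_
    have h1 := S.lie_mem (x := f₀) hn
    rw [lie_thetaVec f hf h] at h1
    have h2 : c * ((n : ℂ) + 1) ≠ 0 := mul_ne_zero hc (Nat.cast_add_one_ne_zero n)
    exact (Submodule.smul_mem_iff S.toSubmodule h2).mp h1

/-- A submodule that contains the powers of `x_θ` is everything. -/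
lemma eq_top_of_forall_thetaVec_mem (hθ : IsMaximalRoot θ)
    (S : LieSubmodule ℂ g (GTModule θ (diffOpHom f hf lam)))
    (hS : ∀ n, thetaVec f hf θ lam n ∈ S) : S = ⊤ := by
  -- Induction on the degree in the variables other than X_θ, starting from the powers of X_θ.
  have key (d : ℕ) : ∀ k : PosRoot b →₀ ℕ, degOff θ k < d →
      gtEquiv θ (diffOpHom f hf lam) (MvPolynomial.monomial k 1) ∈ S := by
    induction d with
    | zero => exact fun k hk ↦ absurd hk (Nat.not_lt_zero _)
    | succ d ih =>
      have hG : ∀ p ∈ degOffLT θ d, gtEquiv θ (diffOpHom f hf lam) p ∈ S := by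
        intro p hp
        rw [← MvPolynomial.support_sum_monomial_coeff p, map_sum]
        refine sum_mem fun k hk ↦ ?_
        rw [MvPolynomial.mem_support_iff] at hk
        rw [← mul_one (MvPolynomial.coeff k p), ← smul_eq_mul, ← MvPolynomial.smul_monomial,
          map_smul]
        exact S.smul_mem _ (ih k (by by_contra hcon; exact hk (hp k (not_lt.mp hcon))))
      have hstep : ∀ α, α ≠ θ → ∀ q ∈ degOffLT θ d,
          gtEquiv θ (diffOpHom f hf lam) (MvPolynomial.X α * q) ∈ S := by
        intro α hα q hq
        obtain ⟨p, hp, hα'⟩ := exists_diffOp_negRoot f hf hθ (lowering θ)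
          (fun γ hγ ↦ X_mem_lowering hγ) (fun γ hγ p hp ↦ X_mul_mem_lowering hγ hp) lam α
        have h1 : gtRep θ (diffOpHom f hf lam (f α : g)) q = -(MvPolynomial.X α * q) -
            ∑ β, gtRep θ (Weyl.ofPoly (p β)) (gtRep θ (Weyl.d β) q) := by
          change gtRep θ (diffOp f lam (f α : g)) q = _
          rw [hα', map_sub, map_neg, map_sum, gtRep_d_of_ne hα]
          simp
        -- The factor ∂_β raises this degree by at most one and p_β lowers it again, so the
        -- correction is covered by the induction hypothesis.
        have h2 : ∑ β, gtRep θ (Weyl.ofPoly (p β)) (gtRep θ (Weyl.d β) q) ∈ degOffLT θ d := by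
          refine sum_mem fun β _ ↦ hp β d _ ?_
          by_cases hβ : β = θ
          · rw [hβ, gtRep_d_self]
            exact degOffLT_mono θ (Nat.le_succ d) (pderiv_mem_degOffLT hq)
          · rw [gtRep_d_of_ne hβ]
            exact X_mul_mem_degOffLT hβ hq
        have h3 := S.lie_mem (x := (f α : g)) (hG q hq)
        rw [lie_gtEquiv, h1, map_sub, map_neg] at h3
        have h4 := neg_mem (add_mem h3 (hG _ h2))
        rwa [sub_add_cancel, neg_neg] at h4
      intro k hk
      by_cases h0 : k.erase θ = 0
      · have hk' : k = Finsupp.single θ (k θ) := by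
          conv_lhs => rw [← Finsupp.erase_add_single θ k, h0, zero_add]
        rw [hk']
        exact hS _
      · obtain ⟨α, hα⟩ := Finsupp.ne_iff.mp h0
        have hαθ : α ≠ θ := by
          rintro rfl
          exact hα (by simp)
        rw [Finsupp.erase_ne hαθ, Finsupp.zero_apply] at hα
        have h1 : Finsupp.single α 1 ≤ k := by
          rw [Finsupp.single_le_iff]
          omega
        have h2 : k - Finsupp.single α 1 + Finsupp.single α 1 = k := tsub_add_cancel_of_le h1
        have h3 := hstep α hαθ (MvPolynomial.monomial (k - Finsupp.single α 1) 1) (by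
          classical
          intro l hl
          rw [MvPolynomial.coeff_monomial]
          refine if_neg ?_
          rintro rfl
          rw [← h2, degOff_add_single_of_ne hαθ] at hk
          omega)
        rwa [MvPolynomial.X, MvPolynomial.monomial_mul, one_mul, add_comm, h2] at h3
  rw [eq_top_iff]
  intro v _
  obtain ⟨p, rfl⟩ := (gtEquiv θ (diffOpHom f hf lam)).surjective v
  rw [← MvPolynomial.support_sum_monomial_coeff p, map_sum]
  refine sum_mem fun k _ ↦ ?_
  rw [← mul_one (MvPolynomial.coeff k p), ← smul_eq_mul, ← MvPolynomial.smul_monomial, map_smul]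
  exact S.smul_mem _ (key _ k (Nat.lt_succ_self _))

/-- The generator is x_θ^N with N beyond the only possible zero of n ↦ ν + n, where ν is the
h₀-weight of 1. From there e₀ reaches all higher powers and f₀ all lower ones. -/
theorem isCyclicModule_gtModule (hθ : IsMaximalRoot θ) (t : IsSl2Triple h₀ e₀ f₀)
    (he : e₀ ∈ rootSpace H (θ.form : H → ℂ)) (hf₀ : f₀ ∈ rootSpace H (-(θ.form : H → ℂ)))
    (hc : c ≠ 0) (h : ∀ p, gtRep θ (diffOpHom f hf lam f₀) p = c • MvPolynomial.pderiv θ p) :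
    IsCyclicModule g (GTModule θ (diffOpHom f hf lam)) := by
  obtain ⟨h', hh', hθ'⟩ := exists_cartan_eq t he hf₀
  obtain ⟨N, hN⟩ := exists_forall_ge_add_ne (monomialWt θ lam 0 h')
  refine ⟨thetaVec f hf θ lam N, eq_top_of_forall_thetaVec_mem f hf hθ _ ?_⟩
  have h1 (n : ℕ) (hn : N ≤ n) : thetaVec f hf θ lam n ∈
      LieSubmodule.lieSpan ℂ g {thetaVec f hf θ lam N} := by
    induction n, hn using Nat.le_induction with
    | base => exact LieSubmodule.subset_lieSpan rfl
    | succ n hn ih =>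
      have h2 := LieSubmodule.lie_mem _ (x := e₀) ih
      rw [lie_raising_thetaVec f hf t he hh' hθ' hc h] at h2
      exact (Submodule.smul_mem_iff (LieSubmodule.toSubmodule _)
        (div_ne_zero (neg_ne_zero.mpr (hN n hn)) hc)).mp h2
  intro n
  exact thetaVec_mem_of_le f hf hc h (h1 (max N n) (le_max_left _ _)) (le_max_right _ _)

end Cyclic

end ThetaGT

end

/-! ### The main theorem. -/

theorem mainTheorem1 {g : Type*} [LieRing g] [LieAlgebra ℂ g] [FiniteDimensional ℂ g]
    [LieAlgebra.IsSimple ℂ g] (H : LieSubalgebra ℂ g) [H.IsCartanSubalgebra]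
    (b : (LieAlgebra.IsKilling.rootSystem H).Base)
    (θ : ThetaGT.PosRoot b) (hθ : ThetaGT.IsMaximalRoot θ)
    (f : Module.Basis (ThetaGT.PosRoot b) ℂ (ThetaGT.nilBar b))
    (hf : ∀ α : ThetaGT.PosRoot b, (f α : g) ∈ LieAlgebra.rootSpace H (-(α.form : H → ℂ)))
    (lam : Module.Dual ℂ H) :
    (∀ y ∈ ThetaGT.gammaTheta θ, ∀ z ∈ ThetaGT.gammaTheta θ, y * z = z * y) ∧
    Function.Bijective (ThetaGT.gtPolyMap θ) ∧
    ∃ Φ : g →ₗ⁅ℂ⁆ ThetaGT.Weyl (ThetaGT.PosRoot b),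
      (∀ a : g, Φ a = ThetaGT.diffOp f (lam + ThetaGT.rho b) a) ∧
      ThetaGT.IsWeightModule (ThetaGT.GTModule θ Φ) H ∧
      ThetaGT.IsCyclicModule g (ThetaGT.GTModule θ Φ) ∧
      ThetaGT.IsGammaWeightModule (ThetaGT.GTModule θ Φ) (ThetaGT.gammaTheta θ) ∧
      ThetaGT.HasFiniteGammaMultiplicities (ThetaGT.GTModule θ Φ) (ThetaGT.gammaTheta θ) := by
  obtain ⟨h₀, e₀, f₀, t, he, hf₀⟩ := ThetaGT.exists_sl2Triple θ
  obtain ⟨c, hc, h⟩ :=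
    ThetaGT.exists_gtRep_lowestRoot f hf hθ (lam + ThetaGT.rho b) hf₀ t.f_ne_zero
  -- The two statements on Γ_θ use only three properties of the module: it is spanned by weight
  -- vectors, f₀ is locally nilpotent, and f₀ has finite-dimensional kernel on each weight space.
  have hM := ThetaGT.iSup_wtSpace_gtModule f hf θ (lam + ThetaGT.rho b)
  have hnil := ThetaGT.exists_toEnd_pow_eq_zero f hf h
  have hfin := ThetaGT.finiteDimensional_killedBy_one f hf hc h
  exact ⟨ThetaGT.gammaTheta_mul_comm θ, ThetaGT.gtPolyMap_bijective θ,
    ThetaGT.diffOpHom f hf (lam + ThetaGT.rho b), fun _ ↦ rfl,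
    ThetaGT.isWeightModule_of_iSup_wtSpace hM,
    ThetaGT.isCyclicModule_gtModule f hf hθ t he hf₀ hc h,
    ThetaGT.isGammaWeightModule_of_locallyNilpotent t he hf₀ hM hnil hfin,
    ThetaGT.hasFiniteGammaMultiplicities_of_locallyNilpotent t he hf₀ hM hnil hfin⟩
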